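/- **Setting.** Let $n,m\ge 0$ and $r\ge 1$ be integers. Let $A\in\mathbb R^{n\times n}$, $B\in\mathbb R^{n\times m}$, $C\in\mathbb R^{m\times n}$ be such that the system $\dot x=Ax+Bu$, $y=Cx$ belongs to the class $\Sigma_{m,r}$, that is: * (strict relative degree $r$) $CA^kB=0$ for $k=0,\dots,r-2$, and $\Gamma:=CA^{r-1}B$ is invertible; * (minimum phase) $\operatorname{rk}\begin{bmatrix}A-\lambda I_n&B\\C&0\end{bmatrix}=n+m$ for all $\lambda\in\mathbb C$ with $\operatorname{Re}\lambda\ge0$; * $\Gamma$ is positive definite, in the sense that $v^\top\Gamma v>0$ for all $v\neq0$ ($\Gamma$ need not be symmetric). Let $\alpha\in\mathbb R[s]$ be monic of degree $p$ such that the above rank equals $n+m$ at every $\lambda\in\mathbb C$ with $\alpha(\lambda)=0$, and let $$\mathcal R(\alpha)=\{w\in C^\infty(\mathbb R_{\ge0},\mathbb R^m) : \alpha(\tfrac{d}{dt})w=0\}.$$ Let $(\tilde A,\tilde B,\tilde C,I_m)$ be an internal model of $\mathcal R(\alpha)$: $\tilde A=\operatorname{diag}(\hat A,\dots,\hat A)\in\mathbb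 R^{mp\times mp}$, $\tilde B=\operatorname{diag}(\hat b,\dots,\hat b)\in\mathbb R^{mp\times m}$, $\tilde C=\operatorname{diag}(\hat c,\dots,\hat c)\in\mathbb R^{m\times mp}$, where $(\hat A,\hat b,\hat c,1)$ with $\hat A\in\mathbb R^{p\times p}$ is a minimal (controllable and observable) realization of $\beta/\alpha$, for some $\beta\in\mathbb R[s]$ all of whose roots have negative real part, which is coprime to $\alpha$, has degree $p$, and satisfies $\lim_{s\to\infty}\beta(s)/\alpha(s)=1$. Let $\Phi$ be the set of $\varphi\in C^1(\mathbb R_{\ge0},\mathbb R)$ with $\varphi,\dot\varphi$ bounded, $\varphi(t)>0$ for $t>0$ and $\liminf_{t\to\infty}\varphi(t)>0$. Let $x^0\in\mathbb R^n$, $z^0\in\mathbb R^{mp}$, $y_{\rm ref}\in\mathcal R(\alpha)$, $\varphi_1,\dots,\varphi_r\in\Phi$ and $k_1,\dots,k_{r-1}>0$. For $k_r>0$ consider the closed loop $$\dot x=Ax+Bu,\quad y=Cx,\quad \dot z=\tilde Az+\tilde Bw,\quad u=\tilde Cz+w,\quad x(0)=x^0,\ z(0)=z^0,$$ $$e_1=e=y-y_{\rm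 ref},\quad e_{i+1}=\dot e_i+k_ie_i\ (1\le i\le r-1),\quad k(t)=\frac{k_r}{1-\varphi_r(t)^2\|e_r(t)\|^2},\quad w(t)=-k(t)e_r(t).$$ Assume * (K1) $k_i>\big\|\dot\varphi_i/\varphi_i\big\|_\infty+\big\|\varphi_i/\varphi_{i+1}\big\|_\infty$ for $i=1,\dots,r-1$; * (K2) $\varphi_i(0)\|e_i(0)\|<1$ for $i=1,\dots,r$, where $e_i(0)$ is computed from the initial data by $y^{(j)}(0)=CA^jx^0$ for $0\le j\le r-1$. A solution on $[0,\omega)$, $\omega\in(0,\infty]$, is a locally absolutely continuous $(x,z):[0,\omega)\to\mathbb R^n\times\mathbb R^{mp}$ which attains the initial values, for which $k(t)$ is well defined for all $t\in[0,\omega)$, and which satisfies the differential equations for almost all $t\in[0,\omega)$. It is maximal if it has no proper right extension that is also a solution. **Theorem.** For every $k_r>0$ the closed loop has a unique maximal solution $(x,z):[0,\omega)\to\mathbb R^n\times\mathbb R^{mp}$, and 1. $\omega=\infty$; 2. for each $i=1,\dots,r$ there is $\varepsilon_i\in(0,1)$ with $\varphi_i(t)\|e_i(t)\|\le\varepsilon_i$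 for all $t\ge0$; 3. $k$ is bounded, and if $y_{\rm ref}$ is bounded, then $x$, $z$ and $u$ are bounded; 4. if $k_r$ is sufficiently large (that is, $k_r\ge k_r^*$ for some $k_r^*>0$ that depends on the data above but not on $k_r$), then $\lim_{t\to\infty}e^{(i)}(t)=0$ for all $i=0,\dots,r-1$. -/

import Mathlib

open Set Filter Topology MeasureTheory Matrix Polynomial
open scoped ENNReal

noncomputable section

namespace FunnelIM

/-- The Rosenbrock matrix `[A - λ I, B; C, 0]` of `(A, B, C)` at a complex number `λ`. -/
def rosenbrock {n m : ℕ} (A : Matrix (Fin n) (Fin n) ℝ) (B : Matrix (Fin n) (Fin m) ℝ)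
    (C : Matrix (Fin m) (Fin n) ℝ) (l : ℂ) : Matrix (Fin n ⊕ Fin m) (Fin n ⊕ Fin m) ℂ :=
  fromBlocks (A.map Complex.ofReal - l • (1 : Matrix (Fin n) (Fin n) ℂ))
    (B.map Complex.ofReal) (C.map Complex.ofReal) 0

/-- Strict relative degree `r`: `C A^k B = 0` for `k = 0, …, r - 2`, and `C A^(r-1) B` is
invertible. -/
def HasStrictRelDegree {n m : ℕ} (A : Matrix (Fin n) (Fin n) ℝ) (B : Matrix (Fin n) (Fin m) ℝ)
    (C : Matrix (Fin m) (Fin n) ℝ) (r : ℕ) : Prop :=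
  (∀ k : ℕ, k + 2 ≤ r → C * A ^ k * B = 0) ∧ IsUnit (C * A ^ (r - 1) * B)

/-- Minimum phase: the Rosenbrock matrix has full rank on the closed right half plane. -/
def IsMinimumPhase {n m : ℕ} (A : Matrix (Fin n) (Fin n) ℝ) (B : Matrix (Fin n) (Fin m) ℝ)
    (C : Matrix (Fin m) (Fin n) ℝ) : Prop :=
  ∀ l : ℂ, 0 ≤ l.re → (rosenbrock A B C l).rank = n + m

/-- The system class `Σ_{m,r}`. Positive definiteness of `Γ = C A^(r-1) B` means `vᵀ Γ v > 0` for
all `v ≠ 0`; symmetry of `Γ` is not required. -/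
structure InSystemClass {n m : ℕ} (A : Matrix (Fin n) (Fin n) ℝ) (B : Matrix (Fin n) (Fin m) ℝ)
    (C : Matrix (Fin m) (Fin n) ℝ) (r : ℕ) : Prop where
  relDegree : HasStrictRelDegree A B C r
  minPhase : IsMinimumPhase A B C
  posDef : ∀ v : Fin m → ℝ, v ≠ 0 → 0 < v ⬝ᵥ ((C * A ^ (r - 1) * B) *ᵥ v)

/-- No root of `α` is a zero of `(A, B, C)`: the Rosenbrock matrix has full rank at each complex
root of `α`. -/
def RootsAvoidZeros {n m : ℕ} (A : Matrix (Fin n) (Fin n) ℝ) (B : Matrix (Fin n) (Fin m) ℝ)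
    (C : Matrix (Fin m) (Fin n) ℝ) (α : ℝ[X]) : Prop :=
  ∀ l : ℂ, aeval l α = 0 → (rosenbrock A B C l).rank = n + m

/-- The reference class `R(α)`: smooth functions `w` on `[0, ∞)` with `α(d/dt) w = 0`. A function
on `[0, ∞)` is represented by a function on `ℝ` whose values off `[0, ∞)` play no role. -/
def RefClass (m : ℕ) (α : ℝ[X]) : Set (ℝ → EuclideanSpace ℝ (Fin m)) :=
  {w | ContDiffOn ℝ ((⊤ : ℕ∞) : WithTop ℕ∞) w (Ici 0) ∧
    ∀ t, 0 ≤ t → ∑ j ∈ Finset.range (α.natDegree + 1),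
      α.coeff j • iteratedDerivWithin j w (Ici 0) t = 0}

/-- A real polynomial is Hurwitz if all its complex roots have negative real part. -/
def IsHurwitz (β : ℝ[X]) : Prop := ∀ l : ℂ, aeval l β = 0 → l.re < 0

/-- `(Â, b̂, ĉ, 1)` is a minimal (controllable and observable) realization of `β / α`, that is,
`ĉ (s I - Â)⁻¹ b̂ + 1 = β(s) / α(s)` as rational functions. -/
structure IsMinimalRealization {p : ℕ} (α β : ℝ[X]) (Ah : Matrix (Fin p) (Fin p) ℝ)
    (bh ch : Fin p → ℝ) : Prop where
  transfer :
    (fun i => algebraMap ℝ (RatFunc ℝ) (ch i)) ⬝ᵥ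
        (((charmatrix Ah).map (algebraMap ℝ[X] (RatFunc ℝ)))⁻¹ *ᵥ
          fun i => algebraMap ℝ (RatFunc ℝ) (bh i)) + 1
      = algebraMap ℝ[X] (RatFunc ℝ) β / algebraMap ℝ[X] (RatFunc ℝ) α
  controllable : Submodule.span ℝ (range fun i : ℕ => (Ah ^ i) *ᵥ bh) = ⊤
  observable : ∀ v : Fin p → ℝ, (∀ i : ℕ, ch ⬝ᵥ ((Ah ^ i) *ᵥ v) = 0) → v = 0

/-- `(Ã, B̃, C̃, I_m)` is an internal model of the class `R(α)`: for some Hurwitz polynomial `β`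
coprime to `α`, of the same degree `p`, with `β(s) / α(s) → 1` as `s → ∞`, and some minimal
realization `(Â, b̂, ĉ, 1)` of `β / α` of order `p`, the matrices are block diagonal with `m` copies
of `Â`, `b̂`, `ĉ`. The state space `ℝ^{mp}` is indexed by pairs (position in the block, block). -/
def IsInternalModel {m p : ℕ} (α : ℝ[X]) (At : Matrix (Fin p × Fin m) (Fin p × Fin m) ℝ)
    (Bt : Matrix (Fin p × Fin m) (Fin m) ℝ) (Ct : Matrix (Fin m) (Fin p × Fin m) ℝ) : Prop :=
  ∃ (β : ℝ[X]) (Ah : Matrix (Fin p) (Fin p) ℝ) (bh ch : Fin p → ℝ),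
    IsHurwitz β ∧ IsCoprime α β ∧ α.degree = (p : WithBot ℕ) ∧ β.degree = (p : WithBot ℕ) ∧
    Tendsto (fun s : ℝ => β.eval s / α.eval s) atTop (𝓝 1) ∧
    IsMinimalRealization α β Ah bh ch ∧
    At = blockDiagonal (fun _ : Fin m => Ah) ∧
    Bt = Matrix.of (fun (i : Fin p × Fin m) (j : Fin m) => if i.2 = j then bh i.1 else 0) ∧
    Ct = Matrix.of (fun (j : Fin m) (i : Fin p × Fin m) => if j = i.2 then ch i.1 else 0)

/-- The class `Φ` of funnel functions on `[0, ∞)`. -/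
structure IsFunnel (φ : ℝ → ℝ) : Prop where
  contDiffOn : ContDiffOn ℝ 1 φ (Ici 0)
  bounded : ∃ M, ∀ t, 0 ≤ t → |φ t| ≤ M
  deriv_bounded : ∃ M, ∀ t, 0 ≤ t → |derivWithin φ (Ici 0) t| ≤ M
  pos : ∀ t, 0 < t → 0 < φ t
  liminf_pos : 0 < liminf φ atTop

/-- The supremum norm over `(0, ∞)`, with value `∞` for unbounded functions. -/
def supNorm (f : ℝ → ℝ) : ℝ≥0∞ := ⨆ t ∈ Ioi (0 : ℝ), ‖f t‖ₑ

/-- The half-open time interval `[0, ω)`. -/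
def timeDomain (ω : EReal) : Set ℝ := {t | 0 ≤ t ∧ (t : EReal) < ω}

/-- The data of the closed loop, except for the gain `k_r`: the system `(A, B, C)`, the internal
model `(At, Bt, Ct, I)`, the initial values, the reference signal, and the gains and funnel
functions of the controller. Indices start at `0`: `k i` is the gain `k_{i+1}` for
`i = 0, …, r - 2`, and `φ i` is the funnel function `φ_{i+1}` for `i = 0, …, r - 1`. -/
structure LoopData (n m p : ℕ) where
  A : Matrix (Fin n) (Fin n) ℝ
  B : Matrix (Fin n) (Fin m) ℝ
  C : Matrix (Fin m) (Fin n) ℝ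
  r : ℕ
  At : Matrix (Fin p × Fin m) (Fin p × Fin m) ℝ
  Bt : Matrix (Fin p × Fin m) (Fin m) ℝ
  Ct : Matrix (Fin m) (Fin p × Fin m) ℝ
  x0 : EuclideanSpace ℝ (Fin n)
  z0 : EuclideanSpace ℝ (Fin p × Fin m)
  yref : ℝ → EuclideanSpace ℝ (Fin m)
  k : ℕ → ℝ
  φ : ℕ → ℝ → ℝ

namespace LoopData

variable {n m p : ℕ} (S : LoopData n m p)

/-- The tracking error `e = y - y_ref` with `y = C x`. -/
def trackErr (x : ℝ → EuclideanSpace ℝ (Fin n)) (t : ℝ) : EuclideanSpace ℝ (Fin m) :=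
  toEuclideanLin S.C (x t) - S.yref t

/-- The auxiliary errors on `[0, ω)`: `auxErr ω x i` is the signal `e_{i+1}`, with `e_1 = e` and
`e_{i+1} = d/dt e_i + k_i e_i`. -/
def auxErr (ω : EReal) (x : ℝ → EuclideanSpace ℝ (Fin n)) : ℕ → ℝ → EuclideanSpace ℝ (Fin m)
  | 0 => S.trackErr x
  | i + 1 => fun t =>
      derivWithin (auxErr ω x i) (timeDomain ω) t + S.k i • auxErr ω x i t

/-- `initErr i j` is the `j`-th derivative of `e_{i+1}` at time `0`, computed from the initial value
`x0` by differentiating the recursion `e_{i+1} = d/dt e_i + k_i e_i`; here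
`y^{(j)}(0) = C A^j x0` for `j ≤ r - 1`, by the strict relative degree `r`. -/
def initErr : ℕ → ℕ → EuclideanSpace ℝ (Fin m)
  | 0, j => toEuclideanLin (S.C * S.A ^ j) S.x0 - iteratedDerivWithin j S.yref (Ici 0) 0
  | i + 1, j => initErr i (j + 1) + S.k i • initErr i j

/-- Condition (K1): `k_i > ‖φ_i' / φ_i‖_∞ + ‖φ_i / φ_{i+1}‖_∞` for `i = 1, …, r - 1`. -/
def K1 : Prop :=
  ∀ i, i + 1 < S.r →
    supNorm (fun t => derivWithin (S.φ i) (Ici 0) t / S.φ i t) +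
      supNorm (fun t => S.φ i t / S.φ (i + 1) t) < ENNReal.ofReal (S.k i)

/-- Condition (K2): `φ_i(0) ‖e_i(0)‖ < 1` for `i = 1, …, r`. -/
def K2 : Prop := ∀ i, i < S.r → S.φ i 0 * ‖S.initErr i 0‖ < 1

/-- The last auxiliary error `e_r`. -/
def lastErr (ω : EReal) (x : ℝ → EuclideanSpace ℝ (Fin n)) (t : ℝ) : EuclideanSpace ℝ (Fin m) :=
  S.auxErr ω x (S.r - 1) t

/-- The denominator `1 - φ_r(t)² ‖e_r(t)‖²` of the gain. -/
def gainDenom (ω : EReal) (x : ℝ → EuclideanSpace ℝ (Fin n)) (t : ℝ) : ℝ :=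
  1 - S.φ (S.r - 1) t ^ 2 * ‖S.lastErr ω x t‖ ^ 2

/-- The gain `k(t) = k_r / (1 - φ_r(t)² ‖e_r(t)‖²)`. -/
def gain (kr : ℝ) (ω : EReal) (x : ℝ → EuclideanSpace ℝ (Fin n)) (t : ℝ) : ℝ :=
  kr / S.gainDenom ω x t

/-- The output `w = -k e_r` of the funnel controller. -/
def ctrl (kr : ℝ) (ω : EReal) (x : ℝ → EuclideanSpace ℝ (Fin n)) (t : ℝ) :
    EuclideanSpace ℝ (Fin m) :=
  -(S.gain kr ω x t • S.lastErr ω x t)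

/-- The output `u = C̃ z + w` of the internal model, which is the input of the system. -/
def input (kr : ℝ) (ω : EReal) (x : ℝ → EuclideanSpace ℝ (Fin n))
    (z : ℝ → EuclideanSpace ℝ (Fin p × Fin m)) (t : ℝ) : EuclideanSpace ℝ (Fin m) :=
  toEuclideanLin S.Ct (z t) + S.ctrl kr ω x t

/-- `(x, z)` is a solution on `[0, ω)` of the closed loop: it is locally absolutely continuous,
attains the initial values, the gain is well defined, and the differential equations hold almost
everywhere. -/
structure IsSolution (kr : ℝ) (ω : EReal) (x : ℝ → EuclideanSpace ℝ (Fin n))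
    (z : ℝ → EuclideanSpace ℝ (Fin p × Fin m)) : Prop where
  pos : 0 < ω
  ac_x : ∀ b ∈ timeDomain ω, AbsolutelyContinuousOnInterval x 0 b
  ac_z : ∀ b ∈ timeDomain ω, AbsolutelyContinuousOnInterval z 0 b
  init_x : x 0 = S.x0
  init_z : z 0 = S.z0
  gain_defined : ∀ t ∈ timeDomain ω, S.gainDenom ω x t ≠ 0
  ode_x : ∀ᵐ t : ℝ, t ∈ timeDomain ω →
    HasDerivAt x (toEuclideanLin S.A (x t) + toEuclideanLin S.B (S.input kr ω x z t)) t
  ode_z : ∀ᵐ t : ℝ, t ∈ timeDomain ω →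
    HasDerivAt z (toEuclideanLin S.At (z t) + toEuclideanLin S.Bt (S.ctrl kr ω x t)) t

/-- A solution is maximal if it has no proper right extension that is also a solution. -/
def IsMaximalSolution (kr : ℝ) (ω : EReal) (x : ℝ → EuclideanSpace ℝ (Fin n))
    (z : ℝ → EuclideanSpace ℝ (Fin p × Fin m)) : Prop :=
  S.IsSolution kr ω x z ∧
    ∀ (ω' : EReal) (x' : ℝ → EuclideanSpace ℝ (Fin n))
      (z' : ℝ → EuclideanSpace ℝ (Fin p × Fin m)),
      ω < ω' → S.IsSolution kr ω' x' z' →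
        ¬ (EqOn x' x (timeDomain ω) ∧ EqOn z' z (timeDomain ω))

end LoopData

/-- Boundedness of a signal on `[0, ∞)`. -/
def BoundedSignal {E : Type*} [Norm E] (f : ℝ → E) : Prop := ∃ M : ℝ, ∀ t, 0 ≤ t → ‖f t‖ ≤ M

end FunnelIM

end

/-!
Augment the system by the internal model, with state `(x, z)`. Since `α` avoids the zeros of the
system, every `y_ref ∈ R(α)` is the output of a free motion `Xr` of the augmented system. The
deviation `X = (x, z) - Xr` then satisfies `X' = A X - k(t) B L X`, where `L X = e_r` has relative
degree one with `L B = Γ`. The zero dynamics of this system consist of those of the plant, those of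
the internal model (the roots of `β`) and the modes `-k_1, …, -k_{r-1}`, so they are exponentially
stable, and a Lyapunov function for them extends to a quadratic energy `W` with
`(W ∘ X)' ≤ -c W(X) + (C - 2 k(t) γ) ‖e_r‖²`.

Bounding the denominator of `k` below by `δ > 0` makes the feedback globally Lipschitz. If `δ` is
small, `e_r` cannot come so close to the funnel boundary that this truncation becomes active, so the
truncated solution is a global bounded solution of the closed loop, and Gronwall's inequality shows
that it is the only one. The remaining funnels follow by descending induction from
`e_i' = e_{i+1} - k_i e_i` and (K1). Since `k(t) ≥ k_r`, the energy decays exponentially once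
`2 k_r γ ≥ C`.
-/

namespace FunnelIM

/-! ### Real matrices as operators on Euclidean spaces -/

section MatCLM

variable {ι κ μ : Type*} [Fintype ι] [DecidableEq ι] [Fintype κ] [Fintype μ]

/-- The continuous linear map between Euclidean spaces with matrix `M`. It is `toEuclideanLin M`
with its continuity; Mathlib's `toEuclideanCLM` covers square matrices only. -/
noncomputable def matCLM (M : Matrix κ ι ℝ) : EuclideanSpace ℝ ι →L[ℝ] EuclideanSpace ℝ κ :=
  LinearMap.toContinuousLinearMap (toEuclideanLin M)

theorem matCLM_apply (M : Matrix κ ι ℝ) (v : EuclideanSpace ℝ ι) :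
    matCLM M v = toEuclideanLin M v := rfl

theorem ofLp_matCLM (M : Matrix κ ι ℝ) (v : EuclideanSpace ℝ ι) :
    (matCLM M v).ofLp = M *ᵥ v.ofLp := rfl

theorem matCLM_mul [DecidableEq κ] (M : Matrix μ κ ℝ) (N : Matrix κ ι ℝ) (v : EuclideanSpace ℝ ι) :
    matCLM (M * N) v = matCLM M (matCLM N v) := by
  apply WithLp.ofLp_injective 2
  simp only [ofLp_matCLM, Matrix.mulVec_mulVec]

theorem matCLM_add (M N : Matrix κ ι ℝ) (v : EuclideanSpace ℝ ι) :
    matCLM (M + N) v = matCLM M v + matCLM N v := by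
  simp [matCLM_apply]

theorem matCLM_smul (c : ℝ) (M : Matrix κ ι ℝ) (v : EuclideanSpace ℝ ι) :
    matCLM (c • M) v = c • matCLM M v := by
  simp [matCLM_apply]

theorem matCLM_one (v : EuclideanSpace ℝ ι) : matCLM (1 : Matrix ι ι ℝ) v = v := by
  apply WithLp.ofLp_injective 2
  simp [ofLp_matCLM]

theorem matCLM_zero (v : EuclideanSpace ℝ ι) : matCLM (0 : Matrix κ ι ℝ) v = 0 := by
  simp [matCLM_apply]

theorem matCLM_pow (M : Matrix ι ι ℝ) (j : ℕ) (v : EuclideanSpace ℝ ι) :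
    matCLM (M ^ j) v = (matCLM M ^ j) v := by
  induction j generalizing v with
  | zero => simp [matCLM_one]
  | succ j ih => rw [pow_succ, matCLM_mul, ih, pow_succ]; rfl

theorem commute_matCLM_aeval (M : Matrix ι ι ℝ) (q : ℝ[X]) :
    Commute (matCLM (aeval M q)) (matCLM M) := by
  have hcomm : aeval M q * M = M * aeval M q := by
    simpa only [map_mul, aeval_X] using congrArg (aeval M) (mul_comm q Polynomial.X)
  ext1 v
  change matCLM (aeval M q) (matCLM M v) = matCLM M (matCLM (aeval M q) v)
  rw [← matCLM_mul, ← matCLM_mul, hcomm]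

theorem inner_matCLM (G : Matrix ι ι ℝ) (u : EuclideanSpace ℝ ι) :
    inner ℝ u (matCLM G u) = u.ofLp ⬝ᵥ (G *ᵥ u.ofLp) := by
  rw [EuclideanSpace.inner_eq_star_dotProduct, ofLp_matCLM, dotProduct_comm, star_trivial]

end MatCLM

theorem exists_coercive_const {U : Type*} [NormedAddCommGroup U] [InnerProductSpace ℝ U]
    [FiniteDimensional ℝ U] {G : U →L[ℝ] U} (hG : ∀ u, u ≠ 0 → 0 < inner ℝ u (G u)) :
    ∃ γ : ℝ, 0 < γ ∧ ∀ u, γ * ‖u‖ ^ 2 ≤ inner ℝ u (G u) := by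
  rcases subsingleton_or_nontrivial U with hU | hU
  · exact ⟨1, one_pos, fun u => by simp [Subsingleton.elim u 0]⟩
  obtain ⟨w, hw, hmin⟩ := (isCompact_sphere (0 : U) 1).exists_isMinOn
    (NormedSpace.sphere_nonempty.2 zero_le_one) (f := fun u => inner ℝ u (G u)) (by fun_prop)
  refine ⟨inner ℝ w (G w), hG w (ne_zero_of_mem_unit_sphere ⟨w, hw⟩), fun u => ?_⟩
  rcases eq_or_ne u 0 with rfl | hu
  · simp
  have hu' : ‖u‖ ≠ 0 := norm_ne_zero_iff.2 hu
  have hunit : inner ℝ w (G w) ≤ inner ℝ (‖u‖⁻¹ • u) (G (‖u‖⁻¹ • u)) :=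
    hmin (by simp [norm_smul, hu])
  rw [map_smul, real_inner_smul_left, real_inner_smul_right] at hunit
  calc inner ℝ w (G w) * ‖u‖ ^ 2
      ≤ ‖u‖⁻¹ * (‖u‖⁻¹ * inner ℝ u (G u)) * ‖u‖ ^ 2 := by gcongr
    _ = inner ℝ u (G u) := by field_simp

/-! ### Quadratic Lyapunov functions -/

section Lyapunov

theorem tendsto_pow_atTop_nhds_zero_of_spectralRadius_lt_one {𝓐 : Type*} [NormedRing 𝓐]
    [NormedAlgebra ℂ 𝓐] [CompleteSpace 𝓐] {a : 𝓐} (ha : spectralRadius ℂ a < 1) :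
    Tendsto (fun k : ℕ => a ^ k) atTop (𝓝 0) := by
  obtain ⟨q, hq, hq1⟩ := exists_between ha
  lift q to NNReal using (hq1.trans ENNReal.one_lt_top).ne
  refine squeeze_zero_norm' ?_ (tendsto_pow_atTop_nhds_zero_of_lt_one q.2 (mod_cast hq1))
  filter_upwards [(spectrum.pow_nnnorm_pow_one_div_tendsto_nhds_spectralRadius
    a).eventually_lt_const hq, eventually_gt_atTop 0] with k hk hk0
  have hk0' : (0 : ℝ) < k := mod_cast hk0
  have hlt := ENNReal.rpow_lt_rpow hk hk0'
  rw [← ENNReal.rpow_mul, one_div_mul_cancel hk0'.ne', ENNReal.rpow_one,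
    ENNReal.rpow_natCast] at hlt
  exact_mod_cast hlt.le

theorem eventually_norm_one_add_mul_lt_one {l : ℂ} (hl : l.re < 0) :
    ∀ᶠ h : ℝ in 𝓝[>] 0, ‖1 + (h : ℂ) * l‖ < 1 := by
  have hlim : Tendsto (fun h : ℝ => h * ‖l‖ ^ 2) (𝓝[>] 0) (𝓝 (0 * ‖l‖ ^ 2)) :=
    ((continuous_mul_const _).tendsto 0).mono_left nhdsWithin_le_nhds
  filter_upwards [hlim.eventually_lt_const (show 0 * ‖l‖ ^ 2 < -2 * l.re by linarith),
    self_mem_nhdsWithin] with h hh hpos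
  have hsq : ‖1 + (h : ℂ) * l‖ ^ 2 = 1 + h * (2 * l.re + h * ‖l‖ ^ 2) := by
    simp only [← Complex.normSq_eq_norm_sq, Complex.normSq_apply, Complex.add_re, Complex.one_re,
      Complex.re_ofReal_mul, Complex.add_im, Complex.one_im, Complex.im_ofReal_mul]
    ring
  refine (sq_lt_one_iff₀ (norm_nonneg _)).1 ?_
  rw [hsq]
  nlinarith [mem_Ioi.1 hpos]

variable {ι : Type*} [Fintype ι] [DecidableEq ι]

/-- A real matrix is Hurwitz if all its complex eigenvalues have negative real part. -/
def IsHurwitzMatrix (F : Matrix ι ι ℝ) : Prop :=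
  ∀ l ∈ spectrum ℂ (F.map Complex.ofReal), l.re < 0

theorem isHurwitzMatrix_of_forall_eigenvector {F : Matrix ι ι ℝ}
    (hF : ∀ (l : ℂ) (v : ι → ℂ), 0 ≤ l.re → F.map Complex.ofReal *ᵥ v = l • v → v = 0) :
    IsHurwitzMatrix F := by
  intro l hl
  by_contra! hre
  rw [← Matrix.spectrum_toLin', ← Module.End.hasEigenvalue_iff_mem_spectrum] at hl
  obtain ⟨v, hv⟩ := hl.exists_hasEigenvector
  exact hv.2 (hF l v hre (by simpa only [Matrix.toLin'_apply] using hv.apply_eq_smul))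

attribute [local instance] Matrix.linftyOpNormedRing Matrix.linftyOpNormedAlgebra in
theorem tendsto_matrix_pow_atTop_nhds_zero {M : Matrix ι ι ℂ}
    (hM : ∀ l ∈ spectrum ℂ M, ‖l‖ < 1) : Tendsto (fun k : ℕ => M ^ k) atTop (𝓝 0) := by
  rcases isEmpty_or_nonempty ι with h | h
  · exact tendsto_const_nhds.congr fun k => Subsingleton.elim _ _
  · exact tendsto_pow_atTop_nhds_zero_of_spectralRadius_lt_one
      (spectrum.spectralRadius_lt_of_forall_lt M fun l hl => hM l hl)

theorem norm_lt_one_of_mem_spectrum_one_add_smul {𝓐 : Type*} [Ring 𝓐] [Algebra ℂ 𝓐] {a : 𝓐}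
    {h : ℂ} (hh : h ≠ 0) (ha : ∀ l ∈ spectrum ℂ a, ‖1 + h * l‖ < 1) {l : ℂ}
    (hl : l ∈ spectrum ℂ (1 + h • a)) : ‖l‖ < 1 := by
  rw [← map_one (algebraMap ℂ 𝓐), ← spectrum.singleton_add_eq,
    show h • a = Units.mk0 h hh • a from rfl, spectrum.unit_smul_eq_smul, singleton_add] at hl
  obtain ⟨_, ⟨l', hl', rfl⟩, rfl⟩ := hl
  exact ha l' hl'

theorem map_ofReal_one_add_smul_pow (F : Matrix ι ι ℝ) (h : ℝ) (k : ℕ) :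
    ((1 + h • F) ^ k).map Complex.ofReal = (1 + (h : ℂ) • F.map Complex.ofReal) ^ k := by
  have hbase : Complex.ofRealHom.mapMatrix (1 + h • F) = 1 + (h : ℂ) • F.map Complex.ofReal := by
    ext i j
    by_cases hij : i = j <;> simp [hij]
  rw [← hbase, ← map_pow]
  rfl

theorem IsHurwitzMatrix.exists_tendsto_euler_pow {F : Matrix ι ι ℝ} (hF : IsHurwitzMatrix F) :
    ∃ h : ℝ, 0 < h ∧ Tendsto (fun k : ℕ => (1 + h • F) ^ k) atTop (𝓝 0) := by
  have hall : ∀ᶠ h : ℝ in 𝓝[>] 0, ∀ l ∈ spectrum ℂ (F.map Complex.ofReal), ‖1 + (h : ℂ) * l‖ < 1 :=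
    (Filter.eventually_all_finite (Matrix.finite_spectrum _)).2
      fun l hl => eventually_norm_one_add_mul_lt_one (hF l hl)
  obtain ⟨h, hh, hpos : 0 < h⟩ := (hall.and self_mem_nhdsWithin).exists
  have hlim := tendsto_matrix_pow_atTop_nhds_zero fun l hl =>
    norm_lt_one_of_mem_spectrum_one_add_smul (Complex.ofReal_ne_zero.2 hpos.ne') hh hl
  refine ⟨h, hpos, tendsto_pi_nhds.2 fun i => tendsto_pi_nhds.2 fun j => ?_⟩
  have hij := tendsto_pi_nhds.1 (tendsto_pi_nhds.1 hlim i) j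
  refine ((Complex.continuous_re.tendsto _).comp hij).congr fun k => ?_
  rw [Function.comp_apply, ← map_ofReal_one_add_smul_pow]
  rfl

/-- `v ↦ ⟪P v, v⟫` is a quadratic Lyapunov function of the linear system `v' = F v`, normalized so
that it dominates `‖v‖²`, with decay rate `c`. -/
structure IsLyapunov {V : Type*} [NormedAddCommGroup V] [InnerProductSpace ℝ V]
    (F P : V →L[ℝ] V) (c : ℝ) : Prop where
  c_pos : 0 < c
  symm : ∀ v w, inner ℝ (P v) w = inner ℝ (P w) v
  norm_sq_le : ∀ v, ‖v‖ ^ 2 ≤ inner ℝ (P v) v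
  inner_le : ∀ v, inner ℝ (P v) (F v) ≤ -c * ‖v‖ ^ 2

section GramSum

variable {V : Type*} [NormedAddCommGroup V] [InnerProductSpace ℝ V] [CompleteSpace V]

/-- The truncated Lyapunov sum `∑_{k < K} (Mᵏ)ᵀ Mᵏ`; it replaces the usual integral
`∫ exp(tF)ᵀ exp(tF) dt` when `M` is an explicit Euler step of `v' = F v`. -/
noncomputable def gramSum (M : V →L[ℝ] V) (K : ℕ) : V →L[ℝ] V :=
  ∑ k ∈ Finset.range K, ContinuousLinearMap.adjoint (M ^ k) ∘L (M ^ k)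

theorem inner_gramSum (M : V →L[ℝ] V) (K : ℕ) (v w : V) :
    inner ℝ (gramSum M K v) w = ∑ k ∈ Finset.range K, inner ℝ ((M ^ k) v) ((M ^ k) w) := by
  simp [gramSum, sum_inner, ContinuousLinearMap.adjoint_inner_left]

theorem inner_gramSum_comm (M : V →L[ℝ] V) (K : ℕ) (v w : V) :
    inner ℝ (gramSum M K v) w = inner ℝ (gramSum M K w) v := by
  rw [inner_gramSum, inner_gramSum]
  exact Finset.sum_congr rfl fun k _ => real_inner_comm _ _

theorem inner_gramSum_self (M : V →L[ℝ] V) (K : ℕ) (v : V) :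
    inner ℝ (gramSum M K v) v = ∑ k ∈ Finset.range K, ‖(M ^ k) v‖ ^ 2 := by
  simp only [inner_gramSum, real_inner_self_eq_norm_sq]

theorem norm_sq_le_inner_gramSum (M : V →L[ℝ] V) {K : ℕ} (hK : 0 < K) (v : V) :
    ‖v‖ ^ 2 ≤ inner ℝ (gramSum M K v) v := by
  rw [inner_gramSum_self]
  exact Finset.single_le_sum (f := fun k => ‖(M ^ k) v‖ ^ 2) (fun k _ => sq_nonneg _)
    (Finset.mem_range.2 hK)

theorem inner_gramSum_apply_sub (M : V →L[ℝ] V) (K : ℕ) (v : V) :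
    inner ℝ (gramSum M K (M v)) (M v) - inner ℝ (gramSum M K v) v
      = ‖(M ^ K) v‖ ^ 2 - ‖v‖ ^ 2 := by
  have hshift (k : ℕ) : (M ^ k) (M v) = (M ^ (k + 1)) v := by rw [pow_succ]; rfl
  simp only [inner_gramSum_self, hshift]
  rw [← Finset.sum_sub_distrib, Finset.sum_range_sub (fun k => ‖(M ^ k) v‖ ^ 2), pow_zero,
    one_apply_eq_self]

theorem isLyapunov_gramSum {F : V →L[ℝ] V} {h : ℝ} (hh : 0 < h) {K : ℕ} (hK : 0 < K)
    (hsmall : ‖(1 + h • F) ^ K‖ ≤ 1 / 2) :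
    IsLyapunov F (gramSum (1 + h • F) K) (3 / (8 * h)) where
  c_pos := by positivity
  symm := inner_gramSum_comm _ K
  norm_sq_le := norm_sq_le_inner_gramSum _ hK
  inner_le v := by
    have hstep : inner ℝ (gramSum (1 + h • F) K (v + h • F v)) (v + h • F v)
        - inner ℝ (gramSum (1 + h • F) K v) v = ‖((1 + h • F) ^ K) v‖ ^ 2 - ‖v‖ ^ 2 :=
      inner_gramSum_apply_sub (1 + h • F) K v
    have hnorm : ‖((1 + h • F) ^ K) v‖ ^ 2 ≤ 1 / 4 * ‖v‖ ^ 2 := by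
      calc ‖((1 + h • F) ^ K) v‖ ^ 2 ≤ (1 / 2 * ‖v‖) ^ 2 := by
            gcongr
            exact ContinuousLinearMap.le_of_opNorm_le _ hsmall v
        _ = 1 / 4 * ‖v‖ ^ 2 := by ring
    have hnonneg : 0 ≤ inner ℝ (gramSum (1 + h • F) K (F v)) (F v) :=
      (sq_nonneg _).trans (norm_sq_le_inner_gramSum _ hK _)
    simp only [map_add, map_smul, inner_add_left, inner_add_right, real_inner_smul_left,
      real_inner_smul_right, inner_gramSum_comm _ K (F v) v] at hstep
    have hmul : inner ℝ (gramSum (1 + h • F) K v) (F v) * (8 * h) ≤ -3 * ‖v‖ ^ 2 := by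
      nlinarith [mul_nonneg (sq_nonneg h) hnonneg]
    rw [show -(3 / (8 * h)) * ‖v‖ ^ 2 = -3 * ‖v‖ ^ 2 / (8 * h) by ring]
    rwa [le_div_iff₀ (by positivity)]

end GramSum

theorem IsHurwitzMatrix.exists_isLyapunov {F : Matrix ι ι ℝ} (hF : IsHurwitzMatrix F) :
    ∃ P c, IsLyapunov (matCLM F) P c := by
  obtain ⟨h, hpos, hlim⟩ := hF.exists_tendsto_euler_pow
  have hcont : Continuous (toEuclideanCLM (𝕜 := ℝ) (n := ι)) :=
    (toEuclideanCLM (𝕜 := ℝ) (n := ι)).toAlgEquiv.toLinearMap.continuous_of_finiteDimensional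
  have heuler (k : ℕ) : toEuclideanCLM (𝕜 := ℝ) ((1 + h • F) ^ k) = (1 + h • matCLM F) ^ k := by
    rw [map_pow, map_add, map_one, map_smul]
    rfl
  have hnorm : Tendsto (fun k : ℕ => ‖(1 + h • matCLM F) ^ k‖) atTop (𝓝 0) := by
    simpa only [Function.comp_def, heuler, map_zero, norm_zero]
      using ((hcont.tendsto 0).comp hlim).norm
  obtain ⟨K, hK, hK0⟩ :=
    ((hnorm.eventually_lt_const (half_pos one_pos)).and (eventually_gt_atTop 0)).exists
  exact ⟨_, _, isLyapunov_gramSum hpos hK0 hK.le⟩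

end Lyapunov

/-! ### Ordinary differential equations -/

section GlobalSolution

variable {V : Type*} [NormedAddCommGroup V] [NormedSpace ℝ V]

theorem norm_exp_smul_integral_le {h : ℝ → V} {c l t : ℝ} (hc : 0 ≤ c) (hl : 0 < l) (ht : 0 ≤ t)
    (hh : ∀ s, 0 ≤ s → ‖h s‖ ≤ c * Real.exp (l * s)) :
    ‖Real.exp (-(l * t)) • ∫ s in (0 : ℝ)..t, h s‖ ≤ c / l := by
  have hexp : ∫ s in (0 : ℝ)..t, Real.exp (l * s) = (Real.exp (l * t) - 1) / l := by
    rw [intervalIntegral.integral_comp_mul_left Real.exp hl.ne', integral_exp, mul_zero,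
      Real.exp_zero, smul_eq_mul, inv_mul_eq_div]
  have hint : ‖∫ s in (0 : ℝ)..t, h s‖ ≤ c * ((Real.exp (l * t) - 1) / l) := by
    rw [← hexp, ← intervalIntegral.integral_const_mul]
    exact intervalIntegral.norm_integral_le_of_norm_le ht
      (Eventually.of_forall fun s hs => hh s hs.1.le)
      (Continuous.intervalIntegrable (by fun_prop) _ _)
  rw [norm_smul, Real.norm_of_nonneg (Real.exp_nonneg _)]
  calc Real.exp (-(l * t)) * ‖∫ s in (0 : ℝ)..t, h s‖
      ≤ Real.exp (-(l * t)) * (c * (Real.exp (l * t) / l)) := by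
        gcongr
        exact hint.trans (by gcongr; linarith)
    _ = c / l := by
        rw [Real.exp_neg]
        field_simp

/-- One step of the Picard iteration for `X' = f t X`, `X 0 = v0`, written for the weighted unknown
`g t = exp (-l t) X t`; it is extended to negative times by its value at `0`. -/
noncomputable def picardStep (f : ℝ → V → V) (v0 : V) (l : ℝ) (g : ℝ → V) (t : ℝ) : V :=
  Real.exp (-(l * max t 0)) • (v0 + ∫ s in (0 : ℝ)..max t 0, f s (Real.exp (l * s) • g s))

variable {f : ℝ → V → V} {v0 : V} {l : ℝ}

theorem continuous_weighted_field (hf : Continuous (Function.uncurry f)) {g : ℝ → V}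
    (hg : Continuous g) : Continuous fun s => f s (Real.exp (l * s) • g s) :=
  hf.comp (continuous_id.prodMk (by fun_prop))

theorem continuous_picardStep (hf : Continuous (Function.uncurry f)) {g : ℝ → V}
    (hg : Continuous g) : Continuous (picardStep f v0 l g) := by
  have _hprim := intervalIntegral.continuous_primitive (μ := volume)
    (fun a b => (continuous_weighted_field (l := l) hf hg).intervalIntegrable a b) 0
  unfold picardStep
  fun_prop

variable {K : NNReal}

theorem norm_picardStep_sub_le (hf : Continuous (Function.uncurry f))
    (hlip : ∀ t, LipschitzWith K (f t)) (hl : 0 < l) {g g' : ℝ → V} (hg : Continuous g)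
    (hg' : Continuous g') {d : ℝ} (hd : ∀ s, ‖g s - g' s‖ ≤ d) (t : ℝ) :
    ‖picardStep f v0 l g t - picardStep f v0 l g' t‖ ≤ K * d / l := by
  have hd0 : 0 ≤ d := (norm_nonneg _).trans (hd 0)
  rw [picardStep, picardStep, ← smul_sub, add_sub_add_left_eq_sub,
    ← intervalIntegral.integral_sub ((continuous_weighted_field hf hg).intervalIntegrable _ _)
      ((continuous_weighted_field hf hg').intervalIntegrable _ _)]
  refine norm_exp_smul_integral_le (by positivity) hl (le_max_right _ _) fun s _ => ?_
  calc ‖f s (Real.exp (l * s) • g s) - f s (Real.exp (l * s) • g' s)‖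
      ≤ K * ‖Real.exp (l * s) • (g s - g' s)‖ := by
        rw [smul_sub]
        exact (hlip s).norm_sub_le _ _
    _ ≤ K * (Real.exp (l * s) * d) := by
        rw [norm_smul, Real.norm_of_nonneg (Real.exp_nonneg _)]
        gcongr
        exact hd s
    _ = K * d * Real.exp (l * s) := by ring

theorem norm_picardStep_zero_le (h0 : ∀ t, f t 0 = 0) (hl : 0 < l) (t : ℝ) :
    ‖picardStep f v0 l 0 t‖ ≤ ‖v0‖ := by
  have hle : Real.exp (-(l * max t 0)) ≤ 1 :=
    Real.exp_le_one_iff.2 (neg_nonpos.2 (by positivity))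
  simpa [picardStep, h0, norm_smul] using mul_le_of_le_one_left (norm_nonneg v0) hle

/-- The Picard step as a self-map of the space of bounded continuous weighted functions. -/
noncomputable def picardMap (hf : Continuous (Function.uncurry f))
    (hlip : ∀ t, LipschitzWith K (f t)) (h0 : ∀ t, f t 0 = 0) (v0 : V) (hl : 0 < l)
    (g : BoundedContinuousFunction ℝ V) : BoundedContinuousFunction ℝ V :=
  BoundedContinuousFunction.ofNormedAddCommGroup (picardStep f v0 l g)
    (continuous_picardStep hf g.continuous) (‖v0‖ + K * ‖g‖ / l) fun t => by
      have hsub := norm_picardStep_sub_le (v0 := v0) hf hlip hl g.continuous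
        (continuous_zero : Continuous (0 : ℝ → V))
        (fun s => by simpa using g.norm_coe_le_norm s) t
      have hzero := norm_picardStep_zero_le (v0 := v0) h0 hl t
      linarith [norm_le_norm_add_norm_sub' (picardStep f v0 l g t) (picardStep f v0 l 0 t)]

theorem contractingWith_picardMap (hf : Continuous (Function.uncurry f))
    (hlip : ∀ t, LipschitzWith K (f t)) (h0 : ∀ t, f t 0 = 0) (hl : 0 < l) (hKl : 2 * K ≤ l) :
    ContractingWith (1 / 2) (picardMap hf hlip h0 v0 hl) := by
  refine ⟨by rw [← NNReal.coe_lt_coe]; norm_num, LipschitzWith.of_dist_le_mul fun g g' => ?_⟩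
  refine (BoundedContinuousFunction.dist_le (by positivity)).2 fun t => ?_
  calc dist (picardStep f v0 l g t) (picardStep f v0 l g' t)
      ≤ K * dist g g' / l := by
        rw [dist_eq_norm]
        exact norm_picardStep_sub_le hf hlip hl g.continuous g'.continuous
          (fun s => (dist_eq_norm (g s) (g' s)).ge.trans
            (BoundedContinuousFunction.dist_coe_le_dist s)) t
    _ ≤ l / 2 * dist g g' / l := by
        gcongr
        linarith
    _ = (1 / 2 : NNReal) * dist g g' := by
        push_cast
        field_simp

theorem exists_forall_hasDerivAt_of_lipschitzWith [CompleteSpace V]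
    (hf : Continuous (Function.uncurry f)) (hlip : ∀ t, LipschitzWith K (f t))
    (h0 : ∀ t, f t 0 = 0) (v0 : V) :
    ∃ X : ℝ → V, X 0 = v0 ∧ ∀ t, 0 ≤ t → HasDerivAt X (f t (X t)) t := by
  have hl : 0 < 2 * (K : ℝ) + 1 := by positivity
  have hT := contractingWith_picardMap (v0 := v0) hf hlip h0 hl (by linarith)
  obtain ⟨g, hg⟩ : ∃ g, picardMap hf hlip h0 v0 hl g = g := ⟨_, hT.fixedPoint_isFixedPt⟩
  set l := 2 * (K : ℝ) + 1
  have hfix {t : ℝ} (ht : 0 ≤ t) :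
      Real.exp (l * t) • g t = v0 + ∫ s in (0 : ℝ)..t, f s (Real.exp (l * s) • g s) := by
    have hgt : g t = picardStep f v0 l g t := (DFunLike.congr_fun hg t).symm
    rw [hgt, picardStep, max_eq_left ht, smul_smul, ← Real.exp_add, add_neg_cancel, Real.exp_zero,
      one_smul]
  refine ⟨fun t => v0 + ∫ s in (0 : ℝ)..t, f s (Real.exp (l * s) • g s), by simp, fun t ht => ?_⟩
  beta_reduce
  rw [← hfix ht]
  exact ((continuous_weighted_field hf g.continuous).integral_hasStrictDerivAt 0
    t).hasDerivAt.const_add v0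

end GlobalSolution

theorem exists_first_hitting_time {g : ℝ → ℝ} {b t : ℝ} (hg : ContinuousOn g (Icc 0 t))
    (h0 : g 0 < b) (ht : 0 ≤ t) (hbt : b ≤ g t) :
    ∃ τ, 0 < τ ∧ g τ = b ∧ ∀ s, 0 ≤ s → s < τ → g s < b := by
  set S := Icc 0 t ∩ g ⁻¹' Ici b
  have hS : IsClosed S := hg.preimage_isClosed_of_isClosed isClosed_Icc isClosed_Ici
  have hbdd : BddBelow S := ⟨0, fun s hs => hs.1.1⟩
  obtain ⟨⟨hτ0, hτt⟩, hbτ : b ≤ g (sInf S)⟩ := hS.csInf_mem ⟨t, ⟨ht, le_rfl⟩, hbt⟩ hbdd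
  have hbefore (s : ℝ) (hs : 0 ≤ s) (hsτ : s < sInf S) : g s < b := by
    by_contra! hbs
    exact hsτ.not_ge (csInf_le hbdd ⟨⟨hs, hsτ.le.trans hτt⟩, hbs⟩)
  have hτpos : 0 < sInf S := hτ0.lt_of_ne fun h => (h ▸ hbτ).not_gt h0
  have hclosure : sInf S ∈ closure (Ico 0 (sInf S)) := by
    rw [closure_Ico hτpos.ne]
    exact ⟨hτ0, le_rfl⟩
  have hle : g (sInf S) ≤ b :=
    ((hg _ ⟨hτ0, hτt⟩).mono fun s hs => ⟨hs.1, hs.2.le.trans hτt⟩).closure_le hclosure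
      continuousWithinAt_const fun s hs => (hbefore s hs.1 hs.2).le
  exact ⟨sInf S, hτpos, hle.antisymm hbτ, hbefore⟩

theorem nonneg_of_hasDerivAt_of_forall_lt {g : ℝ → ℝ} {d a τ : ℝ} (hg : HasDerivAt g d τ)
    (haτ : a < τ) (hlt : ∀ s, a < s → s < τ → g s < g τ) : 0 ≤ d := by
  refine ge_of_tendsto (x := 𝓝[<] τ)
    (hg.tendsto_slope.mono_left (nhdsWithin_mono τ fun s hs => ne_of_lt hs)) ?_
  filter_upwards [Ioo_mem_nhdsLT haτ] with s hs
  rw [slope_def_field]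
  exact div_nonneg_of_nonpos (sub_nonpos.2 (hlt s hs.1 hs.2).le) (sub_nonpos.2 hs.2.le)

theorem lt_of_barrier {g : ℝ → ℝ} {b : ℝ} (hg : ContinuousOn g (Ici 0)) (h0 : g 0 < b)
    (hd : ∀ t, 0 < t → g t = b → (∀ s, 0 ≤ s → s ≤ t → g s ≤ b) → ∃ d < 0, HasDerivAt g d t)
    {t : ℝ} (ht : 0 ≤ t) : g t < b := by
  by_contra! hbt
  obtain ⟨τ, hτ, hgτ, hbefore⟩ :=
    exists_first_hitting_time (hg.mono Icc_subset_Ici_self) h0 ht hbt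
  obtain ⟨d, hd0, hder⟩ := hd τ hτ hgτ fun s hs hsτ => by
    rcases hsτ.eq_or_lt with rfl | hlt
    · exact hgτ.le
    · exact (hbefore s hs hlt).le
  exact hd0.not_ge (nonneg_of_hasDerivAt_of_forall_lt hder hτ fun s hs hsτ =>
    hgτ ▸ hbefore s hs.le hsτ)

theorem le_gronwallBound_of_hasDerivAt {W W' : ℝ → ℝ} {k d T : ℝ}
    (hW : ∀ t, 0 ≤ t → HasDerivAt W (W' t) t)
    (hb : ∀ t, 0 ≤ t → t < T → W' t ≤ k * W t + d) {t : ℝ} (ht : 0 ≤ t) (htT : t ≤ T) :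
    W t ≤ gronwallBound (W 0) k d t := by
  have hle := le_gronwallBound_of_liminf_deriv_right_le (f := W) (f' := W') (a := 0) (b := T)
    (fun s hs => (hW s hs.1).continuousAt.continuousWithinAt)
    (fun s hs r hr => (hW s hs.1).hasDerivWithinAt.liminf_right_slope_le hr) le_rfl
    (fun s hs => hb s hs.1 hs.2) t ⟨ht, htT⟩
  rwa [sub_zero] at hle

theorem gronwallBound_neg_le {δ c d t : ℝ} (hδ : 0 ≤ δ) (hc : 0 < c) (hd : 0 ≤ d) (ht : 0 ≤ t) :
    gronwallBound δ (-c) d t ≤ δ + d / c := by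
  have hexp : Real.exp (-c * t) ≤ 1 := Real.exp_le_one_iff.2 (by nlinarith)
  rw [gronwallBound_of_K_ne_0 (neg_ne_zero.2 hc.ne'), div_neg]
  nlinarith [Real.exp_nonneg (-c * t), div_nonneg hd hc.le]

/-! ### Funnel functions -/

theorem IsFunnel.nonneg {φ : ℝ → ℝ} (h : IsFunnel φ) {t : ℝ} (ht : 0 ≤ t) : 0 ≤ φ t := by
  rcases ht.eq_or_lt with rfl | ht
  · have hcont : ContinuousWithinAt φ (Ioi 0) 0 :=
      (h.contDiffOn.continuousOn 0 self_mem_Ici).mono Ioi_subset_Ici_self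
    exact ge_of_tendsto hcont
      (by filter_upwards [self_mem_nhdsWithin] with s hs using (h.pos s hs).le)
  · exact (h.pos t ht).le

theorem IsFunnel.exists_lower_bound {φ : ℝ → ℝ} (h : IsFunnel φ) :
    ∃ c, 0 < c ∧ ∀ t, 1 ≤ t → c ≤ φ t := by
  obtain ⟨M, hM⟩ := h.bounded
  have hbdd : IsBoundedUnder (· ≥ ·) atTop φ :=
    ⟨-M, eventually_map.2 ((eventually_ge_atTop 0).mono fun t ht => (abs_le.1 (hM t ht)).1)⟩
  obtain ⟨a, ha0, ha⟩ := exists_between h.liminf_pos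
  obtain ⟨T, hT⟩ := eventually_atTop.1 (eventually_lt_of_lt_liminf ha hbdd)
  obtain ⟨s, hs, hmin⟩ := (isCompact_Icc (a := (1 : ℝ)) (b := max 1 T)).exists_isMinOn
    ⟨1, le_rfl, le_max_left _ _⟩
    (h.contDiffOn.continuousOn.mono fun t ht => zero_le_one.trans ht.1)
  refine ⟨min a (φ s), lt_min ha0 (h.pos s (by linarith [hs.1])), fun t ht => ?_⟩
  rcases le_total t (max 1 T) with htT | htT
  · exact (min_le_right _ _).trans (hmin ⟨ht, htT⟩)
  · exact (min_le_left _ _).trans (hT t ((le_max_right _ _).trans htT)).le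

theorem IsFunnel.hasDerivAt {φ : ℝ → ℝ} (h : IsFunnel φ) {t : ℝ} (ht : 0 < t) :
    HasDerivAt φ (derivWithin φ (Ici 0) t) t :=
  ((h.contDiffOn.differentiableOn one_ne_zero) t ht.le).hasDerivWithinAt.hasDerivAt
    (Ici_mem_nhds ht)

/-! ### The truncated funnel gain -/

theorem abs_max_one_sub_sq_sub_le {δ s x y : ℝ} (hδ : 0 ≤ δ) (hs : 0 ≤ s) (hx : 0 ≤ x)
    (hxy : x ≤ y) (hsx : s * x ≤ 1) :
    |max δ (1 - s ^ 2 * x ^ 2) - max δ (1 - s ^ 2 * y ^ 2)| ≤ 2 * s * (y - x) := by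
  have hsxy : s * x ≤ s * y := by gcongr
  have _hsx0 : 0 ≤ s * x := by positivity
  have hmono : s ^ 2 * x ^ 2 ≤ s ^ 2 * y ^ 2 := by gcongr
  have hle : max δ (1 - s ^ 2 * y ^ 2) ≤ max δ (1 - s ^ 2 * x ^ 2) :=
    max_le_max le_rfl (by linarith)
  rw [abs_of_nonneg (by linarith), sub_le_iff_le_add]
  refine max_le ?_ ?_
  · nlinarith [le_max_left δ (1 - s ^ 2 * y ^ 2)]
  · rcases le_total (s * y) 1 with hsy | hsy
    · nlinarith [le_max_right δ (1 - s ^ 2 * y ^ 2)]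
    · nlinarith [le_max_left δ (1 - s ^ 2 * y ^ 2)]

section Truncation

variable {U : Type*} [NormedAddCommGroup U]

theorem abs_truncated_denom_sub_mul_norm_le {δ s : ℝ} (hδ : 0 ≤ δ) (hs : 0 ≤ s) {a b : U}
    (hab : ‖a‖ ≤ ‖b‖) :
    |max δ (1 - s ^ 2 * ‖a‖ ^ 2) - max δ (1 - s ^ 2 * ‖b‖ ^ 2)| * ‖a‖ ≤ 2 * ‖a - b‖ := by
  rcases le_or_gt (s * ‖a‖) 1 with hsa | hsa
  · have _hba : 0 ≤ ‖b‖ - ‖a‖ := sub_nonneg.2 hab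
    calc |max δ (1 - s ^ 2 * ‖a‖ ^ 2) - max δ (1 - s ^ 2 * ‖b‖ ^ 2)| * ‖a‖
        ≤ 2 * s * (‖b‖ - ‖a‖) * ‖a‖ := by
          gcongr
          exact abs_max_one_sub_sq_sub_le hδ hs (norm_nonneg a) hab hsa
      _ = 2 * (‖b‖ - ‖a‖) * (s * ‖a‖) := by ring
      _ ≤ 2 * (‖b‖ - ‖a‖) * 1 := by gcongr
      _ ≤ 2 * ‖a - b‖ := by
          rw [mul_one, norm_sub_rev]
          gcongr
          exact norm_sub_norm_le b a
  · have hsb : s * ‖a‖ ≤ s * ‖b‖ := by gcongr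
    rw [max_eq_left (by nlinarith), max_eq_left (by nlinarith), sub_self, abs_zero, zero_mul]
    positivity

variable [NormedSpace ℝ U]

theorem norm_truncated_gain_sub_le {δ s : ℝ} (hδ : 0 < δ) (hs : 0 ≤ s) (a b : U) :
    ‖(max δ (1 - s ^ 2 * ‖a‖ ^ 2))⁻¹ • a - (max δ (1 - s ^ 2 * ‖b‖ ^ 2))⁻¹ • b‖
      ≤ (δ⁻¹ + 2 * (δ⁻¹ * δ⁻¹)) * ‖a - b‖ := by
  wlog hab : ‖a‖ ≤ ‖b‖ generalizing a b
  · rw [norm_sub_rev, norm_sub_rev a b]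
    exact this b a (le_of_not_ge hab)
  have hdenom := abs_truncated_denom_sub_mul_norm_le hδ.le hs hab
  set Da := max δ (1 - s ^ 2 * ‖a‖ ^ 2)
  set Db := max δ (1 - s ^ 2 * ‖b‖ ^ 2)
  have hda : δ ≤ Da := le_max_left _ _
  have hdb : δ ≤ Db := le_max_left _ _
  have hDa : 0 < Da := hδ.trans_le hda
  have hDb : 0 < Db := hδ.trans_le hdb
  have hfst : ‖Db⁻¹ • (a - b)‖ ≤ δ⁻¹ * ‖a - b‖ := by
    rw [norm_smul, Real.norm_of_nonneg (by positivity)]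
    gcongr
  have hsnd : ‖(Da⁻¹ - Db⁻¹) • a‖ ≤ 2 * (δ⁻¹ * δ⁻¹) * ‖a - b‖ := by
    rw [norm_smul, Real.norm_eq_abs, inv_sub_inv hDa.ne' hDb.ne', abs_div, abs_sub_comm,
      abs_of_pos (mul_pos hDa hDb), div_eq_mul_inv, mul_inv]
    calc |Da - Db| * (Da⁻¹ * Db⁻¹) * ‖a‖ = (Da⁻¹ * Db⁻¹) * (|Da - Db| * ‖a‖) := by ring
      _ ≤ (δ⁻¹ * δ⁻¹) * (2 * ‖a - b‖) := by gcongr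
      _ = 2 * (δ⁻¹ * δ⁻¹) * ‖a - b‖ := by ring
  calc ‖Da⁻¹ • a - Db⁻¹ • b‖ = ‖Db⁻¹ • (a - b) + (Da⁻¹ - Db⁻¹) • a‖ := by
        congr 1
        module
    _ ≤ δ⁻¹ * ‖a - b‖ + 2 * (δ⁻¹ * δ⁻¹) * ‖a - b‖ :=
        (norm_add_le _ _).trans (add_le_add hfst hsnd)
    _ = (δ⁻¹ + 2 * (δ⁻¹ * δ⁻¹)) * ‖a - b‖ := by ring

end Truncation

/-! ### Energy forms for high-gain feedback -/

section Energy

variable {V U : Type*} [NormedAddCommGroup V] [InnerProductSpace ℝ V]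
  [NormedAddCommGroup U] [InnerProductSpace ℝ U]

theorem inner_apply_le_opNorm_mul (T : V →L[ℝ] U) (u : U) (v : V) :
    inner ℝ u (T v) ≤ ‖T‖ * (‖u‖ * ‖v‖) :=
  calc inner ℝ u (T v) ≤ ‖u‖ * ‖T v‖ := real_inner_le_norm _ _
    _ ≤ ‖u‖ * (‖T‖ * ‖v‖) := by
        gcongr
        exact T.le_opNorm v
    _ = ‖T‖ * (‖u‖ * ‖v‖) := by ring

/-- A quadratic form `v ↦ ⟪Q v, v⟫` which certifies stability of `v' = A v - k B L v` for large
gains `k` and bounded growth for every nonnegative gain. -/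
structure IsEnergyForm (A : V →L[ℝ] V) (B : U →L[ℝ] V) (L : V →L[ℝ] U) (Q : V →L[ℝ] V)
    (a c C γ : ℝ) : Prop where
  symm : ∀ v w, inner ℝ (Q v) w = inner ℝ (Q w) v
  a_pos : 0 < a
  c_pos : 0 < c
  C_pos : 0 < C
  γ_pos : 0 < γ
  norm_le : ∀ v, ‖v‖ ^ 2 ≤ a * inner ℝ (Q v) v
  output_le : ∀ v, ‖L v‖ ^ 2 ≤ inner ℝ (Q v) v
  coercive : ∀ u, γ * ‖u‖ ^ 2 ≤ inner ℝ u (L (B u))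
  decay : ∀ k v, 0 ≤ k → 2 * inner ℝ (Q v) (A v - k • B (L v))
    ≤ -c * inner ℝ (Q v) v + (C - 2 * k * γ) * ‖L v‖ ^ 2

/-- The map `1 - R L`, which is the projection onto `ker L` along the range of `R` when `R` is a
right inverse of `L`. -/
def kerProj (L : V →L[ℝ] U) (R : U →L[ℝ] V) : V →L[ℝ] V :=
  ContinuousLinearMap.id ℝ V - R ∘L L

theorem kerProj_apply (L : V →L[ℝ] U) (R : U →L[ℝ] V) (v : V) :
    kerProj L R v = v - R (L v) := rfl

variable {P F A : V →L[ℝ] V} {L : V →L[ℝ] U} {R B : U →L[ℝ] V} {c γ : ℝ}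

theorem apply_kerProj_eq_zero (hLR : ∀ u, L (R u) = u) (v : V) : L (kerProj L R v) = 0 := by
  rw [kerProj_apply, map_sub, hLR, sub_self]

theorem IsLyapunov.div_mul_inner_le (hP : IsLyapunov F P c) (v : V) :
    c / (‖P‖ + 1) * inner ℝ (P v) v ≤ c * ‖v‖ ^ 2 := by
  have hc := hP.c_pos
  have hPv : inner ℝ (P v) v ≤ (‖P‖ + 1) * ‖v‖ ^ 2 := by
    rw [real_inner_comm]
    nlinarith [inner_apply_le_opNorm_mul P v v, sq_nonneg ‖v‖]
  calc c / (‖P‖ + 1) * inner ℝ (P v) v ≤ c / (‖P‖ + 1) * ((‖P‖ + 1) * ‖v‖ ^ 2) := by gcongr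
    _ = c * ‖v‖ ^ 2 := by field_simp

variable [CompleteSpace V] [CompleteSpace U]

/-- The operator of the quadratic form `v ↦ ⟪P ξ, ξ⟫ + ‖L v‖²` with `ξ = kerProj L R v`. -/
noncomputable def energyOp (P : V →L[ℝ] V) (L : V →L[ℝ] U) (R : U →L[ℝ] V) : V →L[ℝ] V :=
  ContinuousLinearMap.adjoint (kerProj L R) ∘L P ∘L kerProj L R
    + ContinuousLinearMap.adjoint L ∘L L

theorem inner_energyOp (v w : V) :
    inner ℝ (energyOp P L R v) w
      = inner ℝ (P (kerProj L R v)) (kerProj L R w) + inner ℝ (L v) (L w) := by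
  simp [energyOp, inner_add_left, ContinuousLinearMap.adjoint_inner_left]

theorem inner_energyOp_self (v : V) :
    inner ℝ (energyOp P L R v) v
      = inner ℝ (P (kerProj L R v)) (kerProj L R v) + ‖L v‖ ^ 2 := by
  rw [inner_energyOp, real_inner_self_eq_norm_sq]

theorem norm_sq_le_mul_inner_energyOp (hP : ∀ v, ‖v‖ ^ 2 ≤ inner ℝ (P v) v) (v : V) :
    ‖v‖ ^ 2 ≤ (2 + 2 * ‖R‖ ^ 2) * inner ℝ (energyOp P L R v) v := by
  rw [inner_energyOp_self]
  set ξ := kerProj L R v with hξ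
  have hdecomp : ‖v‖ ≤ ‖ξ‖ + ‖R‖ * ‖L v‖ := by
    calc ‖v‖ = ‖ξ + R (L v)‖ := by rw [hξ, kerProj_apply, sub_add_cancel]
      _ ≤ ‖ξ‖ + ‖R‖ * ‖L v‖ := (norm_add_le _ _).trans (by gcongr; exact R.le_opNorm _)
  calc ‖v‖ ^ 2 ≤ (‖ξ‖ + ‖R‖ * ‖L v‖) ^ 2 := by gcongr
    _ ≤ 2 * (‖ξ‖ ^ 2 + (‖R‖ * ‖L v‖) ^ 2) := add_sq_le
    _ ≤ (2 + 2 * ‖R‖ ^ 2) * (‖ξ‖ ^ 2 + ‖L v‖ ^ 2) := by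
        nlinarith [mul_nonneg (sq_nonneg ‖R‖) (sq_nonneg ‖ξ‖), sq_nonneg ‖L v‖]
    _ ≤ (2 + 2 * ‖R‖ ^ 2) * (inner ℝ (P ξ) ξ + ‖L v‖ ^ 2) := by
        gcongr
        exact hP ξ

/-- Weight of the cross term `‖ξ‖ ‖L v‖` in the derivative of the energy form `energyOp P L R`
along `v' = A v`. -/
noncomputable def crossBound (A P : V →L[ℝ] V) (L : V →L[ℝ] U) (R : U →L[ℝ] V) : ℝ :=
  ‖P ∘L kerProj L R ∘L A ∘L R‖ + ‖L ∘L A‖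

theorem inner_energyOp_drift_le (hP : IsLyapunov F P c) (hLR : ∀ u, L (R u) = u)
    (hF : ∀ v, L v = 0 → F v = kerProj L R (A v)) (v : V) :
    inner ℝ (energyOp P L R v) (A v) ≤ -c * ‖kerProj L R v‖ ^ 2
      + crossBound A P L R * (‖kerProj L R v‖ * ‖L v‖) + ‖L ∘L A ∘L R‖ * ‖L v‖ ^ 2 := by
  set ξ := kerProj L R v with hξ
  have hAv : A v = A ξ + A (R (L v)) := by rw [← map_add, hξ, kerProj_apply, sub_add_cancel]
  have hdiag : inner ℝ (P ξ) (kerProj L R (A ξ)) ≤ -c * ‖ξ‖ ^ 2 := by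
    rw [← hF ξ (apply_kerProj_eq_zero hLR v)]
    exact hP.inner_le ξ
  have hcross : inner ℝ (P ξ) (kerProj L R (A (R (L v))))
      ≤ ‖P ∘L kerProj L R ∘L A ∘L R‖ * (‖ξ‖ * ‖L v‖) := by
    rw [hP.symm, real_inner_comm]
    exact inner_apply_le_opNorm_mul (P ∘L kerProj L R ∘L A ∘L R) ξ (L v)
  have hcross' : inner ℝ (L v) (L (A ξ)) ≤ ‖L ∘L A‖ * (‖ξ‖ * ‖L v‖) := by
    rw [mul_comm ‖ξ‖]
    exact inner_apply_le_opNorm_mul (L ∘L A) (L v) ξ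
  have hout : inner ℝ (L v) (L (A (R (L v)))) ≤ ‖L ∘L A ∘L R‖ * ‖L v‖ ^ 2 := by
    rw [sq]
    exact inner_apply_le_opNorm_mul (L ∘L A ∘L R) (L v) (L v)
  rw [inner_energyOp, hAv, crossBound]
  simp only [map_add, inner_add_right]
  linarith

theorem inner_energyOp_input_ge (hRB : ∀ u, R (L (B u)) = B u)
    (hcoer : ∀ u, γ * ‖u‖ ^ 2 ≤ inner ℝ u (L (B u))) (v : V) :
    γ * ‖L v‖ ^ 2 ≤ inner ℝ (energyOp P L R v) (B (L v)) := by
  rw [inner_energyOp, kerProj_apply L R (B _), hRB, sub_self, inner_zero_right, zero_add]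
  exact hcoer (L v)

theorem isEnergyForm_energyOp (hP : IsLyapunov F P c) (hLR : ∀ u, L (R u) = u)
    (hF : ∀ v, L v = 0 → F v = kerProj L R (A v)) (hRB : ∀ u, R (L (B u)) = B u)
    (hγ : 0 < γ) (hcoer : ∀ u, γ * ‖u‖ ^ 2 ≤ inner ℝ u (L (B u))) :
    IsEnergyForm A B L (energyOp P L R) (2 + 2 * ‖R‖ ^ 2) (c / (‖P‖ + 1))
      (crossBound A P L R ^ 2 / c + 2 * ‖L ∘L A ∘L R‖ + c / (‖P‖ + 1)) γ where
  symm v w := by rw [inner_energyOp, inner_energyOp, hP.symm, real_inner_comm (L v)]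
  a_pos := by positivity
  c_pos := div_pos hP.c_pos (by positivity)
  C_pos := by
    have := hP.c_pos
    positivity
  γ_pos := hγ
  norm_le := norm_sq_le_mul_inner_energyOp hP.norm_sq_le
  output_le v := by
    rw [inner_energyOp_self]
    linarith [(sq_nonneg _).trans (hP.norm_sq_le (kerProj L R v))]
  coercive := hcoer
  decay k v hk := by
    have hc := hP.c_pos
    have hdrift := inner_energyOp_drift_le hP hLR hF v
    have hinput := mul_le_mul_of_nonneg_left (inner_energyOp_input_ge (P := P) hRB hcoer v) hk
    have hlyap := hP.div_mul_inner_le (kerProj L R v)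
    have hself := inner_energyOp_self (P := P) (L := L) (R := R) v
    set ν := crossBound A P L R
    set ξ := kerProj L R v
    have hyoung : 2 * (ν * (‖ξ‖ * ‖L v‖)) ≤ c * ‖ξ‖ ^ 2 + ν ^ 2 / c * ‖L v‖ ^ 2 := by
      have hsq : 0 ≤ (c * ‖ξ‖ - ν * ‖L v‖) ^ 2 / c := by positivity
      have hexpand : (c * ‖ξ‖ - ν * ‖L v‖) ^ 2 / c
          = c * ‖ξ‖ ^ 2 + ν ^ 2 / c * ‖L v‖ ^ 2 - 2 * (ν * (‖ξ‖ * ‖L v‖)) := by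
        field_simp
        ring
      linarith
    rw [inner_sub_right, real_inner_smul_right, hself]
    linarith

end Energy

/-! ### High-gain funnel feedback -/

/-- The gain of the funnel controller with the denominator bounded below by `δ`. -/
noncomputable def truncGain {U : Type*} [Norm U] (ψ : ℝ → ℝ) (kr δ t : ℝ) (u : U) : ℝ :=
  kr / max δ (1 - ψ t ^ 2 * ‖u‖ ^ 2)

theorem le_truncGain {U : Type*} [NormedAddCommGroup U] {ψ : ℝ → ℝ} {kr δ : ℝ} (hkr : 0 ≤ kr)
    (hδ : 0 < δ) (hδ1 : δ ≤ 1) (t : ℝ) (u : U) :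
    kr ≤ truncGain ψ kr δ t u := by
  have hle : max δ (1 - ψ t ^ 2 * ‖u‖ ^ 2) ≤ 1 := max_le hδ1 (sub_le_self _ (by positivity))
  rw [truncGain, le_div_iff₀ (hδ.trans_le (le_max_left _ _))]
  exact mul_le_of_le_one_right hkr hle

section HighGain

variable {V U : Type*} [NormedAddCommGroup V] [InnerProductSpace ℝ V]
  [NormedAddCommGroup U] [InnerProductSpace ℝ U]
  {A : V →L[ℝ] V} {B : U →L[ℝ] V} {L : V →L[ℝ] U} {Q : V →L[ℝ] V} {a c C γ : ℝ}
  {k : ℝ → ℝ} {X : ℝ → V}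

/-- `X` solves `X' = A X - k(t) B L X` on `[0, ∞)`, where the gain `k` is nonnegative. -/
structure IsFeedbackSolution (A : V →L[ℝ] V) (B : U →L[ℝ] V) (L : V →L[ℝ] U) (k : ℝ → ℝ)
    (X : ℝ → V) : Prop where
  gain_nonneg : ∀ t, 0 ≤ t → 0 ≤ k t
  hasDerivAt : ∀ t, 0 ≤ t → HasDerivAt X (A (X t) - k t • B (L (X t))) t

theorem IsEnergyForm.nonneg (h : IsEnergyForm A B L Q a c C γ) (v : V) : 0 ≤ inner ℝ (Q v) v :=
  (sq_nonneg _).trans (h.output_le v)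

theorem IsEnergyForm.hasDerivAt (h : IsEnergyForm A B L Q a c C γ) {X' : V} {t : ℝ}
    (hX : HasDerivAt X X' t) :
    HasDerivAt (fun s => inner ℝ (Q (X s)) (X s)) (2 * inner ℝ (Q (X t)) X') t := by
  convert! (Q.hasFDerivAt.comp_hasDerivAt t hX).inner ℝ hX using 1
  rw [Function.comp_apply, h.symm X' (X t)]
  ring

theorem IsEnergyForm.energy_le_gronwallBound (h : IsEnergyForm A B L Q a c C γ)
    (hX : IsFeedbackSolution A B L k X) {κ d t : ℝ} (ht : 0 ≤ t)
    (hb : ∀ s, 0 ≤ s → s < t → -c * inner ℝ (Q (X s)) (X s) + (C - 2 * k s * γ) * ‖L (X s)‖ ^ 2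
      ≤ κ * inner ℝ (Q (X s)) (X s) + d) :
    inner ℝ (Q (X t)) (X t) ≤ gronwallBound (inner ℝ (Q (X 0)) (X 0)) κ d t :=
  le_gronwallBound_of_hasDerivAt (W := fun s => inner ℝ (Q (X s)) (X s))
    (fun s hs => h.hasDerivAt (hX.hasDerivAt s hs))
    (fun s hs hst => (h.decay (k s) (X s) (hX.gain_nonneg s hs)).trans (hb s hs hst)) ht le_rfl

theorem IsEnergyForm.gain_term_nonneg (h : IsEnergyForm A B L Q a c C γ)
    (hX : IsFeedbackSolution A B L k X) {t : ℝ} (ht : 0 ≤ t) :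
    0 ≤ k t * γ * ‖L (X t)‖ ^ 2 :=
  mul_nonneg (mul_nonneg (hX.gain_nonneg t ht) h.γ_pos.le) (sq_nonneg _)

theorem IsEnergyForm.energy_le_exp (h : IsEnergyForm A B L Q a c C γ)
    (hX : IsFeedbackSolution A B L k X) {t : ℝ} (ht : 0 ≤ t) :
    inner ℝ (Q (X t)) (X t) ≤ inner ℝ (Q (X 0)) (X 0) * Real.exp (C * t) := by
  rw [← gronwallBound_ε0]
  refine h.energy_le_gronwallBound hX ht fun s hs _ => ?_
  linarith [h.gain_term_nonneg hX hs, mul_nonneg h.c_pos.le (h.nonneg (X s)),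
    mul_le_mul_of_nonneg_left (h.output_le (X s)) h.C_pos.le]

theorem IsEnergyForm.energy_le_of_output_le (h : IsEnergyForm A B L Q a c C γ)
    (hX : IsFeedbackSolution A B L k X) {M t : ℝ} (ht : 0 ≤ t)
    (hM : ∀ s, 0 ≤ s → s ≤ t → ‖L (X s)‖ ^ 2 ≤ M) :
    inner ℝ (Q (X t)) (X t) ≤ inner ℝ (Q (X 0)) (X 0) + C * M / c := by
  have hM0 : 0 ≤ M := (sq_nonneg _).trans (hM 0 le_rfl ht)
  refine (h.energy_le_gronwallBound hX (κ := -c) (d := C * M) ht fun s hs hst => ?_).trans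
    (gronwallBound_neg_le (h.nonneg _) h.c_pos (mul_nonneg h.C_pos.le hM0) ht)
  linarith [h.gain_term_nonneg hX hs, mul_le_mul_of_nonneg_left (hM s hs hst.le) h.C_pos.le]

theorem IsEnergyForm.energy_le_exp_neg (h : IsEnergyForm A B L Q a c C γ)
    (hX : IsFeedbackSolution A B L k X) (hC : ∀ t, 0 ≤ t → C ≤ 2 * k t * γ) {t : ℝ}
    (ht : 0 ≤ t) :
    inner ℝ (Q (X t)) (X t) ≤ inner ℝ (Q (X 0)) (X 0) * Real.exp (-c * t) := by
  rw [← gronwallBound_ε0]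
  refine h.energy_le_gronwallBound hX ht fun s hs _ => ?_
  linarith [mul_nonneg (sub_nonneg.2 (hC s hs)) (sq_nonneg ‖L (X s)‖)]

theorem IsEnergyForm.tendsto_zero (h : IsEnergyForm A B L Q a c C γ)
    (hX : IsFeedbackSolution A B L k X) (hC : ∀ t, 0 ≤ t → C ≤ 2 * k t * γ) :
    Tendsto X atTop (𝓝 0) := by
  have hexp : Tendsto (fun t : ℝ => a * (inner ℝ (Q (X 0)) (X 0) * Real.exp (-c * t))) atTop
      (𝓝 0) := by
    have hlin : Tendsto (fun t : ℝ => -c * t) atTop atBot :=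
      tendsto_id.const_mul_atTop_of_neg (neg_lt_zero.2 h.c_pos)
    simpa [mul_assoc] using
      (Real.tendsto_exp_atBot.comp hlin).const_mul (a * inner ℝ (Q (X 0)) (X 0))
  have hsq : Tendsto (fun t => ‖X t‖ ^ 2) atTop (𝓝 0) := by
    refine squeeze_zero' (Eventually.of_forall fun t => sq_nonneg _) ?_ hexp
    filter_upwards [eventually_ge_atTop 0] with t ht
    exact (h.norm_le _).trans
      (mul_le_mul_of_nonneg_left (h.energy_le_exp_neg hX hC ht) h.a_pos.le)
  rw [tendsto_zero_iff_norm_tendsto_zero]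
  simpa [Function.comp_def] using (Real.continuous_sqrt.tendsto 0).comp hsq

theorem norm_sq_le_inv_sq_of_mul_le_one {c₀ p y : ℝ} (hc₀ : 0 < c₀) (hp : c₀ ≤ p) (hy : 0 ≤ y)
    (hpy : p * y ≤ 1) : y ^ 2 ≤ c₀⁻¹ ^ 2 := by
  have hle : y ≤ c₀⁻¹ := by
    rw [← one_div, le_div_iff₀ hc₀]
    nlinarith
  gcongr

/- A funnel function may vanish at `0`, so that the funnel confines the output only on `[1, ∞)`;
on `[0, 1]` the output is bounded by the a priori growth of the energy. -/
theorem IsEnergyForm.exists_norm_le_of_mem_funnel (h : IsEnergyForm A B L Q a c C γ) {ψ : ℝ → ℝ}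
    (hψ : IsFunnel ψ) (v0 : V) :
    ∃ N, 0 ≤ N ∧ ∀ k X, IsFeedbackSolution A B L k X → X 0 = v0 → ∀ t, 0 ≤ t →
      (∀ s, 0 ≤ s → s ≤ t → ψ s * ‖L (X s)‖ ≤ 1) → ‖X t‖ ≤ N := by
  obtain ⟨c₀, hc₀, hlow⟩ := hψ.exists_lower_bound
  set W₀ := inner ℝ (Q v0) v0 with hW₀
  have hW₀0 : 0 ≤ W₀ := h.nonneg v0
  set M := c₀⁻¹ ^ 2 + W₀ * Real.exp C
  refine ⟨√(a * (W₀ + C * M / c)), Real.sqrt_nonneg _, fun k X hX hX0 t ht hfun =>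
    Real.le_sqrt_of_sq_le ?_⟩
  have hout (s : ℝ) (hs : 0 ≤ s) (hst : s ≤ t) : ‖L (X s)‖ ^ 2 ≤ M := by
    rcases le_total s 1 with hs1 | hs1
    · have hCs : C * s ≤ C := mul_le_of_le_one_right h.C_pos.le hs1
      calc ‖L (X s)‖ ^ 2 ≤ W₀ * Real.exp (C * s) := by
            rw [hW₀, ← hX0]
            exact (h.output_le (X s)).trans (h.energy_le_exp hX hs)
        _ ≤ W₀ * Real.exp C := by gcongr
        _ ≤ M := le_add_of_nonneg_left (sq_nonneg _)
    · calc ‖L (X s)‖ ^ 2 ≤ c₀⁻¹ ^ 2 :=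
            norm_sq_le_inv_sq_of_mul_le_one hc₀ (hlow s hs1) (norm_nonneg _) (hfun s hs hst)
        _ ≤ M := le_add_of_nonneg_right (mul_nonneg hW₀0 (Real.exp_nonneg C))
  have henergy := h.energy_le_of_output_le hX ht hout
  rw [hX0] at henergy
  exact (h.norm_le _).trans (mul_le_mul_of_nonneg_left henergy h.a_pos.le)

theorem IsEnergyForm.funnel_drift_le (h : IsEnergyForm A B L Q a c C γ) {x : V}
    {p q k Ψ Ψ' N : ℝ} (hk : 0 ≤ k) (hp : |p| ≤ Ψ) (hq : |q| ≤ Ψ') (hN : ‖x‖ ≤ N) :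
    2 * p * q * ‖L x‖ ^ 2 + p ^ 2 * (2 * inner ℝ (L x) (L (A x - k • B (L x))))
      ≤ 2 * (Ψ * Ψ' * (‖L‖ * N) ^ 2 + Ψ ^ 2 * ((‖L‖ * N) * (‖L ∘L A‖ * N)))
        - 2 * (k * γ) * (p ^ 2 * ‖L x‖ ^ 2) := by
  have hΨ : 0 ≤ Ψ := (abs_nonneg _).trans hp
  have hL : ‖L x‖ ≤ ‖L‖ * N := L.le_opNorm_of_le hN
  have hLA : ‖L (A x)‖ ≤ ‖L ∘L A‖ * N := (L ∘L A).le_opNorm_of_le hN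
  have hN0 : 0 ≤ N := (norm_nonneg _).trans hN
  have hweight : p * q * ‖L x‖ ^ 2 ≤ Ψ * Ψ' * (‖L‖ * N) ^ 2 := by
    have hpq : p * q ≤ Ψ * Ψ' := by
      refine (le_abs_self _).trans ?_
      rw [abs_mul]
      gcongr
    have _hΨ' : 0 ≤ Ψ' := (abs_nonneg _).trans hq
    gcongr
  have hfree : p ^ 2 * inner ℝ (L x) (L (A x)) ≤ Ψ ^ 2 * ((‖L‖ * N) * (‖L ∘L A‖ * N)) := by
    have hp2 : p ^ 2 ≤ Ψ ^ 2 := sq_le_sq' (neg_le_of_abs_le hp) (le_of_abs_le hp)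
    calc p ^ 2 * inner ℝ (L x) (L (A x)) ≤ p ^ 2 * (‖L x‖ * ‖L (A x)‖) := by
          gcongr
          exact real_inner_le_norm _ _
      _ ≤ Ψ ^ 2 * ((‖L‖ * N) * (‖L ∘L A‖ * N)) := by gcongr
  have hgain : k * p ^ 2 * (γ * ‖L x‖ ^ 2) ≤ k * p ^ 2 * inner ℝ (L x) (L (B (L x))) := by
    gcongr
    exact h.coercive _
  rw [map_sub, map_smul, inner_sub_right, inner_smul_right]
  linarith

theorem IsEnergyForm.exists_funnel_drift_le (h : IsEnergyForm A B L Q a c C γ) {ψ : ℝ → ℝ}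
    (hψ : IsFunnel ψ) {N : ℝ} (hN : 0 ≤ N) :
    ∃ D, 0 ≤ D ∧ ∀ k X, IsFeedbackSolution A B L k X → ∀ t, 0 < t → ‖X t‖ ≤ N →
      ∃ d, HasDerivAt (fun s => ψ s ^ 2 * ‖L (X s)‖ ^ 2) d t ∧
        d ≤ D - 2 * (k t * γ) * (ψ t ^ 2 * ‖L (X t)‖ ^ 2) := by
  obtain ⟨Ψ, hΨ⟩ := hψ.bounded
  obtain ⟨Ψ', hΨ'⟩ := hψ.deriv_bounded
  have hΨ0 : 0 ≤ Ψ := (abs_nonneg _).trans (hΨ 0 le_rfl)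
  have hΨ'0 : 0 ≤ Ψ' := (abs_nonneg _).trans (hΨ' 0 le_rfl)
  refine ⟨2 * (Ψ * Ψ' * (‖L‖ * N) ^ 2 + Ψ ^ 2 * ((‖L‖ * N) * (‖L ∘L A‖ * N))), by positivity,
    fun k X hX t ht hXN => ⟨_, ((hψ.hasDerivAt ht).pow 2).mul
      (L.hasFDerivAt.comp_hasDerivAt t (hX.hasDerivAt t ht.le)).norm_sq, ?_⟩⟩
  have hdrift := h.funnel_drift_le (hX.gain_nonneg t ht.le) (hΨ t ht.le) (hΨ' t ht.le) hXN
  simpa using hdrift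

/-- The closed-loop vector field with the truncated gain; unlike the actual one, it is globally
Lipschitz. -/
noncomputable def truncField (A : V →L[ℝ] V) (B : U →L[ℝ] V) (L : V →L[ℝ] U) (ψ : ℝ → ℝ)
    (kr δ t : ℝ) (v : V) : V :=
  A v - truncGain ψ kr δ t (L v) • B (L v)

variable {ψ : ℝ → ℝ} {kr δ : ℝ}

theorem norm_truncGain_smul_sub_le (hkr : 0 ≤ kr) (hδ : 0 < δ) {t : ℝ} (hψ : 0 ≤ ψ t) (u w : U) :
    ‖truncGain ψ kr δ t u • u - truncGain ψ kr δ t w • w‖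
      ≤ kr * (δ⁻¹ + 2 * (δ⁻¹ * δ⁻¹)) * ‖u - w‖ := by
  simp only [truncGain, div_eq_mul_inv, mul_smul, ← smul_sub]
  rw [norm_smul, Real.norm_of_nonneg hkr, mul_assoc]
  gcongr
  exact norm_truncated_gain_sub_le hδ hψ u w

/-- A global Lipschitz constant of `truncField`. -/
noncomputable def truncFieldLip (A : V →L[ℝ] V) (B : U →L[ℝ] V) (L : V →L[ℝ] U) (kr δ : ℝ) :
    NNReal :=
  (‖A‖ + ‖B‖ * (kr * (δ⁻¹ + 2 * (δ⁻¹ * δ⁻¹)) * ‖L‖)).toNNReal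

theorem lipschitzWith_truncField (hkr : 0 ≤ kr) (hδ : 0 < δ) {t : ℝ} (hψ : 0 ≤ ψ t) :
    LipschitzWith (truncFieldLip A B L kr δ) (truncField A B L ψ kr δ t) := by
  refine LipschitzWith.of_dist_le_mul fun v w => ?_
  rw [dist_eq_norm, dist_eq_norm, truncFieldLip, Real.coe_toNNReal _ (by positivity)]
  have hfeed : ‖B (truncGain ψ kr δ t (L v) • L v - truncGain ψ kr δ t (L w) • L w)‖
      ≤ ‖B‖ * (kr * (δ⁻¹ + 2 * (δ⁻¹ * δ⁻¹)) * (‖L‖ * ‖v - w‖)) := by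
    refine B.le_opNorm_of_le ((norm_truncGain_smul_sub_le hkr hδ hψ _ _).trans ?_)
    gcongr
    rw [← map_sub]
    exact L.le_opNorm _
  calc ‖truncField A B L ψ kr δ t v - truncField A B L ψ kr δ t w‖
      = ‖A (v - w) - B (truncGain ψ kr δ t (L v) • L v - truncGain ψ kr δ t (L w) • L w)‖ := by
        simp only [truncField, map_sub, map_smul]
        congr 1
        abel
    _ ≤ ‖A‖ * ‖v - w‖ + ‖B‖ * (kr * (δ⁻¹ + 2 * (δ⁻¹ * δ⁻¹)) * (‖L‖ * ‖v - w‖)) :=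
        (norm_sub_le _ _).trans (add_le_add (A.le_opNorm _) hfeed)
    _ = (‖A‖ + ‖B‖ * (kr * (δ⁻¹ + 2 * (δ⁻¹ * δ⁻¹)) * ‖L‖)) * ‖v - w‖ := by ring

theorem continuous_truncField (hδ : 0 < δ) (hψ : Continuous ψ) :
    Continuous (Function.uncurry (truncField A B L ψ kr δ)) := by
  unfold Function.uncurry truncField truncGain
  have hne (p : ℝ × V) : max δ (1 - ψ p.1 ^ 2 * ‖L p.2‖ ^ 2) ≠ 0 :=
    (hδ.trans_le (le_max_left _ _)).ne'
  fun_prop (disch := exact hne)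

theorem eqOn_of_truncField (hkr : 0 ≤ kr) (hδ : 0 < δ) (hψ : ∀ t, 0 ≤ t → 0 ≤ ψ t) {Y : ℝ → V}
    {b : ℝ} (hXc : ContinuousOn X (Icc 0 b)) (hYc : ContinuousOn Y (Icc 0 b))
    (hX : ∀ t ∈ Ico 0 b, HasDerivWithinAt X (truncField A B L ψ kr δ t (X t)) (Ici t) t)
    (hY : ∀ t ∈ Ico 0 b, HasDerivWithinAt Y (truncField A B L ψ kr δ t (Y t)) (Ici t) t)
    (h0 : X 0 = Y 0) : EqOn X Y (Icc 0 b) :=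
  ODE_solution_unique_of_mem_Icc_right (s := fun _ => univ)
    (fun t ht => (lipschitzWith_truncField hkr hδ (hψ t ht.1)).lipschitzOnWith) hXc hX
    (fun _ _ => mem_univ _) hYc hY (fun _ _ => mem_univ _) h0

theorem exists_truncated_solution [CompleteSpace V] (A : V →L[ℝ] V) (B : U →L[ℝ] V)
    (L : V →L[ℝ] U) (hψ : IsFunnel ψ) (hkr : 0 ≤ kr) (hδ : 0 < δ) (v0 : V) :
    ∃ X : ℝ → V, X 0 = v0 ∧
      IsFeedbackSolution A B L (fun t => truncGain ψ kr δ t (L (X t))) X := by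
  set ψ' : ℝ → ℝ := fun t => ψ (max t 0)
  have hψ' : Continuous ψ' :=
    hψ.contDiffOn.continuousOn.comp_continuous (by fun_prop) fun t => le_max_right t 0
  obtain ⟨X, hX0, hX⟩ := exists_forall_hasDerivAt_of_lipschitzWith
    (f := truncField A B L ψ' kr δ) (continuous_truncField hδ hψ')
    (fun t => lipschitzWith_truncField hkr hδ (hψ.nonneg (le_max_right _ _)))
    (fun t => by simp [truncField]) v0
  refine ⟨X, hX0, fun t _ => ?_, fun t ht => ?_⟩
  · exact div_nonneg hkr (hδ.le.trans (le_max_left _ _))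
  · simpa only [truncField, truncGain, ψ', max_eq_left ht] using hX t ht

theorem exists_truncation_level {g₀ K : ℝ} (hg₀ : g₀ < 1) (hK : 0 < K) :
    ∃ δ, 0 < δ ∧ δ ≤ 1 / 2 ∧ g₀ < 1 - δ ∧ δ ≤ K := by
  refine ⟨min (1 / 2) (min ((1 - g₀) / 2) K), ?_, min_le_left _ _, ?_, ?_⟩
  · exact lt_min (by norm_num) (lt_min (by linarith) hK)
  · linarith [(min_le_right (1 / 2) (min ((1 - g₀) / 2) K)).trans (min_le_left _ _)]
  · exact (min_le_right _ _).trans (min_le_right _ _)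

theorem mul_sq_le_one_iff {p y : ℝ} (hp : 0 ≤ p) (hy : 0 ≤ y) :
    p ^ 2 * y ^ 2 ≤ 1 ↔ p * y ≤ 1 := by
  rw [← mul_pow, sq_le_one_iff₀ (mul_nonneg hp hy)]

/- On the level `1 - δ` the truncated gain equals `kr / δ`, which outweighs the drift `D`. -/
theorem IsFeedbackSolution.funnel_lt_of_drift_le {γ N D : ℝ} (hψ : IsFunnel ψ)
    (hX : IsFeedbackSolution A B L (fun t => truncGain ψ kr δ t (L (X t))) X)
    (hN : ∀ t, 0 ≤ t → (∀ s, 0 ≤ s → s ≤ t → ψ s * ‖L (X s)‖ ≤ 1) → ‖X t‖ ≤ N)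
    (hD0 : 0 ≤ D)
    (hD : ∀ t, 0 < t → ‖X t‖ ≤ N → ∃ d, HasDerivAt (fun s => ψ s ^ 2 * ‖L (X s)‖ ^ 2) d t ∧
      d ≤ D - 2 * (truncGain ψ kr δ t (L (X t)) * γ) * (ψ t ^ 2 * ‖L (X t)‖ ^ 2))
    (hδ : 0 < δ) (hδ2 : δ ≤ 1 / 2) (hδD : δ ≤ kr * γ / (D + 1))
    (h0 : ψ 0 ^ 2 * ‖L (X 0)‖ ^ 2 < 1 - δ) {t : ℝ} (ht : 0 ≤ t) :
    ψ t ^ 2 * ‖L (X t)‖ ^ 2 < 1 - δ := by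
  have hXc : ContinuousOn X (Ici 0) := fun t ht =>
    (hX.hasDerivAt t ht).continuousAt.continuousWithinAt
  refine lt_of_barrier (g := fun t => ψ t ^ 2 * ‖L (X t)‖ ^ 2)
    ((hψ.contDiffOn.continuousOn.pow 2).mul ((L.continuous.comp_continuousOn hXc).norm.pow 2))
    h0 (fun t ht hlevel hle => ?_) ht
  have hfun (s : ℝ) (hs : 0 ≤ s) (hst : s ≤ t) : ψ s * ‖L (X s)‖ ≤ 1 :=
    (mul_sq_le_one_iff (hψ.nonneg hs) (norm_nonneg _)).1 ((hle s hs hst).trans (by linarith))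
  obtain ⟨d, hder, hd⟩ := hD t ht (hN t ht.le hfun)
  refine ⟨d, hd.trans_lt ?_, hder⟩
  have hgain : D + 1 ≤ truncGain ψ kr δ t (L (X t)) * γ := by
    rw [truncGain, hlevel, sub_sub_cancel, max_self, div_mul_eq_mul_div, le_div_iff₀ hδ]
    rw [le_div_iff₀ (by linarith)] at hδD
    linarith
  rw [hlevel]
  nlinarith

/-- A solution on `[0, ∞)` of the closed loop `X' = A X - k B L X` with the funnel gain
`k = kr / (1 - ψ² ‖L X‖²)`, along which the denominator stays above `δ`. -/
structure IsFunnelSolution (A : V →L[ℝ] V) (B : U →L[ℝ] V) (L : V →L[ℝ] U) (ψ : ℝ → ℝ)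
    (kr δ : ℝ) (X : ℝ → V) : Prop where
  δ_pos : 0 < δ
  le_denom : ∀ t, 0 ≤ t → δ ≤ 1 - ψ t ^ 2 * ‖L (X t)‖ ^ 2
  hasDerivAt : ∀ t, 0 ≤ t → HasDerivAt X
    (A (X t) - (kr / (1 - ψ t ^ 2 * ‖L (X t)‖ ^ 2)) • B (L (X t))) t

theorem IsEnergyForm.exists_isFunnelSolution [CompleteSpace V] (h : IsEnergyForm A B L Q a c C γ)
    (hψ : IsFunnel ψ) (hkr : 0 < kr) {v0 : V} (h0 : ψ 0 * ‖L v0‖ < 1) :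
    ∃ δ X, IsFunnelSolution A B L ψ kr δ X ∧ X 0 = v0 ∧ BoundedSignal X ∧
      (C ≤ 2 * kr * γ → Tendsto X atTop (𝓝 0)) := by
  obtain ⟨N, hN0, hN⟩ := h.exists_norm_le_of_mem_funnel hψ v0
  obtain ⟨D, hD0, hD⟩ := h.exists_funnel_drift_le hψ hN0
  have hγ := h.γ_pos
  have h0' : ψ 0 ^ 2 * ‖L v0‖ ^ 2 < 1 := by
    rw [← mul_pow]
    exact (sq_lt_one_iff₀ (mul_nonneg (hψ.nonneg le_rfl) (norm_nonneg _))).2 h0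
  obtain ⟨δ, hδ, hδ2, hδ0, hδD⟩ :=
    exists_truncation_level h0' (show 0 < kr * γ / (D + 1) by positivity)
  obtain ⟨X, hX0, hX⟩ := exists_truncated_solution A B L hψ hkr.le hδ v0
  have hbar (t : ℝ) (ht : 0 ≤ t) : ψ t ^ 2 * ‖L (X t)‖ ^ 2 < 1 - δ :=
    hX.funnel_lt_of_drift_le hψ (hN _ X hX hX0) hD0 (hD _ X hX) hδ hδ2 hδD (hX0 ▸ hδ0) ht
  refine ⟨δ, X, ⟨hδ, fun t ht => by linarith [hbar t ht], fun t ht => ?_⟩, hX0,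
    ⟨N, fun t ht => hN _ X hX hX0 t ht fun s hs _ => ?_⟩, fun hC => ?_⟩
  · have hder := hX.hasDerivAt t ht
    rwa [truncGain, max_eq_right (by linarith [hbar t ht])] at hder
  · exact (mul_sq_le_one_iff (hψ.nonneg hs) (norm_nonneg _)).1 (by linarith [hbar s hs])
  · refine h.tendsto_zero hX fun t _ => hC.trans ?_
    have hgain := le_truncGain (ψ := ψ) hkr.le hδ (hδ2.trans (by norm_num)) t (L (X t))
    gcongr

end HighGain

/-! ### The cascade of auxiliary errors -/

section Cascade

variable {U : Type*} [NormedAddCommGroup U] [InnerProductSpace ℝ U]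

theorem abs_le_toReal_supNorm {f : ℝ → ℝ} (hf : supNorm f ≠ ∞) {t : ℝ} (ht : 0 < t) :
    |f t| ≤ (supNorm f).toReal := by
  have hle : ‖f t‖ₑ ≤ supNorm f := le_iSup₂ (f := fun t (_ : t ∈ Ioi (0 : ℝ)) => ‖f t‖ₑ) t ht
  simpa using ENNReal.toReal_mono hf hle

theorem exists_bounds_of_supNorm_add_lt {f g : ℝ → ℝ} {κ : ℝ}
    (h : supNorm f + supNorm g < ENNReal.ofReal κ) :
    ∃ a b, 0 ≤ b ∧ a + b < κ ∧ ∀ t, 0 < t → f t ≤ a ∧ g t ≤ b := by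
  have hfin : supNorm f + supNorm g ≠ ∞ := (h.trans ENNReal.ofReal_lt_top).ne
  obtain ⟨hf, hg⟩ := ENNReal.add_ne_top.1 hfin
  refine ⟨(supNorm f).toReal, (supNorm g).toReal, ENNReal.toReal_nonneg,
    ?_, fun t ht => ⟨(le_abs_self _).trans (abs_le_toReal_supNorm hf ht),
      (le_abs_self _).trans (abs_le_toReal_supNorm hg ht)⟩⟩
  rw [← ENNReal.ofReal_toReal hfin, ENNReal.toReal_add hf hg] at h
  exact (ENNReal.ofReal_lt_ofReal_iff_of_nonneg (by positivity)).1 h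

theorem exists_level_of_add_lt {a b κ g₀ : ℝ} (hb : 0 ≤ b) (hab : a + b < κ) (hg₀ : g₀ < 1) :
    ∃ ε, 0 < ε ∧ ε < 1 ∧ g₀ < ε ∧ b < (κ - a) * ε := by
  have hκ : 0 < κ - a := by linarith
  have hq : b / (κ - a) < 1 := by
    rw [div_lt_one hκ]
    linarith
  have hq0 : 0 ≤ b / (κ - a) := by positivity
  obtain ⟨ε, hε, hε1⟩ := exists_between (max_lt hg₀ hq)
  obtain ⟨hg, hqε⟩ := max_lt_iff.1 hε
  refine ⟨ε, hq0.trans_lt hqε, hε1, hg, ?_⟩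
  rwa [div_lt_iff₀' hκ] at hqε

theorem cascade_drift_neg {p q a b κ ε : ℝ} {x y : U} (hp : 0 < p) (hq : q / p ≤ a)
    (hy : p * ‖y‖ ≤ b) (hx : p * ‖x‖ = ε) (hε : 0 < ε) (hbε : b < (κ - a) * ε) :
    2 * p * q * ‖x‖ ^ 2 + p ^ 2 * (2 * inner ℝ x (y - κ • x)) < 0 := by
  have hweight : p * q * ‖x‖ ^ 2 ≤ a * ε ^ 2 := by
    calc p * q * ‖x‖ ^ 2 = q / p * ε ^ 2 := by
          rw [← hx]
          field_simp
      _ ≤ a * ε ^ 2 := by gcongr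
  have hnext : p ^ 2 * inner ℝ x y ≤ ε * b := by
    calc p ^ 2 * inner ℝ x y ≤ p ^ 2 * (‖x‖ * ‖y‖) := by
          gcongr
          exact real_inner_le_norm _ _
      _ = (p * ‖x‖) * (p * ‖y‖) := by ring
      _ ≤ ε * b := by
          rw [hx]
          gcongr
  have hself : p ^ 2 * ‖x‖ ^ 2 = ε ^ 2 := by rw [← mul_pow, hx]
  have hsum : a * ε ^ 2 + ε * b - κ * ε ^ 2 < 0 := by nlinarith
  rw [inner_sub_right, inner_smul_right, real_inner_self_eq_norm_sq]
  linear_combination 2 * hweight + 2 * hnext + 2 * hsum - 2 * κ * hself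

theorem exists_funnel_bound_of_cascade {φ ψ : ℝ → ℝ} (hφ : IsFunnel φ) (hψ : IsFunnel ψ) {κ : ℝ}
    (hκ : supNorm (fun t => derivWithin φ (Ici 0) t / φ t) + supNorm (fun t => φ t / ψ t)
      < ENNReal.ofReal κ)
    {e e' : ℝ → U} (he : ∀ t, 0 ≤ t → HasDerivWithinAt e (e' t - κ • e t) (Ici 0) t)
    (h0 : φ 0 * ‖e 0‖ < 1) (he' : ∀ t, 0 ≤ t → ψ t * ‖e' t‖ ≤ 1) :
    ∃ ε : ℝ, 0 < ε ∧ ε < 1 ∧ ∀ t, 0 ≤ t → φ t * ‖e t‖ ≤ ε := by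
  obtain ⟨a, b, hb, hab, hbound⟩ := exists_bounds_of_supNorm_add_lt hκ
  obtain ⟨ε, hε, hε1, h0ε, hbε⟩ := exists_level_of_add_lt hb hab h0
  have hφe (t : ℝ) (ht : 0 ≤ t) : 0 ≤ φ t * ‖e t‖ := mul_nonneg (hφ.nonneg ht) (norm_nonneg _)
  have hec : ContinuousOn e (Ici 0) := fun t ht => (he t ht).continuousWithinAt
  refine ⟨ε, hε, hε1, fun t ht => (lt_of_pow_lt_pow_left₀ 2 hε.le ?_).le⟩
  simp only [mul_pow]
  refine lt_of_barrier (g := fun t => φ t ^ 2 * ‖e t‖ ^ 2)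
    ((hφ.contDiffOn.continuousOn.pow 2).mul (hec.norm.pow 2)) ?_ (fun t ht hlevel _ => ?_) ht
  · rw [← mul_pow]
    exact pow_lt_pow_left₀ h0ε (hφe 0 le_rfl) two_ne_zero
  · have het : HasDerivAt e (e' t - κ • e t) t := (he t ht.le).hasDerivAt (Ici_mem_nhds ht)
    refine ⟨_, ?_, ((hφ.hasDerivAt ht).pow 2).mul het.norm_sq⟩
    have hlevel' : φ t * ‖e t‖ = ε := by
      rw [← mul_pow] at hlevel
      exact (pow_left_inj₀ (hφe t ht.le) hε.le two_ne_zero).1 hlevel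
    have hnext : φ t * ‖e' t‖ ≤ b := by
      have hψt := hψ.pos t ht
      calc φ t * ‖e' t‖ = φ t / ψ t * (ψ t * ‖e' t‖) := by field_simp
        _ ≤ b * 1 := mul_le_mul (hbound t ht).2 (he' t ht.le)
            (mul_nonneg hψt.le (norm_nonneg _)) hb
        _ = b := mul_one b
    simpa using cascade_drift_neg (hφ.pos t ht) (hbound t ht).1 hnext hlevel' hε hbε

end Cascade

/-! ### Time domains and absolutely continuous solutions -/

section TimeDomain

theorem timeDomain_top : timeDomain ⊤ = Ici 0 := by
  ext t
  simp [timeDomain, EReal.coe_lt_top]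

theorem timeDomain_subset (ω : EReal) : timeDomain ω ⊆ Ici 0 := fun _ ht => ht.1

theorem zero_mem_timeDomain {ω : EReal} (hω : 0 < ω) : (0 : ℝ) ∈ timeDomain ω := ⟨le_rfl, hω⟩

theorem Icc_subset_timeDomain {ω : EReal} {t : ℝ} (ht : t ∈ timeDomain ω) :
    Icc 0 t ⊆ timeDomain ω := fun _ hs =>
  ⟨hs.1, (EReal.coe_le_coe_iff.2 hs.2).trans_lt ht.2⟩

theorem exists_gt_mem_timeDomain {ω : EReal} {t : ℝ} (ht : t ∈ timeDomain ω) :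
    ∃ b, t < b ∧ b ∈ timeDomain ω := by
  obtain ⟨b, htb, hbω⟩ := EReal.lt_iff_exists_real_btwn.1 ht.2
  rw [EReal.coe_lt_coe_iff] at htb
  exact ⟨b, htb, ht.1.trans htb.le, hbω⟩

theorem convex_timeDomain (ω : EReal) : Convex ℝ (timeDomain ω) :=
  Set.OrdConnected.convex ⟨fun _ hx _ hy _ hs => Icc_subset_timeDomain hy ⟨hx.1.trans hs.1, hs.2⟩⟩

theorem uniqueDiffOn_timeDomain {ω : EReal} (hω : 0 < ω) : UniqueDiffOn ℝ (timeDomain ω) := by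
  obtain ⟨b, hb, hbω⟩ := exists_gt_mem_timeDomain (zero_mem_timeDomain hω)
  have hsub : Ioo 0 b ⊆ timeDomain ω := Ioo_subset_Icc_self.trans (Icc_subset_timeDomain hbω)
  exact uniqueDiffOn_convex (convex_timeDomain ω)
    ((nonempty_Ioo.2 hb).mono (isOpen_Ioo.subset_interior_iff.2 hsub))

theorem Icc_mem_nhdsWithin_timeDomain {ω : EReal} {t b : ℝ} (htb : t < b) :
    Icc 0 b ∈ 𝓝[timeDomain ω] t := by
  filter_upwards [self_mem_nhdsWithin, nhdsWithin_le_nhds (Iio_mem_nhds htb)] with s hs hsb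
  exact ⟨hs.1, le_of_lt hsb⟩

theorem absolutelyContinuousOnInterval_comp_of_lipschitzWith {X Y : Type*} [PseudoMetricSpace X]
    [PseudoMetricSpace Y] {f : ℝ → X} {g : X → Y} {K : NNReal} {a b : ℝ} (hg : LipschitzWith K g)
    (hf : AbsolutelyContinuousOnInterval f a b) :
    AbsolutelyContinuousOnInterval (fun t => g (f t)) a b := by
  refine squeeze_zero (fun I => Finset.sum_nonneg fun i _ => dist_nonneg) (fun I => ?_)
    (by simpa using Tendsto.const_mul (K : ℝ) hf)
  rw [Finset.mul_sum]
  exact Finset.sum_le_sum fun i _ => hg.dist_le_mul _ _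

theorem absolutelyContinuousOnInterval_clm_comp {U V : Type*} [NormedAddCommGroup U]
    [NormedSpace ℝ U] [NormedAddCommGroup V] [NormedSpace ℝ V] (T : U →L[ℝ] V) {f : ℝ → U} {a b : ℝ}
    (hf : AbsolutelyContinuousOnInterval f a b) :
    AbsolutelyContinuousOnInterval (fun t => T (f t)) a b :=
  absolutelyContinuousOnInterval_comp_of_lipschitzWith T.lipschitz hf

variable {E : Type*} [NormedAddCommGroup E] [NormedSpace ℝ E] {f g : ℝ → E}

theorem exists_eq_add_const_of_ae_hasDerivAt {G : ℝ → E} {b : ℝ} (hb : 0 ≤ b)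
    (hf : AbsolutelyContinuousOnInterval f 0 b) (hG : ContDiff ℝ 1 G)
    (hfG : ∀ᵐ t : ℝ, t ∈ Icc 0 b → HasDerivAt f (deriv G t) t) :
    ∃ c, ∀ t ∈ Icc 0 b, f t = G t + c := by
  obtain ⟨c, hc⟩ :=
    (hf.sub hG.contDiffOn.absolutelyContinuousOnInterval).const_of_ae_hasDerivAt_zero <| by
      rw [uIcc_of_le hb]
      filter_upwards [hfG] with t ht htb
      simpa using (ht htb).sub (hG.differentiable_one t).hasDerivAt
  rw [uIcc_of_le hb] at hc
  refine ⟨c, fun t ht => ?_⟩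
  rw [← hc t ht, Pi.sub_apply, add_sub_cancel]

theorem hasDerivWithinAt_of_absolutelyContinuousOnInterval [CompleteSpace E] {ω : EReal}
    (hf : ∀ b ∈ timeDomain ω, AbsolutelyContinuousOnInterval f 0 b)
    (hfg : ∀ᵐ t : ℝ, t ∈ timeDomain ω → HasDerivAt f (g t) t)
    (hg : ContinuousOn g (timeDomain ω)) {t : ℝ} (ht : t ∈ timeDomain ω) :
    HasDerivWithinAt f (g t) (timeDomain ω) t := by
  obtain ⟨b, htb, hb⟩ := exists_gt_mem_timeDomain ht
  have hsub : Icc 0 b ⊆ timeDomain ω := Icc_subset_timeDomain hb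
  set g' : ℝ → E := IccExtend hb.1 ((Icc 0 b).domRestrict g) with hg'_def
  have hg'c : Continuous g' := (hg.mono hsub).domRestrict.Icc_extend'
  have hg' (s : ℝ) (hs : s ∈ Icc 0 b) : g' s = g s := by
    rw [hg'_def, IccExtend_of_mem _ _ hs, domRestrict_apply]
  set G : ℝ → E := fun s => ∫ τ in (0 : ℝ)..s, g' τ
  have hG (s : ℝ) : HasDerivAt G (g' s) s := (hg'c.integral_hasStrictDerivAt 0 s).hasDerivAt
  have hderivG : deriv G = g' := funext fun s => (hG s).deriv
  obtain ⟨c, hc⟩ := exists_eq_add_const_of_ae_hasDerivAt (G := G) hb.1 (hf b hb)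
    (contDiff_one_iff_deriv.2 ⟨fun s => (hG s).differentiableAt, hderivG ▸ hg'c⟩) (by
      filter_upwards [hfg] with s hs hsb
      rw [hderivG, hg' s hsb]
      exact hs (hsub hsb))
  have htb' : t ∈ Icc 0 b := ⟨ht.1, htb.le⟩
  rw [← hg' t htb']
  exact (((hG t).add_const c).hasDerivWithinAt.congr hc (hc t htb')).mono_of_mem_nhdsWithin
    (Icc_mem_nhdsWithin_timeDomain htb)

theorem absolutelyContinuousOnInterval_of_hasDerivAt {f f' : ℝ → E} {b : ℝ} (hb : 0 ≤ b)
    (hf : ∀ t, 0 ≤ t → HasDerivAt f (f' t) t) (hf' : ContinuousOn f' (Ici 0)) :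
    AbsolutelyContinuousOnInterval f 0 b := by
  obtain ⟨M, hM⟩ := (isCompact_Icc (a := (0 : ℝ)) (b := b)).exists_bound_of_continuousOn
    (hf'.mono Icc_subset_Ici_self)
  refine LipschitzOnWith.absolutelyContinuousOnInterval (K := M.toNNReal) ?_
  rw [uIcc_of_le hb]
  refine (convex_Icc 0 b).lipschitzOnWith_of_nnnorm_hasDerivWithin_le (f' := f')
    (fun t ht => (hf t ht.1).hasDerivWithinAt) fun t ht => ?_
  rw [← NNReal.coe_le_coe, coe_nnnorm]
  exact (hM t ht).trans (Real.le_coe_toNNReal M)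

end TimeDomain

/-! ### Auxiliary output matrices -/

section OutMat

variable {R ι κ μ : Type*} [CommRing R] [Fintype ι] [DecidableEq ι]

/-- The matrices `C (A + k₀) ⋯ (A + k_{i-1})`: since `d/dt (C x) = C A x` along `x' = A x`, these
are the output matrices of the signals defined by `e_{i+1} = d/dt e_i + k_i e_i`. -/
def outMat (A : Matrix ι ι R) (C : Matrix κ ι R) (k : ℕ → R) : ℕ → Matrix κ ι R
  | 0 => C
  | i + 1 => outMat A C k i * (A + k i • 1)

theorem outMat_succ_mul_pow (A : Matrix ι ι R) (C : Matrix κ ι R) (k : ℕ → R) (i j : ℕ) :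
    outMat A C k (i + 1) * A ^ j
      = outMat A C k i * A ^ (j + 1) + k i • (outMat A C k i * A ^ j) := by
  rw [outMat, Matrix.mul_assoc, Matrix.add_mul, Matrix.mul_add, pow_succ',
    Matrix.smul_mul, Matrix.one_mul, Matrix.mul_smul]

theorem map_outMat {R' : Type*} [CommRing R'] (f : R →+* R') (A : Matrix ι ι R) (C : Matrix κ ι R)
    (k : ℕ → R) (i : ℕ) :
    (outMat A C k i).map f = outMat (A.map f) (C.map f) (fun s => f (k s)) i := by
  induction i with
  | zero => rfl
  | succ i ih =>
    rw [outMat, outMat, Matrix.map_mul, ih]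
    congr 1
    ext a b
    by_cases hab : a = b <;> simp [hab]

theorem map_mul_pow_mul {R' : Type*} [CommRing R'] (f : R →+* R') (A : Matrix ι ι R)
    (B : Matrix ι μ R) (C : Matrix κ ι R) (j : ℕ) :
    (C * A ^ j * B).map f = C.map f * A.map f ^ j * B.map f := by
  rw [Matrix.map_mul, Matrix.map_mul]
  congr 2
  exact map_pow f.mapMatrix A j

variable {A : Matrix ι ι R} {B : Matrix ι μ R} {C : Matrix κ ι R} {r : ℕ}

theorem outMat_mul_pow_mul_eq_zero (h : ∀ j, j + 2 ≤ r → C * A ^ j * B = 0) (k : ℕ → R) (i j : ℕ)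
    (hij : i + j + 2 ≤ r) : outMat A C k i * A ^ j * B = 0 := by
  induction i generalizing j with
  | zero => exact h j (by omega)
  | succ i ih =>
    rw [outMat_succ_mul_pow, Matrix.add_mul, Matrix.smul_mul, ih (j + 1) (by omega),
      ih j (by omega), smul_zero, add_zero]

theorem outMat_mul_eq_zero (h : ∀ j, j + 2 ≤ r → C * A ^ j * B = 0) (k : ℕ → R) {i : ℕ}
    (hi : i + 2 ≤ r) : outMat A C k i * B = 0 := by
  simpa using outMat_mul_pow_mul_eq_zero h k i 0 hi

theorem outMat_mul_pow_mul_eq (h : ∀ j, j + 2 ≤ r → C * A ^ j * B = 0) (k : ℕ → R) (i j : ℕ)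
    (hij : i + j + 1 = r) : outMat A C k i * A ^ j * B = C * A ^ (r - 1) * B := by
  induction i generalizing j with
  | zero => rw [outMat, show j = r - 1 by omega]
  | succ i ih =>
    rw [outMat_succ_mul_pow, Matrix.add_mul, Matrix.smul_mul, ih (j + 1) (by omega),
      outMat_mul_pow_mul_eq_zero h k i j (by omega), smul_zero, add_zero]

theorem outMat_mulVec_eq_prod_smul [Fintype μ] (h : ∀ j, j + 2 ≤ r → C * A ^ j * B = 0)
    (k : ℕ → R) {l : R} {v : ι → R} {q : μ → R} (hv : A *ᵥ v = l • v + B *ᵥ q) (i : ℕ)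
    (hi : i + 1 ≤ r) :
    outMat A C k i *ᵥ v = (∏ s ∈ Finset.range i, (l + k s)) • (C *ᵥ v) := by
  induction i with
  | zero => simp [outMat]
  | succ i ih =>
    have hshift : (A + k i • 1) *ᵥ v = (l + k i) • v + B *ᵥ q := by
      rw [Matrix.add_mulVec, hv, Matrix.smul_mulVec, Matrix.one_mulVec, add_smul]
      abel
    rw [outMat, ← Matrix.mulVec_mulVec, hshift, Matrix.mulVec_add, Matrix.mulVec_smul,
      ih (by omega), Matrix.mulVec_mulVec, outMat_mul_eq_zero h k (by omega), Matrix.zero_mulVec,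
      add_zero, smul_smul, Finset.prod_range_succ, mul_comm]

end OutMat

/-! ### Zeros and zero dynamics -/

section Zeros

theorem mulVec_injective_of_rank_eq_card {K ι κ : Type*} [Field K] [Fintype κ] {M : Matrix ι κ K}
    (hM : M.rank = Fintype.card κ) : Function.Injective M.mulVec := by
  have hker : LinearMap.ker M.mulVecLin = ⊥ := by
    have hsum := M.mulVecLin.finrank_range_add_finrank_ker
    rw [← Matrix.rank, hM, Module.finrank_fintype_fun_eq_card] at hsum
    exact Submodule.finrank_eq_zero.1 (by omega)
  exact LinearMap.ker_eq_bot.1 hker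

theorem eq_zero_of_rank_rosenbrock {n m : ℕ} {A : Matrix (Fin n) (Fin n) ℝ}
    {B : Matrix (Fin n) (Fin m) ℝ} {C : Matrix (Fin m) (Fin n) ℝ} {l : ℂ}
    (h : (rosenbrock A B C l).rank = n + m) {v : Fin n → ℂ} {q : Fin m → ℂ}
    (hA : A.map Complex.ofReal *ᵥ v + B.map Complex.ofReal *ᵥ q = l • v)
    (hC : C.map Complex.ofReal *ᵥ v = 0) : v = 0 ∧ q = 0 := by
  have hzero : rosenbrock A B C l *ᵥ Sum.elim v q = 0 := by
    rw [rosenbrock, Matrix.fromBlocks_mulVec, Sum.elim_comp_inl, Sum.elim_comp_inr,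
      Matrix.sub_mulVec, Matrix.smul_mulVec, Matrix.one_mulVec, hC, Matrix.zero_mulVec, add_zero,
      sub_add_eq_add_sub, hA, sub_self, Sum.elim_zero_zero]
  have helim : Sum.elim v q = 0 :=
    mulVec_injective_of_rank_eq_card (by simpa using h) (hzero.trans (mulVec_zero _).symm)
  exact ⟨funext fun i => congrFun helim (Sum.inl i), funext fun i => congrFun helim (Sum.inr i)⟩

section CommRing

variable {𝕜 ι κ : Type*} [CommRing 𝕜] [Fintype ι] [DecidableEq ι] [Fintype κ]

/-- The matrix `(1 - R L) A (1 - R L) - R L`. If `L R = 1`, then it leaves `ker L` invariant, where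
it generates the zero dynamics of the system of relative degree one with output matrix `L` and
input matrix with the same range as `R`; it acts as `-1` on the quotient by `ker L`. -/
def zeroDynMat (A : Matrix ι ι 𝕜) (R : Matrix ι κ 𝕜) (L : Matrix κ ι 𝕜) : Matrix ι ι 𝕜 :=
  (1 - R * L) * A * (1 - R * L) - R * L

variable {A : Matrix ι ι 𝕜} {R : Matrix ι κ 𝕜} {L : Matrix κ ι 𝕜} {v : ι → 𝕜}

theorem zeroDynMat_mulVec_of_mem_ker (hv : L *ᵥ v = 0) :
    zeroDynMat A R L *ᵥ v = A *ᵥ v - R *ᵥ (L *ᵥ (A *ᵥ v)) := by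
  simp only [zeroDynMat, Matrix.sub_mulVec, ← Matrix.mulVec_mulVec, hv, Matrix.one_mulVec,
    Matrix.mulVec_zero, sub_zero]

theorem map_zeroDynMat {𝕜' : Type*} [CommRing 𝕜'] (f : 𝕜 →+* 𝕜') (A : Matrix ι ι 𝕜)
    (R : Matrix ι κ 𝕜) (L : Matrix κ ι 𝕜) :
    (zeroDynMat A R L).map f = zeroDynMat (A.map f) (R.map f) (L.map f) := by
  have hproj : (1 - R * L).map f = 1 - R.map f * L.map f := by
    rw [Matrix.map_sub _ (map_sub _), Matrix.map_mul, Matrix.map_one _ (map_zero _) (map_one _)]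
  rw [zeroDynMat, zeroDynMat, Matrix.map_sub _ (map_sub _), Matrix.map_mul, Matrix.map_mul,
    Matrix.map_mul, hproj]

variable [DecidableEq κ]

theorem mul_zeroDynMat (hLR : L * R = 1) : L * zeroDynMat A R L = -L := by
  have hproj : L * (1 - R * L) = 0 := by
    rw [Matrix.mul_sub, ← Matrix.mul_assoc, hLR, Matrix.mul_one, Matrix.one_mul, sub_self]
  rw [zeroDynMat, Matrix.mul_sub, ← Matrix.mul_assoc, ← Matrix.mul_assoc, hproj,
    ← Matrix.mul_assoc, hLR, Matrix.zero_mul, Matrix.zero_mul, Matrix.one_mul, zero_sub]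

theorem mulVec_eq_of_zeroDynMat_mulVec_eq_smul [NoZeroDivisors 𝕜] (hLR : L * R = 1) {l : 𝕜}
    (hl : l + 1 ≠ 0) (hv : zeroDynMat A R L *ᵥ v = l • v) :
    L *ᵥ v = 0 ∧ A *ᵥ v = l • v + R *ᵥ (L *ᵥ (A *ᵥ v)) := by
  have hLv : L *ᵥ v = 0 := by
    have hsmul : (l + 1) • (L *ᵥ v) = 0 := by
      rw [add_smul, one_smul, ← Matrix.mulVec_smul, ← hv, Matrix.mulVec_mulVec,
        mul_zeroDynMat hLR, Matrix.neg_mulVec, neg_add_cancel]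
    exact (smul_eq_zero.1 hsmul).resolve_left hl
  rw [zeroDynMat_mulVec_of_mem_ker hLv] at hv
  exact ⟨hLv, by rw [← hv, sub_add_cancel]⟩

end CommRing

theorem isHurwitzMatrix_zeroDynMat {ι κ μ : Type*} [Fintype ι] [DecidableEq ι] [Fintype κ]
    [DecidableEq κ] [Fintype μ] {A : Matrix ι ι ℝ} {B : Matrix ι μ ℝ} {C : Matrix κ ι ℝ}
    {N : Matrix μ κ ℝ} {k : ℕ → ℝ} {r : ℕ} (hrel : ∀ j, j + 2 ≤ r + 1 → C * A ^ j * B = 0)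
    (hk : ∀ i < r, 0 < k i) (hN : outMat A C k r * (B * N) = 1)
    (hzero : ∀ (l : ℂ) (v : ι → ℂ) (q : μ → ℂ), 0 ≤ l.re →
      A.map Complex.ofReal *ᵥ v = l • v + B.map Complex.ofReal *ᵥ q →
      C.map Complex.ofReal *ᵥ v = 0 → v = 0) :
    IsHurwitzMatrix (zeroDynMat A (B * N) (outMat A C k r)) := by
  set f := Complex.ofRealHom
  refine isHurwitzMatrix_of_forall_eigenvector fun l v hl hv => ?_
  have hlk (t : ℝ) (ht : 0 < t) : l + t ≠ 0 := fun h0 => by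
    have hre := congrArg Complex.re h0
    rw [Complex.add_re, Complex.ofReal_re, Complex.zero_re] at hre
    linarith
  have hNc : (outMat A C k r).map f * (B * N).map f = 1 := by
    rw [← Matrix.map_mul, hN, Matrix.map_one _ (map_zero _) (map_one _)]
  change (zeroDynMat A (B * N) (outMat A C k r)).map f *ᵥ v = l • v at hv
  rw [map_zeroDynMat] at hv
  obtain ⟨hLv, hAv⟩ := mulVec_eq_of_zeroDynMat_mulVec_eq_smul hNc
    (by simpa using hlk 1 one_pos) hv
  rw [Matrix.map_mul, ← Matrix.mulVec_mulVec] at hAv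
  have hrelc (j : ℕ) (hj : j + 2 ≤ r + 1) : C.map f * A.map f ^ j * B.map f = 0 := by
    rw [← map_mul_pow_mul, hrel j hj, Matrix.map_zero _ (map_zero f)]
  rw [map_outMat, outMat_mulVec_eq_prod_smul hrelc _ hAv r le_rfl] at hLv
  refine hzero l v _ hl hAv ((smul_eq_zero.1 hLv).resolve_left ?_)
  exact Finset.prod_ne_zero_iff.2 fun s hs => hlk _ (hk s (Finset.mem_range.1 hs))

end Zeros

/-! ### Internal models -/

section SingleBlock

theorem map_charpoly {R S ι : Type*} [CommRing R] [CommRing S] [Fintype ι] [DecidableEq ι]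
    (f : R[X] →+* S) (M : Matrix ι ι R) : f M.charpoly = ((charmatrix M).map f).det := by
  rw [Matrix.charpoly, RingHom.map_det]
  rfl

theorem algebraMap_charpoly_sub_vecMulVec {K ι : Type*} [Field K] [Fintype ι] [DecidableEq ι]
    (M : Matrix ι ι K) (b c : ι → K) :
    algebraMap K[X] (RatFunc K) (M - vecMulVec b c).charpoly
      = algebraMap K[X] (RatFunc K) M.charpoly
        * ((fun i => algebraMap K (RatFunc K) (c i)) ⬝ᵥ
          (((charmatrix M).map (algebraMap K[X] (RatFunc K)))⁻¹ *ᵥ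
            fun i => algebraMap K (RatFunc K) (b i)) + 1) := by
  set f := algebraMap K[X] (RatFunc K)
  set b' : ι → RatFunc K := fun i => algebraMap K (RatFunc K) (b i) with hb'
  set c' : ι → RatFunc K := fun i => algebraMap K (RatFunc K) (c i) with hc'
  have hfC (x : K) : f (Polynomial.C x) = algebraMap K (RatFunc K) x :=
    (IsScalarTower.algebraMap_apply K K[X] (RatFunc K) x).symm
  have hchar : (charmatrix (M - vecMulVec b c)).map f
      = (charmatrix M).map f + replicateCol Unit b' * replicateRow Unit c' := by
    rw [← vecMulVec_eq Unit]
    ext i j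
    simp only [Matrix.map_apply, charmatrix_apply, Matrix.add_apply, Matrix.sub_apply,
      vecMulVec_apply, map_sub, map_mul, hfC, hb', hc']
    ring
  have hunit : IsUnit ((charmatrix M).map f).det := by
    rw [← map_charpoly]
    exact ((map_ne_zero_iff f (IsFractionRing.injective _ _)).2 M.charpoly_monic.ne_zero).isUnit
  rw [map_charpoly, hchar, det_add_replicateCol_mul_replicateRow hunit, ← map_charpoly, det_unique,
    Matrix.add_apply, Matrix.one_apply_eq, add_comm, Matrix.mul_assoc,
    ← Matrix.replicateCol_mulVec, Matrix.replicateRow_mul_replicateCol_apply]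

variable {p : ℕ} {α β : ℝ[X]} {Ah : Matrix (Fin p) (Fin p) ℝ} {bh ch : Fin p → ℝ}

theorem IsMinimalRealization.charpoly_eq (h : IsMinimalRealization α β Ah bh ch) (hα : α.Monic)
    (hcop : IsCoprime α β) (hdeg : α.degree = (p : WithBot ℕ)) :
    Ah.charpoly = α ∧ (Ah - vecMulVec bh ch).charpoly = β := by
  set f := algebraMap ℝ[X] (RatFunc ℝ)
  have hf : Function.Injective f := IsFractionRing.injective _ _
  have hcross : (Ah - vecMulVec bh ch).charpoly * α = Ah.charpoly * β := hf <| by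
    rw [map_mul, map_mul, algebraMap_charpoly_sub_vecMulVec, h.transfer, mul_assoc,
      div_mul_cancel₀ _ ((map_ne_zero_iff f hf).2 hα.ne_zero)]
  have hchar : Ah.charpoly = α :=
    eq_of_monic_of_dvd_of_natDegree_le hα Ah.charpoly_monic
      (hcop.dvd_of_dvd_mul_right (Dvd.intro_left _ hcross))
      (by rw [Matrix.charpoly_natDegree_eq_dim, natDegree_eq_of_degree_eq_some hdeg,
        Fintype.card_fin])
  rw [hchar, mul_comm] at hcross
  exact ⟨hchar, mul_left_cancel₀ hα.ne_zero hcross⟩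

end SingleBlock

section Complexification

variable {ι κ : Type*} [Fintype κ]

theorem re_map_ofReal_mulVec (M : Matrix ι κ ℝ) (u : κ → ℂ) (i : ι) :
    ((M.map Complex.ofReal *ᵥ u) i).re = (M *ᵥ fun j => (u j).re) i := by
  simp [Matrix.mulVec, dotProduct]

theorem im_map_ofReal_mulVec (M : Matrix ι κ ℝ) (u : κ → ℂ) (i : ι) :
    ((M.map Complex.ofReal *ᵥ u) i).im = (M *ᵥ fun j => (u j).im) i := by
  simp [Matrix.mulVec, dotProduct]

theorem pow_mulVec_eq_smul {R : Type*} [CommRing R] [DecidableEq κ] {M : Matrix κ κ R} {l : R}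
    {u : κ → R} (hu : M *ᵥ u = l • u) (k : ℕ) : M ^ k *ᵥ u = l ^ k • u := by
  induction k with
  | zero => rw [pow_zero, Matrix.one_mulVec, pow_zero, one_smul]
  | succ k ih =>
    rw [pow_succ, ← Matrix.mulVec_mulVec, hu, Matrix.mulVec_smul, ih, smul_smul, pow_succ']

/-- Half of the Popov–Belevitch–Hautus test. -/
theorem eq_zero_of_mulVec_eq_smul_of_observable [DecidableEq κ] {M : Matrix κ κ ℝ}
    {C : Matrix ι κ ℝ} (hobs : ∀ v : κ → ℝ, (∀ k : ℕ, C *ᵥ (M ^ k *ᵥ v) = 0) → v = 0) {l : ℂ}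
    {u : κ → ℂ} (hu : M.map Complex.ofReal *ᵥ u = l • u)
    (hCu : C.map Complex.ofReal *ᵥ u = 0) : u = 0 := by
  have hCpow (k : ℕ) : (C * M ^ k).map Complex.ofReal *ᵥ u = 0 := by
    have hmap : (C * M ^ k).map Complex.ofRealHom
        = C.map Complex.ofRealHom * M.map Complex.ofRealHom ^ k := by
      rw [Matrix.map_mul]
      exact congrArg _ (map_pow Complex.ofRealHom.mapMatrix M k)
    change (C * M ^ k).map Complex.ofRealHom *ᵥ u = 0
    change M.map Complex.ofRealHom *ᵥ u = l • u at hu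
    change C.map Complex.ofRealHom *ᵥ u = 0 at hCu
    rw [hmap, ← Matrix.mulVec_mulVec, pow_mulVec_eq_smul hu, Matrix.mulVec_smul, hCu, smul_zero]
  have hre : (fun j => (u j).re) = 0 := hobs _ fun k => funext fun i => by
    rw [Matrix.mulVec_mulVec, ← re_map_ofReal_mulVec, hCpow]
    rfl
  have him : (fun j => (u j).im) = 0 := hobs _ fun k => funext fun i => by
    rw [Matrix.mulVec_mulVec, ← im_map_ofReal_mulVec, hCpow]
    rfl
  exact funext fun j => Complex.ext (congrFun hre j) (congrFun him j)

theorem IsHurwitz.eq_zero_of_mulVec_eq_smul [DecidableEq κ] {M : Matrix κ κ ℝ}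
    (hM : IsHurwitz M.charpoly) {l : ℂ} (hl : 0 ≤ l.re) {u : κ → ℂ}
    (hu : M.map Complex.ofReal *ᵥ u = l • u) : u = 0 := by
  by_contra hne
  have hspec : l ∈ spectrum ℂ (M.map Complex.ofReal) := by
    rw [← Matrix.spectrum_toLin', ← Module.End.hasEigenvalue_iff_mem_spectrum]
    exact Module.End.hasEigenvalue_of_hasEigenvector
      (Module.End.hasEigenvector_iff.2 ⟨Module.End.mem_eigenspace_iff.2 hu, hne⟩)
  have hroot := Matrix.mem_spectrum_iff_isRoot_charpoly.1 hspec
  have hmap : (M.map Complex.ofReal).charpoly = M.charpoly.map Complex.ofRealHom :=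
    Matrix.charpoly_map M Complex.ofRealHom
  rw [hmap, IsRoot.def, eval_map] at hroot
  exact (hM l hroot).not_ge hl

end Complexification

section BlockModel

variable {m p : ℕ}

/-- The internal model consists of `m` copies of the single-input single-output system
`(Ah, bh, ch, 1)`, whose poles are the roots of `α`, which is observable in the sense of Hautus,
and which has no zeros in the closed right half plane. -/
structure BlockModel (α : ℝ[X]) (At : Matrix (Fin p × Fin m) (Fin p × Fin m) ℝ)
    (Bt : Matrix (Fin p × Fin m) (Fin m) ℝ) (Ct : Matrix (Fin m) (Fin p × Fin m) ℝ)
    (Ah : Matrix (Fin p) (Fin p) ℝ) (bh ch : Fin p → ℝ) : Prop where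
  At_eq : At = blockDiagonal (fun _ : Fin m => Ah)
  Bt_eq : Bt = Matrix.of (fun (i : Fin p × Fin m) (j : Fin m) => if i.2 = j then bh i.1 else 0)
  Ct_eq : Ct = Matrix.of (fun (j : Fin m) (i : Fin p × Fin m) => if j = i.2 then ch i.1 else 0)
  natDegree_eq : α.natDegree = p
  charpoly_eq : Ah.charpoly = α
  observable : ∀ (l : ℂ) (u : Fin p → ℂ), Ah.map Complex.ofReal *ᵥ u = l • u →
    (fun i => (ch i : ℂ)) ⬝ᵥ u = 0 → u = 0
  zeros : ∀ (l : ℂ) (u : Fin p → ℂ), 0 ≤ l.re →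
    Ah.map Complex.ofReal *ᵥ u
      = l • u + ((fun i => (ch i : ℂ)) ⬝ᵥ u) • (fun i => (bh i : ℂ)) → u = 0

theorem IsInternalModel.exists_blockModel {α : ℝ[X]}
    {At : Matrix (Fin p × Fin m) (Fin p × Fin m) ℝ} {Bt : Matrix (Fin p × Fin m) (Fin m) ℝ}
    {Ct : Matrix (Fin m) (Fin p × Fin m) ℝ} (hα : α.Monic) (h : IsInternalModel α At Bt Ct) :
    ∃ Ah bh ch, BlockModel α At Bt Ct Ah bh ch := by
  obtain ⟨β, Ah, bh, ch, hβ, hcop, hdeg, -, -, hmin, hA, hB, hC⟩ := h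
  obtain ⟨hcharα, hcharβ⟩ := hmin.charpoly_eq hα hcop hdeg
  refine ⟨Ah, bh, ch, hA, hB, hC, natDegree_eq_of_degree_eq_some hdeg, hcharα,
    fun l u hu hcu => ?_, fun l u hl hu => ?_⟩
  · refine eq_zero_of_mulVec_eq_smul_of_observable (C := replicateRow Unit ch)
      (fun v hv => hmin.observable v fun k => congrFun (hv k) ()) hu (funext fun _ => hcu)
  · have hmap : (Ah - vecMulVec bh ch).map Complex.ofReal
        = Ah.map Complex.ofReal - vecMulVec (fun i => (bh i : ℂ)) (fun i => (ch i : ℂ)) := by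
      ext i j
      simp [vecMulVec_apply]
    refine IsHurwitz.eq_zero_of_mulVec_eq_smul (hcharβ ▸ hβ) hl ?_
    rw [hmap, Matrix.sub_mulVec, hu, vecMulVec_mulVec, op_smul_eq_smul, add_sub_cancel_right]

end BlockModel

/-! ### The interconnection of system and internal model -/

namespace LoopData

variable {n m p : ℕ} (S : LoopData n m p)

/-- The system matrix of the interconnection, with state `(x, z)` and input `w`. -/
def augA : Matrix (Fin n ⊕ Fin p × Fin m) (Fin n ⊕ Fin p × Fin m) ℝ :=
  fromBlocks S.A (S.B * S.Ct) 0 S.At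

/-- The input matrix of the interconnection. -/
def augB : Matrix (Fin n ⊕ Fin p × Fin m) (Fin m) ℝ := fromRows S.B S.Bt

/-- The output matrix of the interconnection. -/
def augC : Matrix (Fin m) (Fin n ⊕ Fin p × Fin m) ℝ := fromCols S.C 0

/-- The matrix of the auxiliary error `auxErr i`, for the reference `0`, as a function of the state
of the interconnection. -/
def errMat (i : ℕ) : Matrix (Fin m) (Fin n ⊕ Fin p × Fin m) ℝ := outMat S.augA S.augC S.k i

variable {S}

theorem augC_mul_augA_pow (hrel : ∀ j, j + 2 ≤ S.r → S.C * S.A ^ j * S.B = 0) (j : ℕ)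
    (hj : j + 1 ≤ S.r) : S.augC * S.augA ^ j = fromCols (S.C * S.A ^ j) 0 := by
  induction j with
  | zero => simp [augC]
  | succ j ih =>
    rw [pow_succ, ← Matrix.mul_assoc, ih (by omega), augA, fromCols_mul_fromBlocks,
      ← Matrix.mul_assoc, hrel j (by omega), pow_succ, Matrix.mul_assoc]
    simp

theorem augC_mul_augA_pow_mul_augB (hrel : ∀ j, j + 2 ≤ S.r → S.C * S.A ^ j * S.B = 0) (j : ℕ)
    (hj : j + 1 ≤ S.r) : S.augC * S.augA ^ j * S.augB = S.C * S.A ^ j * S.B := by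
  rw [augC_mul_augA_pow hrel j hj, augB, fromCols_mul_fromRows, Matrix.zero_mul, add_zero]

theorem augC_mul_augA_pow_mul_augB_eq_zero
    (hrel : ∀ j, j + 2 ≤ S.r → S.C * S.A ^ j * S.B = 0) (j : ℕ) (hj : j + 2 ≤ S.r) :
    S.augC * S.augA ^ j * S.augB = 0 := by
  rw [augC_mul_augA_pow_mul_augB hrel j (by omega), hrel j hj]

theorem errMat_mul_augB (hr : 1 ≤ S.r) (hrel : ∀ j, j + 2 ≤ S.r → S.C * S.A ^ j * S.B = 0) :
    S.errMat (S.r - 1) * S.augB = S.C * S.A ^ (S.r - 1) * S.B := by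
  have hgain := outMat_mul_pow_mul_eq (augC_mul_augA_pow_mul_augB_eq_zero hrel) S.k (S.r - 1) 0
    (by omega)
  rwa [pow_zero, Matrix.mul_one, augC_mul_augA_pow_mul_augB hrel _ (by omega)] at hgain

theorem map_augA_mulVec (v : Fin n ⊕ Fin p × Fin m → ℂ) :
    S.augA.map Complex.ofReal *ᵥ v = Sum.elim
      (S.A.map Complex.ofReal *ᵥ (v ∘ Sum.inl)
        + S.B.map Complex.ofReal *ᵥ (S.Ct.map Complex.ofReal *ᵥ (v ∘ Sum.inr)))
      (S.At.map Complex.ofReal *ᵥ (v ∘ Sum.inr)) := by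
  have hmul : (S.B * S.Ct).map Complex.ofReal = S.B.map Complex.ofReal * S.Ct.map Complex.ofReal :=
    Matrix.map_mul (f := Complex.ofRealHom)
  rw [augA, fromBlocks_map, fromBlocks_mulVec, hmul, Matrix.map_zero _ Complex.ofReal_zero,
    Matrix.mulVec_mulVec, Matrix.zero_mulVec, zero_add]

theorem map_augB_mulVec (q : Fin m → ℂ) :
    S.augB.map Complex.ofReal *ᵥ q
      = Sum.elim (S.B.map Complex.ofReal *ᵥ q) (S.Bt.map Complex.ofReal *ᵥ q) := by
  ext i
  cases i <;> rfl

theorem map_augC_mulVec (v : Fin n ⊕ Fin p × Fin m → ℂ) :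
    S.augC.map Complex.ofReal *ᵥ v = S.C.map Complex.ofReal *ᵥ (v ∘ Sum.inl) := by
  ext i
  simp [augC, Matrix.mulVec, dotProduct]

end LoopData

namespace BlockModel

variable {m p : ℕ} {α : ℝ[X]} {At : Matrix (Fin p × Fin m) (Fin p × Fin m) ℝ}
  {Bt : Matrix (Fin p × Fin m) (Fin m) ℝ} {Ct : Matrix (Fin m) (Fin p × Fin m) ℝ}
  {Ah : Matrix (Fin p) (Fin p) ℝ} {bh ch : Fin p → ℝ}

theorem map_At_mulVec (h : BlockModel α At Bt Ct Ah bh ch) (v : Fin p × Fin m → ℂ) (i : Fin p)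
    (j : Fin m) :
    (At.map Complex.ofReal *ᵥ v) (i, j) = (Ah.map Complex.ofReal *ᵥ fun i' => v (i', j)) i := by
  rw [h.At_eq]
  simp only [Matrix.mulVec, dotProduct, Matrix.map_apply, blockDiagonal_apply,
    Fintype.sum_prod_type]
  refine Finset.sum_congr rfl fun i' _ => ?_
  rw [Finset.sum_eq_single j] <;> simp +contextual [eq_comm]

theorem map_Bt_mulVec (h : BlockModel α At Bt Ct Ah bh ch) (q : Fin m → ℂ) (i : Fin p)
    (j : Fin m) : (Bt.map Complex.ofReal *ᵥ q) (i, j) = bh i * q j := by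
  rw [h.Bt_eq]
  simp only [Matrix.mulVec, dotProduct, Matrix.map_apply, Matrix.of_apply]
  rw [Finset.sum_eq_single j] <;> simp +contextual [eq_comm]

theorem map_Ct_mulVec (h : BlockModel α At Bt Ct Ah bh ch) (v : Fin p × Fin m → ℂ) (j : Fin m) :
    (Ct.map Complex.ofReal *ᵥ v) j = (fun i => (ch i : ℂ)) ⬝ᵥ fun i => v (i, j) := by
  rw [h.Ct_eq]
  simp only [Matrix.mulVec, dotProduct, Matrix.map_apply, Matrix.of_apply, Fintype.sum_prod_type]
  refine Finset.sum_congr rfl fun i' _ => ?_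
  rw [Finset.sum_eq_single j] <;> simp +contextual [eq_comm]

end BlockModel

namespace LoopData

variable {n m p : ℕ} {S : LoopData n m p} {α : ℝ[X]} {Ah : Matrix (Fin p) (Fin p) ℝ}
  {bh ch : Fin p → ℝ} {l : ℂ} {v : Fin n ⊕ Fin p × Fin m → ℂ} {q : Fin m → ℂ}

theorem blocks_of_augA_mulVec_eq (h : BlockModel α S.At S.Bt S.Ct Ah bh ch)
    (hrank : (rosenbrock S.A S.B S.C l).rank = n + m)
    (hv : S.augA.map Complex.ofReal *ᵥ v = l • v + S.augB.map Complex.ofReal *ᵥ q)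
    (hC : S.augC.map Complex.ofReal *ᵥ v = 0) :
    v ∘ Sum.inl = 0 ∧ ∀ j, (fun i => (ch i : ℂ)) ⬝ᵥ (fun i => v (Sum.inr (i, j))) = q j ∧
      Ah.map Complex.ofReal *ᵥ (fun i => v (Sum.inr (i, j)))
        = l • (fun i => v (Sum.inr (i, j))) + q j • fun i => (bh i : ℂ) := by
  rw [map_augA_mulVec, map_augB_mulVec] at hv
  rw [map_augC_mulVec] at hC
  have hx : S.A.map Complex.ofReal *ᵥ (v ∘ Sum.inl)
      + S.B.map Complex.ofReal *ᵥ (S.Ct.map Complex.ofReal *ᵥ (v ∘ Sum.inr))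
      = l • (v ∘ Sum.inl) + S.B.map Complex.ofReal *ᵥ q :=
    funext fun i => congrFun hv (Sum.inl i)
  have hz : S.At.map Complex.ofReal *ᵥ (v ∘ Sum.inr)
      = l • (v ∘ Sum.inr) + S.Bt.map Complex.ofReal *ᵥ q :=
    funext fun i => congrFun hv (Sum.inr i)
  obtain ⟨hx0, hq⟩ := eq_zero_of_rank_rosenbrock hrank (v := v ∘ Sum.inl)
    (q := S.Ct.map Complex.ofReal *ᵥ (v ∘ Sum.inr) - q)
    (by rw [Matrix.mulVec_sub, ← add_sub_assoc, hx, add_sub_cancel_right]) hC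
  refine ⟨hx0, fun j => ⟨?_, funext fun i => ?_⟩⟩
  · exact (h.map_Ct_mulVec _ j).symm.trans (congrFun (sub_eq_zero.1 hq) j)
  · refine (h.map_At_mulVec _ i j).symm.trans ((congrFun hz (i, j)).trans ?_)
    rw [Pi.add_apply, h.map_Bt_mulVec, mul_comm]
    rfl

theorem eq_zero_of_blocks_eq_zero (hx : v ∘ Sum.inl = 0)
    (hz : ∀ j, (fun i => v (Sum.inr (i, j))) = 0) : v = 0 := by
  ext (i | ⟨i, j⟩)
  exacts [congrFun hx i, congrFun (hz j) i]

theorem eq_zero_of_isMinimumPhase (hmin : IsMinimumPhase S.A S.B S.C)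
    (h : BlockModel α S.At S.Bt S.Ct Ah bh ch) (hl : 0 ≤ l.re)
    (hv : S.augA.map Complex.ofReal *ᵥ v = l • v + S.augB.map Complex.ofReal *ᵥ q)
    (hC : S.augC.map Complex.ofReal *ᵥ v = 0) : v = 0 := by
  obtain ⟨hx, hz⟩ := blocks_of_augA_mulVec_eq h (hmin l hl) hv hC
  exact eq_zero_of_blocks_eq_zero hx fun j => h.zeros l _ hl ((hz j).1 ▸ (hz j).2)

theorem eq_zero_of_rootsAvoidZeros (hα : RootsAvoidZeros S.A S.B S.C α)
    (h : BlockModel α S.At S.Bt S.Ct Ah bh ch) (hl : aeval l α = 0)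
    (hv : S.augA.map Complex.ofReal *ᵥ v = l • v)
    (hC : S.augC.map Complex.ofReal *ᵥ v = 0) : v = 0 := by
  obtain ⟨hx, hz⟩ := blocks_of_augA_mulVec_eq (q := 0) h (hα l hl)
    (by rw [hv, Matrix.mulVec_zero, add_zero]) hC
  exact eq_zero_of_blocks_eq_zero hx fun j =>
    h.observable l _ (by simpa using (hz j).2) (hz j).1

theorem exists_isEnergyForm (hr : 1 ≤ S.r) (hsys : InSystemClass S.A S.B S.C S.r)
    (h : BlockModel α S.At S.Bt S.Ct Ah bh ch) (hk : ∀ i, i + 1 < S.r → 0 < S.k i) :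
    ∃ Q a c C γ, IsEnergyForm (matCLM S.augA) (matCLM S.augB) (matCLM (S.errMat (S.r - 1)))
      Q a c C γ := by
  obtain ⟨⟨hrel, hunit⟩, hmin, hpos⟩ := hsys
  set Γ := S.C * S.A ^ (S.r - 1) * S.B
  set L := S.errMat (S.r - 1)
  have hdet : IsUnit Γ.det := (Matrix.isUnit_iff_isUnit_det _).1 hunit
  have hLB : L * S.augB = Γ := errMat_mul_augB hr hrel
  have hLR : L * (S.augB * Γ⁻¹) = 1 := by
    rw [← Matrix.mul_assoc, hLB, Matrix.mul_nonsing_inv _ hdet]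
  have hRB : S.augB * Γ⁻¹ * (L * S.augB) = S.augB := by
    rw [hLB, Matrix.mul_assoc, Matrix.nonsing_inv_mul _ hdet, Matrix.mul_one]
  have hzd : IsHurwitzMatrix (zeroDynMat S.augA (S.augB * Γ⁻¹) L) :=
    isHurwitzMatrix_zeroDynMat
      (fun j hj => augC_mul_augA_pow_mul_augB_eq_zero hrel j (by omega))
      (fun i hi => hk i (by omega)) hLR
      (fun _ _ _ hl hv hC => eq_zero_of_isMinimumPhase hmin h hl hv hC)
  obtain ⟨P, c, hP⟩ := hzd.exists_isLyapunov
  have hΓ (u : EuclideanSpace ℝ (Fin m)) (hu : u ≠ 0) : 0 < inner ℝ u (matCLM Γ u) := by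
    rw [inner_matCLM]
    exact hpos _ ((WithLp.ofLp_eq_zero 2).not.2 hu)
  obtain ⟨γ, hγ, hcoer⟩ := exists_coercive_const hΓ
  refine ⟨_, _, _, _, γ, isEnergyForm_energyOp (R := matCLM (S.augB * Γ⁻¹)) hP
    (fun u => ?_) (fun v hv => ?_) (fun u => ?_) hγ fun u => ?_⟩
  · rw [← matCLM_mul, hLR, matCLM_one]
  · rw [kerProj_apply]
    exact WithLp.ofLp_injective 2 (zeroDynMat_mulVec_of_mem_ker (congrArg WithLp.ofLp hv))
  · rw [← matCLM_mul L, ← matCLM_mul, hRB]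
  · rw [← matCLM_mul, hLB]
    exact hcoer u

end LoopData

/-! ### Initial jets of the outputs of the interconnection -/

section Observability

theorem eq_zero_of_aeval_eq_zero_of_forall_pow {K W V : Type*} [Field K] [IsAlgClosed K]
    [AddCommGroup W] [Module K W] [FiniteDimensional K W] [AddCommGroup V] [Module K V]
    {T : Module.End K W} {O : W →ₗ[K] V} {α : K[X]}
    (hobs : ∀ l v, α.eval l = 0 → T v = l • v → O v = 0 → v = 0) {x : W}
    (hx : aeval T α x = 0) (hO : ∀ j : ℕ, O ((T ^ j) x) = 0) : x = 0 := by
  set N : Submodule K W :=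
    LinearMap.ker (aeval T α) ⊓ ⨅ j : ℕ, LinearMap.ker (O ∘ₗ (T ^ j : Module.End K W)) with hN
  have hmem (v : W) : v ∈ N ↔ aeval T α v = 0 ∧ ∀ j : ℕ, O ((T ^ j) v) = 0 := by
    simp [hN, Submodule.mem_inf, Submodule.mem_iInf, LinearMap.mem_ker]
  have hinv (v : W) (hv : v ∈ N) : T v ∈ N := by
    rw [hmem] at hv ⊢
    refine ⟨?_, fun j => ?_⟩
    · have hcomm : aeval T α * T = T * aeval T α := by
        simpa only [map_mul, aeval_X] using congrArg (aeval T) (mul_comm α X)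
      rw [← Module.End.mul_apply, hcomm, Module.End.mul_apply, hv.1, map_zero]
    · rw [← Module.End.mul_apply, ← pow_succ]
      exact hv.2 (j + 1)
  suffices hbot : N = ⊥ from (Submodule.mem_bot K).1 (hbot ▸ (hmem x).2 ⟨hx, hO⟩)
  by_contra hne
  have : Nontrivial N := Submodule.nontrivial_iff_ne_bot.2 hne
  obtain ⟨l, hl⟩ := Module.End.exists_eigenvalue (T.restrict hinv)
  obtain ⟨v, hv⟩ := hl.exists_hasEigenvector
  have hv0 : (v : W) ≠ 0 := fun h0 => hv.2 (Subtype.ext h0)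
  have hTv : T v = l • (v : W) := congrArg Subtype.val hv.apply_eq_smul
  obtain ⟨hαv, hOv⟩ := (hmem v).1 v.2
  rw [Module.End.aeval_apply_of_hasEigenvector
    (Module.End.hasEigenvector_iff.2 ⟨Module.End.mem_eigenspace_iff.2 hTv, hv0⟩)] at hαv
  exact hv0 (hobs l v ((smul_eq_zero.1 hαv).resolve_right hv0) hTv (hOv 0))

theorem map_ofReal_mulVec_ofReal {ι κ : Type*} [Fintype ι] (M : Matrix κ ι ℝ)
    (u : ι → ℝ) :
    M.map Complex.ofReal *ᵥ (fun i => (u i : ℂ)) = fun i => ((M *ᵥ u) i : ℂ) := by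
  ext i
  simp [Matrix.mulVec, dotProduct]

variable {ι κ : Type*} [Fintype ι] [DecidableEq ι] {A : Matrix ι ι ℝ} {C : Matrix κ ι ℝ}
  {α : ℝ[X]} {X : ι → ℝ}

theorem eq_zero_of_aeval_mulVec_eq_zero_of_forall_pow
    (hobs : ∀ (l : ℂ) (v : ι → ℂ), aeval l α = 0 → A.map Complex.ofReal *ᵥ v = l • v →
      C.map Complex.ofReal *ᵥ v = 0 → v = 0)
    (hX : aeval A α *ᵥ X = 0) (hC : ∀ j : ℕ, (C * A ^ j) *ᵥ X = 0) : X = 0 := by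
  set f := Complex.ofRealHom
  have hαc : aeval (toLin' (A.map f)) (α.map f) = toLin' ((aeval A α).map f) := by
    have hmap := map_aeval_eq_aeval_map (φ := f) (ψ := f.mapMatrix)
      (RingHom.ext fun x => by
        ext i j
        by_cases hij : i = j <;> simp [algebraMap_matrix_apply, hij]) α A
    exact (aeval_algHom_apply (toLinAlgEquiv' : Matrix ι ι ℂ ≃ₐ[ℂ] _) (A.map f) (α.map f)).trans
      (congrArg toLin' hmap.symm)
  have hXc : (fun i => (X i : ℂ)) = 0 := by
    refine eq_zero_of_aeval_eq_zero_of_forall_pow (T := toLin' (A.map f)) (O := toLin' (C.map f))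
      (α := α.map f) (fun l v hl hTv hOv => hobs l v ?_ hTv hOv) ?_ fun j => ?_
    · rwa [eval_map] at hl
    · rw [hαc, toLin'_apply]
      exact (map_ofReal_mulVec_ofReal _ X).trans (by rw [hX]; rfl)
    · have hpow : (C * A ^ j).map f = C.map f * A.map f ^ j := by
        rw [Matrix.map_mul]
        exact congrArg _ (map_pow f.mapMatrix A j)
      rw [← toLin'_pow, ← toLin'_mul_apply, ← hpow, toLin'_apply]
      exact (map_ofReal_mulVec_ofReal _ X).trans (by rw [hC]; rfl)
  exact funext fun i => Complex.ofReal_eq_zero.1 (congrFun hXc i)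

theorem mul_pow_mulVec_eq_zero_of_aeval_mulVec_eq_zero (hα : α.Monic)
    (hX : aeval A α *ᵥ X = 0) (hC : ∀ j < α.natDegree, (C * A ^ j) *ᵥ X = 0) (j : ℕ) :
    (C * A ^ j) *ᵥ X = 0 := by
  have hmod : A ^ j *ᵥ X = aeval A (Polynomial.X ^ j %ₘ α) *ᵥ X := by
    conv_lhs => rw [← aeval_X_pow (R := ℝ) A, ← modByMonic_add_div (Polynomial.X ^ j) α, mul_comm α]
    rw [map_add, map_mul, Matrix.add_mulVec, ← Matrix.mulVec_mulVec, hX, Matrix.mulVec_zero,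
      add_zero]
  rw [← Matrix.mulVec_mulVec, hmod, aeval_eq_sum_range, Matrix.sum_mulVec, Matrix.mulVec_sum]
  refine Finset.sum_eq_zero fun i _ => ?_
  rw [Matrix.smul_mulVec, Matrix.mulVec_smul, Matrix.mulVec_mulVec]
  rcases lt_or_ge i α.natDegree with hi | hi
  · rw [hC i hi, smul_zero]
  · have hdeg : (Polynomial.X ^ j %ₘ α).degree < i :=
      (degree_modByMonic_lt _ hα).trans_le (degree_le_natDegree.trans (by exact_mod_cast hi))
    rw [coeff_eq_zero_of_degree_lt hdeg, zero_smul]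

end Observability

section BlockTriangular

variable {R ι κ : Type*} [CommRing R] [Fintype ι] [DecidableEq ι] [Fintype κ] [DecidableEq κ]

theorem exists_aeval_fromBlocks_zero₂₁_eq (A : Matrix ι ι R) (B : Matrix ι κ R)
    (D : Matrix κ κ R) (q : R[X]) :
    ∃ M, aeval (fromBlocks A B 0 D) q = fromBlocks (aeval A q) M 0 (aeval D q) := by
  induction q using Polynomial.induction_on with
  | C a =>
    refine ⟨0, ?_⟩
    simp only [aeval_C, Algebra.algebraMap_eq_smul_one, ← fromBlocks_one, fromBlocks_smul,
      smul_zero]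
  | add f g hf hg =>
    obtain ⟨M, hM⟩ := hf
    obtain ⟨N, hN⟩ := hg
    exact ⟨M + N, by rw [map_add, hM, hN, fromBlocks_add, add_zero, map_add, map_add]⟩
  | monomial k a ih =>
    obtain ⟨M, hM⟩ := ih
    refine ⟨aeval A (Polynomial.C a * Polynomial.X ^ k) * B + M * D, ?_⟩
    rw [pow_succ, ← mul_assoc, map_mul _ (_ * _) _, hM, aeval_X, fromBlocks_multiply,
      map_mul _ (_ * _) Polynomial.X, map_mul _ (_ * _) Polynomial.X, aeval_X, aeval_X]
    simp

theorem aeval_blockDiagonal_const (A : Matrix ι ι R) (q : R[X]) :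
    aeval (blockDiagonal fun _ : κ => A) q = blockDiagonal fun _ => aeval A q := by
  have hmap := map_aeval_eq_aeval_map (φ := RingHom.id R)
    (ψ := (blockDiagonalRingHom ι κ R).comp (Pi.constRingHom κ _))
    (RingHom.ext fun x => by
      change algebraMap R _ x = blockDiagonal fun _ => algebraMap R _ x
      simp only [Algebra.algebraMap_eq_smul_one]
      rw [← blockDiagonal_one, ← blockDiagonal_smul]
      rfl) q A
  rw [Polynomial.map_id] at hmap
  exact hmap.symm

end BlockTriangular

namespace LoopData

variable {n m p : ℕ} {S : LoopData n m p} {α : ℝ[X]} {Ah : Matrix (Fin p) (Fin p) ℝ}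
  {bh ch : Fin p → ℝ}

theorem aeval_augA_mulVec_comp_inr (h : BlockModel α S.At S.Bt S.Ct Ah bh ch)
    (X : Fin n ⊕ Fin p × Fin m → ℝ) : (aeval S.augA α *ᵥ X) ∘ Sum.inr = 0 := by
  have hAt : aeval S.At α = 0 := by
    rw [h.At_eq, aeval_blockDiagonal_const, ← h.charpoly_eq, aeval_self_charpoly]
    exact blockDiagonal_zero
  obtain ⟨M, hM⟩ := exists_aeval_fromBlocks_zero₂₁_eq S.A (S.B * S.Ct) S.At α
  rw [augA, hM, hAt, fromBlocks_mulVec, Sum.elim_comp_inr, Matrix.zero_mulVec,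
    Matrix.zero_mulVec, add_zero]

theorem finrank_range_aeval_augA_le (h : BlockModel α S.At S.Bt S.Ct Ah bh ch) :
    Module.finrank ℝ (LinearMap.range (toLin' (aeval S.augA α))) ≤ n := by
  set g : LinearMap.range (toLin' (aeval S.augA α)) →ₗ[ℝ] (Fin n → ℝ) :=
    LinearMap.funLeft ℝ ℝ Sum.inl ∘ₗ (LinearMap.range _).subtype
  have hg : Function.Injective g := by
    rw [← LinearMap.ker_eq_bot, LinearMap.ker_eq_bot']
    rintro ⟨Y, X, rfl⟩ hY
    refine Subtype.ext (funext (Sum.rec (congrFun hY) (congrFun ?_)))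
    exact aeval_augA_mulVec_comp_inr h X
  simpa using LinearMap.finrank_le_finrank_of_injective hg

theorem eq_zero_of_forall_augC_mul_augA_pow_mulVec (hα : RootsAvoidZeros S.A S.B S.C α)
    (h : BlockModel α S.At S.Bt S.Ct Ah bh ch) {X : Fin n ⊕ Fin p × Fin m → ℝ}
    (hX : aeval S.augA α *ᵥ X = 0) (hC : ∀ j : ℕ, (S.augC * S.augA ^ j) *ᵥ X = 0) : X = 0 :=
  eq_zero_of_aeval_mulVec_eq_zero_of_forall_pow
    (fun _ _ hl hv hCv => eq_zero_of_rootsAvoidZeros hα h hl hv hCv) hX hC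

theorem exists_initial_jet (hmonic : α.Monic) (hα : RootsAvoidZeros S.A S.B S.C α)
    (h : BlockModel α S.At S.Bt S.Ct Ah bh ch) (y : Fin p → Fin m → ℝ) :
    ∃ X : Fin n ⊕ Fin p × Fin m → ℝ, aeval S.augA α *ᵥ X = 0 ∧
      ∀ j : Fin p, (S.augC * S.augA ^ (j : ℕ)) *ᵥ X = y j := by
  set f := toLin' (aeval S.augA α)
  set O : LinearMap.ker f →ₗ[ℝ] (Fin p → Fin m → ℝ) :=
    (LinearMap.pi fun j : Fin p => toLin' (S.augC * S.augA ^ (j : ℕ))) ∘ₗ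
      (LinearMap.ker f).subtype
  have hinj : Function.Injective O := by
    rw [← LinearMap.ker_eq_bot, LinearMap.ker_eq_bot']
    refine fun X hX => Subtype.ext (eq_zero_of_forall_augC_mul_augA_pow_mulVec hα h X.2 ?_)
    exact mul_pow_mulVec_eq_zero_of_aeval_mulVec_eq_zero hmonic X.2 fun j hj =>
      congrFun hX ⟨j, h.natDegree_eq ▸ hj⟩
  have hdim : Module.finrank ℝ (LinearMap.ker f) = Module.finrank ℝ (Fin p → Fin m → ℝ) := by
    refine le_antisymm (LinearMap.finrank_le_finrank_of_injective hinj) ?_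
    have hsum := f.finrank_range_add_finrank_ker
    have hrange : Module.finrank ℝ (LinearMap.range f) ≤ n := finrank_range_aeval_augA_le h
    rw [Module.finrank_fintype_fun_eq_card, Fintype.card_sum, Fintype.card_prod, Fintype.card_fin,
      Fintype.card_fin, Fintype.card_fin] at hsum
    rw [Module.finrank_pi_fintype, Finset.sum_const, Module.finrank_fintype_fun_eq_card,
      Fintype.card_fin, Finset.card_univ, Fintype.card_fin, smul_eq_mul]
    omega
  obtain ⟨X, hX⟩ := (LinearMap.injective_iff_surjective_of_finrank_eq_finrank hdim).1 hinj y
  exact ⟨X.1, X.2, congrFun hX⟩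

end LoopData

/-! ### The reference signal as an output of the interconnection -/

section LinearODE

variable {U : Type*} [NormedAddCommGroup U] [NormedSpace ℝ U]

theorem norm_le_of_sum_coeff_smul_eq_zero {α : ℝ[X]} (hα : α.Monic) {u : ℕ → U}
    (hu : ∑ j ∈ Finset.range (α.natDegree + 1), α.coeff j • u j = 0) {j : ℕ}
    (hj : j ≤ α.natDegree) :
    ‖u j‖ ≤ (1 + ∑ i ∈ Finset.range α.natDegree, |α.coeff i|) *
      ‖fun i : Fin α.natDegree => u i‖ := by
  set N := ‖fun i : Fin α.natDegree => u i‖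
  have hle (i : ℕ) (hi : i < α.natDegree) : ‖u i‖ ≤ N :=
    norm_le_pi_norm (fun i : Fin α.natDegree => u i) ⟨i, hi⟩
  have hN : 0 ≤ N := norm_nonneg _
  have hcoeff : 0 ≤ ∑ i ∈ Finset.range α.natDegree, |α.coeff i| :=
    Finset.sum_nonneg fun _ _ => abs_nonneg _
  rcases hj.lt_or_eq with hj | rfl
  · exact (hle j hj).trans (le_mul_of_one_le_left hN (by linarith))
  · rw [Finset.sum_range_succ, hα.coeff_natDegree, one_smul] at hu
    calc ‖u α.natDegree‖ = ‖∑ i ∈ Finset.range α.natDegree, α.coeff i • u i‖ := by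
          rw [eq_neg_of_add_eq_zero_right hu, norm_neg]
      _ ≤ ∑ i ∈ Finset.range α.natDegree, |α.coeff i| * N := by
          refine norm_sum_le_of_le _ fun i hi => ?_
          rw [norm_smul, Real.norm_eq_abs]
          exact mul_le_mul_of_nonneg_left (hle i (Finset.mem_range.1 hi)) (abs_nonneg _)
      _ ≤ _ := by
          rw [← Finset.sum_mul]
          exact mul_le_mul_of_nonneg_right (by linarith) hN

theorem eq_zero_of_jet_eq_zero {α : ℝ[X]} (hα : α.Monic) {J : ℕ → ℝ → U}
    (hJ : ∀ j t, 0 ≤ t → HasDerivWithinAt (J j) (J (j + 1) t) (Ici 0) t)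
    (hode : ∀ t, 0 ≤ t → ∑ j ∈ Finset.range (α.natDegree + 1), α.coeff j • J j t = 0)
    (h0 : ∀ j, j < α.natDegree → J j 0 = 0) {t : ℝ} (ht : 0 ≤ t) : J 0 t = 0 := by
  set K : ℝ := 1 + ∑ i ∈ Finset.range α.natDegree, |α.coeff i|
  have hK : 0 ≤ K := add_nonneg zero_le_one (Finset.sum_nonneg fun _ _ => abs_nonneg _)
  set Y : ℝ → Fin α.natDegree → U := fun t j => J j t
  have hY (s : ℝ) (hs : 0 ≤ s) : HasDerivWithinAt Y (fun j => J (j + 1) s) (Ici 0) s :=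
    hasDerivWithinAt_pi.2 fun j => hJ j s hs
  have hbound (s : ℝ) (hs : 0 ≤ s) : ‖fun j : Fin α.natDegree => J (j + 1) s‖ ≤ K * ‖Y s‖ :=
    (pi_norm_le_iff_of_nonneg (mul_nonneg hK (norm_nonneg _))).2 fun j =>
      norm_le_of_sum_coeff_smul_eq_zero hα (u := fun i => J i s) (hode s hs) j.2
  have hYt : Y t = 0 :=
    eq_zero_of_abs_deriv_le_mul_abs_self_of_eq_zero_right
      (fun s hs => (hY s hs.1).continuousWithinAt.mono Icc_subset_Ici_self)
      (fun s hs => (hY s hs.1).mono (Ici_subset_Ici.2 hs.1)) (funext fun j => h0 j j.2)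
      (fun s hs => hbound s hs.1) t ⟨ht, le_rfl⟩
  simpa [Y, hYt] using
    norm_le_of_sum_coeff_smul_eq_zero hα (u := fun i => J i t) (hode t ht) (Nat.zero_le _)

theorem hasDerivWithinAt_iteratedDerivWithin {w : ℝ → U}
    (hw : ContDiffOn ℝ ((⊤ : ℕ∞) : WithTop ℕ∞) w (Ici 0)) (j : ℕ) {t : ℝ} (ht : 0 ≤ t) :
    HasDerivWithinAt (iteratedDerivWithin j w (Ici 0)) (iteratedDerivWithin (j + 1) w (Ici 0) t)
      (Ici 0) t := by
  rw [iteratedDerivWithin_succ]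
  exact ((hw.differentiableOn_iteratedDerivWithin (m := j)
    (by exact_mod_cast ENat.natCast_lt_top j) (uniqueDiffOn_Ici 0)) t ht).hasDerivWithinAt

theorem iteratedDerivWithin_eq_of_jet {f : ℝ → U} {J : ℕ → ℝ → U} {N : ℕ}
    (h0 : ∀ t, 0 ≤ t → f t = J 0 t)
    (hJ : ∀ j, j < N → ∀ t, 0 ≤ t → HasDerivWithinAt (J j) (J (j + 1) t) (Ici 0) t) :
    ∀ j, j ≤ N → ∀ t, 0 ≤ t → iteratedDerivWithin j f (Ici 0) t = J j t := by
  intro j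
  induction j with
  | zero =>
    intro _ t ht
    rw [iteratedDerivWithin_zero]
    exact h0 t ht
  | succ j ih =>
    intro hj t ht
    rw [iteratedDerivWithin_succ, derivWithin_congr (s := Ici 0) (f := J j)
      (fun s hs => ih (by lia) s hs) (ih (by lia) t ht)]
    exact (hJ j (by lia) t ht).derivWithin (uniqueDiffOn_Ici 0 t ht)

end LinearODE

section Flow

variable {V U : Type*} [NormedAddCommGroup V] [NormedSpace ℝ V]
  [NormedAddCommGroup U] [NormedSpace ℝ U]

theorem exp_zero_smul_apply (A : V →L[ℝ] V) (v : V) : NormedSpace.exp ((0 : ℝ) • A) v = v := by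
  rw [zero_smul, NormedSpace.exp_zero, one_apply_eq_self]

theorem apply_exp_smul_of_commute {A M : V →L[ℝ] V} (h : Commute M A) {v : V} (hv : M v = 0)
    (t : ℝ) : M (NormedSpace.exp (t • A) v) = 0 := by
  have hcomm : Commute M (NormedSpace.exp (t • A)) := (h.smul_right t).exp_right
  rw [← mul_apply_eq_comp, hcomm.eq, mul_apply_eq_comp, hv, map_zero]

variable [CompleteSpace V]

theorem hasDerivAt_exp_smul_apply (A : V →L[ℝ] V) (v : V) (t : ℝ) :
    HasDerivAt (fun s : ℝ => NormedSpace.exp (s • A) v) (A (NormedSpace.exp (t • A) v)) t := by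
  simpa using (hasDerivAt_exp_smul_const' A t).clm_apply (hasDerivAt_const t v)

theorem exp_smul_apply_apply (A : V →L[ℝ] V) (v : V) (s t : ℝ) :
    NormedSpace.exp (s • A) (NormedSpace.exp (t • A) v) = NormedSpace.exp ((s + t) • A) v := by
  let +nondep : NormedAlgebra ℚ (V →L[ℝ] V) := .restrictScalars ℚ ℝ (V →L[ℝ] V)
  rw [add_smul, NormedSpace.exp_add_of_commute (((Commute.refl A).smul_left s).smul_right t),
    mul_apply_eq_comp]

/-- The output on `[0, 1]` of the system `v' = A v`, `y = C v`, as a function of the initial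
value. -/
noncomputable def unitTimeOutput (A : V →L[ℝ] V) (C : V →L[ℝ] U) : V →ₗ[ℝ] C(Icc (0 : ℝ) 1, U) where
  toFun v := ⟨fun s => C (NormedSpace.exp ((s : ℝ) • A) v),
    C.continuous.comp <| (continuous_iff_continuousAt.2 fun t =>
      (hasDerivAt_exp_smul_apply A v t).continuousAt).comp continuous_subtype_val⟩
  map_add' v w := by ext s; simp
  map_smul' c v := by ext s; simp

theorem unitTimeOutput_apply (A : V →L[ℝ] V) (C : V →L[ℝ] U) (v : V) (s : Icc (0 : ℝ) 1) :
    unitTimeOutput A C v s = C (NormedSpace.exp ((s : ℝ) • A) v) := rfl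

theorem apply_pow_eq_zero_of_unitTimeOutput_eq_zero {A : V →L[ℝ] V} {C : V →L[ℝ] U} {v : V}
    (hv : unitTimeOutput A C v = 0) (j : ℕ) : C ((A ^ j) v) = 0 := by
  have hzero (s : ℝ) (hs : s ∈ Icc (0 : ℝ) 1) : C ((A ^ j) (NormedSpace.exp (s • A) v)) = 0 := by
    induction j generalizing s with
    | zero => exact DFunLike.congr_fun hv ⟨s, hs⟩
    | succ j ih =>
      have hderiv : HasDerivWithinAt (fun τ : ℝ => C ((A ^ j) (NormedSpace.exp (τ • A) v)))
          (C ((A ^ j) (A (NormedSpace.exp (s • A) v)))) (Icc 0 1) s :=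
        ((C ∘L (A ^ j)).hasFDerivAt.comp_hasDerivAt s
          (hasDerivAt_exp_smul_apply A v s)).hasDerivWithinAt
      have hderiv_zero : HasDerivWithinAt (fun τ : ℝ => C ((A ^ j) (NormedSpace.exp (τ • A) v)))
          0 (Icc 0 1) s :=
        (hasDerivWithinAt_const s (Icc 0 1) (0 : U)).congr ih (ih s hs)
      rw [pow_succ]
      exact (uniqueDiffOn_Icc zero_lt_one s hs).eq_deriv _ hderiv hderiv_zero
  simpa using hzero 0 ⟨le_rfl, zero_le_one⟩

/- On the subspace `ker M`, which is invariant under the flow, the output on an interval of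
length one determines the state, hence bounds it. -/
theorem boundedSignal_exp_smul_of_output [FiniteDimensional ℝ V] {A M : V →L[ℝ] V}
    (hcomm : Commute M A) {C : V →L[ℝ] U}
    (hobs : ∀ v, M v = 0 → (∀ j : ℕ, C ((A ^ j) v) = 0) → v = 0) {v : V} (hv : M v = 0)
    (hb : BoundedSignal fun t : ℝ => C (NormedSpace.exp (t • A) v)) :
    BoundedSignal fun t : ℝ => NormedSpace.exp (t • A) v := by
  set T := (unitTimeOutput A C).domRestrict (LinearMap.ker (M : V →ₗ[ℝ] V))
  have hT : LinearMap.ker T = ⊥ := LinearMap.ker_eq_bot'.2 fun w hw =>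
    Subtype.ext (hobs w w.2 (apply_pow_eq_zero_of_unitTimeOutput_eq_zero hw))
  obtain ⟨K, -, hK⟩ := T.exists_antilipschitzWith hT
  obtain ⟨N, hN⟩ := hb
  have hN0 : 0 ≤ N := (norm_nonneg _).trans (hN 0 le_rfl)
  refine ⟨K * N, fun t ht => ?_⟩
  set w : LinearMap.ker (M : V →ₗ[ℝ] V) :=
    ⟨NormedSpace.exp (t • A) v, apply_exp_smul_of_commute hcomm hv t⟩
  have hTw : ‖T w‖ ≤ N := (ContinuousMap.norm_le _ hN0).2 fun s => by
    rw [LinearMap.domRestrict_apply, unitTimeOutput_apply, exp_smul_apply_apply]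
    exact hN _ (add_nonneg s.2.1 ht)
  calc ‖NormedSpace.exp (t • A) v‖ ≤ K * ‖T w‖ := ZeroHomClass.bound_of_antilipschitz T hK w
    _ ≤ K * N := by gcongr

end Flow

section ReferenceClass

variable {ι κ : Type*} [Fintype ι] [DecidableEq ι] {m : ℕ} {α : ℝ[X]}

theorem sum_coeff_smul_matCLM_mul_pow [Fintype κ] (C : Matrix κ ι ℝ) (A : Matrix ι ι ℝ)
    (α : ℝ[X]) (v : EuclideanSpace ℝ ι) :
    ∑ j ∈ Finset.range (α.natDegree + 1), α.coeff j • matCLM (C * A ^ j) v =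
      matCLM C (matCLM (aeval A α) v) := by
  apply WithLp.ofLp_injective 2
  simp only [WithLp.ofLp_sum, WithLp.ofLp_smul, ofLp_matCLM, aeval_eq_sum_range,
    Matrix.sum_mulVec, Matrix.mulVec_sum, Matrix.smul_mulVec, Matrix.mulVec_smul,
    Matrix.mulVec_mulVec]

theorem hasDerivAt_matCLM_mul_pow [Fintype κ] (C : Matrix κ ι ℝ) {A : Matrix ι ι ℝ} (j : ℕ)
    {X : ℝ → EuclideanSpace ℝ ι} {t : ℝ} (hX : HasDerivAt X (matCLM A (X t)) t) :
    HasDerivAt (fun s => matCLM (C * A ^ j) (X s)) (matCLM (C * A ^ (j + 1)) (X t)) t := by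
  rw [pow_succ, ← Matrix.mul_assoc, matCLM_mul]
  exact (matCLM (C * A ^ j)).hasFDerivAt.comp_hasDerivAt t hX

theorem eq_output_of_mem_refClass (hα : α.Monic) {w : ℝ → EuclideanSpace ℝ (Fin m)}
    (hw : w ∈ RefClass m α) {A : Matrix ι ι ℝ} {C : Matrix (Fin m) ι ℝ} {v : EuclideanSpace ℝ ι}
    (hv : matCLM (aeval A α) v = 0)
    (hjet : ∀ j, j < α.natDegree → iteratedDerivWithin j w (Ici 0) 0 = matCLM (C * A ^ j) v)
    {t : ℝ} (ht : 0 ≤ t) : w t = matCLM C (NormedSpace.exp (t • matCLM A) v) := by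
  set X : ℝ → EuclideanSpace ℝ ι := fun t => NormedSpace.exp (t • matCLM A) v
  have hX (t : ℝ) : matCLM (aeval A α) (X t) = 0 :=
    apply_exp_smul_of_commute (commute_matCLM_aeval _ _) hv t
  have hdiff := eq_zero_of_jet_eq_zero hα
    (J := fun j t => iteratedDerivWithin j w (Ici 0) t - matCLM (C * A ^ j) (X t))
    (fun j t ht => (hasDerivWithinAt_iteratedDerivWithin hw.1 j ht).sub
      (hasDerivAt_matCLM_mul_pow C j (hasDerivAt_exp_smul_apply _ v t)).hasDerivWithinAt)
    (fun t ht => by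
      simp only [smul_sub, Finset.sum_sub_distrib]
      rw [sum_coeff_smul_matCLM_mul_pow, hX, map_zero, hw.2 t ht, sub_zero])
    (fun j hj => by simp only [X, exp_zero_smul_apply, hjet j hj, sub_self]) ht
  simpa only [iteratedDerivWithin_zero, pow_zero, Matrix.mul_one, sub_eq_zero] using hdiff

end ReferenceClass

namespace LoopData

variable {n m p : ℕ} {S : LoopData n m p} {α : ℝ[X]} {Ah : Matrix (Fin p) (Fin p) ℝ}
  {bh ch : Fin p → ℝ}

/-- `Xr` is a trajectory of the undriven interconnection of system and internal model whose output
is the reference signal. -/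
structure IsReferenceTrajectory (S : LoopData n m p)
    (Xr : ℝ → EuclideanSpace ℝ (Fin n ⊕ Fin p × Fin m)) : Prop where
  hasDerivAt : ∀ t, HasDerivAt Xr (matCLM S.augA (Xr t)) t
  yref_eq : ∀ t, 0 ≤ t → S.yref t = matCLM S.augC (Xr t)

theorem exists_isReferenceTrajectory (hmonic : α.Monic) (hα : RootsAvoidZeros S.A S.B S.C α)
    (h : BlockModel α S.At S.Bt S.Ct Ah bh ch) (href : S.yref ∈ RefClass m α) :
    ∃ Xr, S.IsReferenceTrajectory Xr ∧ (BoundedSignal S.yref → BoundedSignal Xr) := by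
  obtain ⟨X, hX, hjet⟩ := exists_initial_jet hmonic hα h
    fun j => (iteratedDerivWithin j S.yref (Ici 0) 0).ofLp
  set v : EuclideanSpace ℝ (Fin n ⊕ Fin p × Fin m) := WithLp.toLp 2 X
  have hv : matCLM (aeval S.augA α) v = 0 := WithLp.ofLp_injective 2 hX
  have hyref (t : ℝ) (ht : 0 ≤ t) :
      S.yref t = matCLM S.augC (NormedSpace.exp (t • matCLM S.augA) v) :=
    eq_output_of_mem_refClass hmonic href hv
      (fun j hj => WithLp.ofLp_injective 2 (hjet ⟨j, h.natDegree_eq ▸ hj⟩).symm) ht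
  refine ⟨_, ⟨hasDerivAt_exp_smul_apply _ v, hyref⟩, fun ⟨N, hN⟩ => ?_⟩
  refine boundedSignal_exp_smul_of_output (commute_matCLM_aeval S.augA α) (C := matCLM S.augC)
    (fun w hw hobs => ?_) hv ⟨N, fun t ht => by simpa only [← hyref t ht] using hN t ht⟩
  refine WithLp.ofLp_injective 2 (eq_zero_of_forall_augC_mul_augA_pow_mulVec hα h
    (congrArg WithLp.ofLp hw) fun j => ?_)
  rw [← ofLp_matCLM, matCLM_mul, matCLM_pow, hobs j, WithLp.ofLp_zero]

end LoopData

namespace LoopData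

variable {n m p : ℕ} {S : LoopData n m p}

section JointState

/-- The state `(x, z)` of the interconnection. -/
noncomputable def join (x : EuclideanSpace ℝ (Fin n)) (z : EuclideanSpace ℝ (Fin p × Fin m)) :
    EuclideanSpace ℝ (Fin n ⊕ Fin p × Fin m) :=
  matCLM (fromRows 1 0) x + matCLM (fromRows 0 1) z

/-- The projection `(x, z) ↦ x`. -/
noncomputable def stateX :
    EuclideanSpace ℝ (Fin n ⊕ Fin p × Fin m) →L[ℝ] EuclideanSpace ℝ (Fin n) :=
  matCLM (fromCols 1 0)

/-- The projection `(x, z) ↦ z`. -/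
noncomputable def stateZ :
    EuclideanSpace ℝ (Fin n ⊕ Fin p × Fin m) →L[ℝ] EuclideanSpace ℝ (Fin p × Fin m) :=
  matCLM (fromCols 0 1)

variable (x : EuclideanSpace ℝ (Fin n)) (z : EuclideanSpace ℝ (Fin p × Fin m))
  (v : EuclideanSpace ℝ (Fin n ⊕ Fin p × Fin m))

theorem ofLp_join : (join x z).ofLp = Sum.elim x.ofLp z.ofLp := by
  rw [join, WithLp.ofLp_add, ofLp_matCLM, ofLp_matCLM, fromRows_mulVec, fromRows_mulVec]
  ext i
  cases i <;> simp

theorem ofLp_stateX : (stateX v).ofLp = v.ofLp ∘ Sum.inl := by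
  rw [stateX, ofLp_matCLM, fromCols_mulVec, Matrix.one_mulVec, Matrix.zero_mulVec, add_zero]

theorem ofLp_stateZ : (stateZ v).ofLp = v.ofLp ∘ Sum.inr := by
  rw [stateZ, ofLp_matCLM, fromCols_mulVec, Matrix.one_mulVec, Matrix.zero_mulVec, zero_add]

@[simp]
theorem stateX_join : stateX (join x z) = x :=
  WithLp.ofLp_injective 2 (by rw [ofLp_stateX, ofLp_join, Sum.elim_comp_inl])

@[simp]
theorem stateZ_join : stateZ (join x z) = z :=
  WithLp.ofLp_injective 2 (by rw [ofLp_stateZ, ofLp_join, Sum.elim_comp_inr])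

@[simp]
theorem join_stateX_stateZ : join (stateX v) (stateZ v) = v :=
  WithLp.ofLp_injective 2 (by rw [ofLp_join, ofLp_stateX, ofLp_stateZ, Sum.elim_comp_inl_inr])

theorem augA_join_add_augB (w : EuclideanSpace ℝ (Fin m)) :
    matCLM S.augA (join x z) + matCLM S.augB w
      = join (toEuclideanLin S.A x + toEuclideanLin S.B (toEuclideanLin S.Ct z + w))
          (toEuclideanLin S.At z + toEuclideanLin S.Bt w) := by
  apply WithLp.ofLp_injective 2
  rw [ofLp_join, WithLp.ofLp_add, ofLp_matCLM, ofLp_matCLM, ofLp_join, augA, augB,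
    fromBlocks_mulVec, fromRows_mulVec]
  simp only [← matCLM_apply, WithLp.ofLp_add, ofLp_matCLM, Matrix.mulVec_add,
    Matrix.mulVec_mulVec]
  ext i
  cases i <;> simp [add_assoc]

theorem augC_mul_augA_pow_join (hrel : ∀ j, j + 2 ≤ S.r → S.C * S.A ^ j * S.B = 0) {j : ℕ}
    (hj : j + 1 ≤ S.r) :
    matCLM (S.augC * S.augA ^ j) (join x z) = toEuclideanLin (S.C * S.A ^ j) x := by
  apply WithLp.ofLp_injective 2
  rw [← matCLM_apply, ofLp_matCLM, ofLp_matCLM, augC_mul_augA_pow hrel j hj, ofLp_join,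
    fromCols_mulVec, Sum.elim_comp_inl, Matrix.zero_mulVec, add_zero]

end JointState

/-! ### The errors as outputs of the deviation from a reference trajectory -/

/-- The deviation of the state `(x, z)` from the reference trajectory `Xr`. -/
noncomputable def deviation (x : ℝ → EuclideanSpace ℝ (Fin n))
    (z : ℝ → EuclideanSpace ℝ (Fin p × Fin m))
    (Xr : ℝ → EuclideanSpace ℝ (Fin n ⊕ Fin p × Fin m)) (t : ℝ) :
    EuclideanSpace ℝ (Fin n ⊕ Fin p × Fin m) :=
  join (x t) (z t) - Xr t

/-- The last auxiliary error `e_r` as a function of the deviation. -/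
noncomputable abbrev lastCLM (S : LoopData n m p) :
    EuclideanSpace ℝ (Fin n ⊕ Fin p × Fin m) →L[ℝ] EuclideanSpace ℝ (Fin m) :=
  matCLM (S.errMat (S.r - 1))

/-- The denominator `1 - φ_r(t)² ‖e_r‖²` of the gain as a function of time and the deviation. -/
noncomputable def denom (S : LoopData n m p) (t : ℝ)
    (v : EuclideanSpace ℝ (Fin n ⊕ Fin p × Fin m)) : ℝ :=
  1 - S.φ (S.r - 1) t ^ 2 * ‖S.lastCLM v‖ ^ 2

variable {x : ℝ → EuclideanSpace ℝ (Fin n)} {z : ℝ → EuclideanSpace ℝ (Fin p × Fin m)}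
  {Xr : ℝ → EuclideanSpace ℝ (Fin n ⊕ Fin p × Fin m)} {ω : EReal} {kr δ t : ℝ}
  {v : EuclideanSpace ℝ (Fin n ⊕ Fin p × Fin m)}

theorem errMat_succ_apply (i : ℕ) (v : EuclideanSpace ℝ (Fin n ⊕ Fin p × Fin m)) :
    matCLM (S.errMat (i + 1)) v
      = matCLM (S.errMat i) (matCLM S.augA v) + S.k i • matCLM (S.errMat i) v := by
  have hsucc : S.errMat (i + 1) = S.errMat i * S.augA + S.k i • S.errMat i := by
    simpa only [errMat, pow_zero, zero_add, pow_one, Matrix.mul_one]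
      using outMat_succ_mul_pow S.augA S.augC S.k i 0
  rw [hsucc, matCLM_add, matCLM_smul, matCLM_mul]

theorem errMat_apply_augB (hrel : ∀ j, j + 2 ≤ S.r → S.C * S.A ^ j * S.B = 0) {i : ℕ}
    (hi : i + 2 ≤ S.r) (w : EuclideanSpace ℝ (Fin m)) :
    matCLM (S.errMat i) (matCLM S.augB w) = 0 := by
  rw [← matCLM_mul, errMat,
    outMat_mul_eq_zero (augC_mul_augA_pow_mul_augB_eq_zero hrel) S.k hi, matCLM_zero]

theorem IsReferenceTrajectory.trackErr_eq (hXr : S.IsReferenceTrajectory Xr) (hr : 1 ≤ S.r)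
    (hrel : ∀ j, j + 2 ≤ S.r → S.C * S.A ^ j * S.B = 0)
    (z : ℝ → EuclideanSpace ℝ (Fin p × Fin m)) (ht : 0 ≤ t) :
    S.trackErr x t = matCLM S.augC (deviation x z Xr t) := by
  have hC : matCLM S.augC (join (x t) (z t)) = toEuclideanLin S.C (x t) := by
    simpa only [pow_zero, Matrix.mul_one]
      using augC_mul_augA_pow_join (S := S) (x t) (z t) hrel (j := 0) hr
  rw [trackErr, deviation, map_sub, hC, hXr.yref_eq t ht]

theorem IsReferenceTrajectory.auxErr_eq (hXr : S.IsReferenceTrajectory Xr) (hr : 1 ≤ S.r)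
    (hrel : ∀ j, j + 2 ≤ S.r → S.C * S.A ^ j * S.B = 0) (hω : 0 < ω)
    (hdiff : ∀ i, i + 2 ≤ S.r → ∀ t ∈ timeDomain ω,
      HasDerivWithinAt (fun s => matCLM (S.errMat i) (deviation x z Xr s))
        (matCLM (S.errMat i) (matCLM S.augA (deviation x z Xr t))) (timeDomain ω) t)
    {i : ℕ} (hi : i < S.r) (ht : t ∈ timeDomain ω) :
    S.auxErr ω x i t = matCLM (S.errMat i) (deviation x z Xr t) := by
  induction i generalizing t with
  | zero => exact hXr.trackErr_eq hr hrel z ht.1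
  | succ i ih =>
    have heq (s : ℝ) (hs : s ∈ timeDomain ω) := ih (by omega) hs
    simp only [auxErr]
    rw [derivWithin_congr heq (heq t ht), heq t ht, errMat_succ_apply,
      (hdiff i (by omega) t ht).derivWithin (uniqueDiffOn_timeDomain hω t ht)]

theorem IsReferenceTrajectory.initErr_eq (hXr : S.IsReferenceTrajectory Xr)
    (hrel : ∀ j, j + 2 ≤ S.r → S.C * S.A ^ j * S.B = 0) (i : ℕ) {j : ℕ} (hj : i + j + 1 ≤ S.r) :
    S.initErr i j = matCLM (S.errMat i * S.augA ^ j) (join S.x0 S.z0 - Xr 0) := by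
  induction i generalizing j with
  | zero =>
    have hyref : iteratedDerivWithin j S.yref (Ici 0) 0
        = matCLM (S.augC * S.augA ^ j) (Xr 0) :=
      iteratedDerivWithin_eq_of_jet (J := fun j t => matCLM (S.augC * S.augA ^ j) (Xr t))
        (fun t ht => by simpa using hXr.yref_eq t ht)
        (fun j _ t _ => (hasDerivAt_matCLM_mul_pow S.augC j (hXr.hasDerivAt t)).hasDerivWithinAt)
        j le_rfl 0 le_rfl
    rw [initErr, hyref, errMat, outMat, map_sub, augC_mul_augA_pow_join _ _ hrel (by omega)]
  | succ i ih =>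
    rw [initErr, ih (by omega), ih (by omega), ← matCLM_smul, ← matCLM_add, errMat, errMat,
      outMat_succ_mul_pow]

theorem K2.mul_norm_lt_one (hK2 : S.K2) (hXr : S.IsReferenceTrajectory Xr)
    (hrel : ∀ j, j + 2 ≤ S.r → S.C * S.A ^ j * S.B = 0) {i : ℕ} (hi : i < S.r) :
    S.φ i 0 * ‖matCLM (S.errMat i) (join S.x0 S.z0 - Xr 0)‖ < 1 := by
  simpa only [hXr.initErr_eq hrel i (j := 0) (by omega), pow_zero, Matrix.mul_one]
    using hK2 i hi

theorem denom_init_pos (hr : 1 ≤ S.r) (hφ : IsFunnel (S.φ (S.r - 1))) (hK2 : S.K2)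
    (hrel : ∀ j, j + 2 ≤ S.r → S.C * S.A ^ j * S.B = 0) (hXr : S.IsReferenceTrajectory Xr) :
    0 < S.denom 0 (join S.x0 S.z0 - Xr 0) := by
  rw [denom, ← mul_pow, sub_pos]
  exact pow_lt_one₀ (mul_nonneg (hφ.nonneg le_rfl) (norm_nonneg _))
    (hK2.mul_norm_lt_one hXr hrel (by omega)) two_ne_zero

theorem continuousOn_denom {s : Set ℝ} (hs : s ⊆ Ici 0) (hφ : IsFunnel (S.φ (S.r - 1)))
    {X : ℝ → EuclideanSpace ℝ (Fin n ⊕ Fin p × Fin m)} (hX : ContinuousOn X s) :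
    ContinuousOn (fun t => S.denom t (X t)) s :=
  continuousOn_const.sub (((hφ.contDiffOn.continuousOn.mono hs).pow 2).mul
    ((S.lastCLM.continuous.comp_continuousOn hX).norm.pow 2))

theorem gainDenom_eq_denom (hv : S.auxErr ω x (S.r - 1) t = S.lastCLM v) :
    S.gainDenom ω x t = S.denom t v := by
  rw [gainDenom, lastErr, hv, denom]

theorem ctrl_eq_neg_smul (hv : S.auxErr ω x (S.r - 1) t = S.lastCLM v) :
    S.ctrl kr ω x t = -((kr / S.denom t v) • S.lastCLM v) := by
  rw [ctrl, gain, gainDenom_eq_denom hv, lastErr, hv]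

theorem truncField_eq_of_le_denom (hδ : δ ≤ S.denom t v) :
    truncField (matCLM S.augA) (matCLM S.augB) S.lastCLM (S.φ (S.r - 1)) kr δ t v
      = matCLM S.augA v - (kr / S.denom t v) • matCLM S.augB (S.lastCLM v) := by
  rw [denom] at hδ ⊢
  rw [truncField, truncGain, max_eq_right hδ]

/-! ### Solutions of the closed loop are classical and stay in the funnel -/

namespace IsSolution

theorem absolutelyContinuousOnInterval_join (h : S.IsSolution kr ω x z) {b : ℝ}
    (hb : b ∈ timeDomain ω) : AbsolutelyContinuousOnInterval (fun t => join (x t) (z t)) 0 b :=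
  (absolutelyContinuousOnInterval_clm_comp _ (h.ac_x b hb)).add
    (absolutelyContinuousOnInterval_clm_comp _ (h.ac_z b hb))

theorem ae_hasDerivAt_join (h : S.IsSolution kr ω x z) :
    ∀ᵐ t : ℝ, t ∈ timeDomain ω → HasDerivAt (fun s => join (x s) (z s))
      (matCLM S.augA (join (x t) (z t)) + matCLM S.augB (S.ctrl kr ω x t)) t := by
  filter_upwards [h.ode_x, h.ode_z] with t hx hz ht
  rw [augA_join_add_augB]
  exact ((matCLM (fromRows 1 0)).hasFDerivAt.comp_hasDerivAt t (hx ht)).add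
    ((matCLM (fromRows 0 1)).hasFDerivAt.comp_hasDerivAt t (hz ht))

theorem continuousOn_join (h : S.IsSolution kr ω x z) :
    ContinuousOn (fun t => join (x t) (z t)) (timeDomain ω) := by
  intro t ht
  obtain ⟨b, htb, hb⟩ := exists_gt_mem_timeDomain ht
  have hcont := (h.absolutelyContinuousOnInterval_join hb).continuousOn
  rw [uIcc_of_le hb.1] at hcont
  exact (hcont t ⟨ht.1, htb.le⟩).mono_of_mem_nhdsWithin (Icc_mem_nhdsWithin_timeDomain htb)

theorem continuousOn_deviation (h : S.IsSolution kr ω x z) (hXr : S.IsReferenceTrajectory Xr) :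
    ContinuousOn (deviation x z Xr) (timeDomain ω) :=
  h.continuousOn_join.sub fun t _ => (hXr.hasDerivAt t).continuousAt.continuousWithinAt

theorem hasDerivWithinAt_errMat_join (h : S.IsSolution kr ω x z)
    (hrel : ∀ j, j + 2 ≤ S.r → S.C * S.A ^ j * S.B = 0) {i : ℕ} (hi : i + 2 ≤ S.r)
    (ht : t ∈ timeDomain ω) :
    HasDerivWithinAt (fun s => matCLM (S.errMat i) (join (x s) (z s)))
      (matCLM (S.errMat i) (matCLM S.augA (join (x t) (z t)))) (timeDomain ω) t := by
  refine hasDerivWithinAt_of_absolutelyContinuousOnInterval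
    (g := fun t => matCLM (S.errMat i) (matCLM S.augA (join (x t) (z t))))
    (fun b hb => absolutelyContinuousOnInterval_clm_comp _
      (h.absolutelyContinuousOnInterval_join hb)) ?_
    (((matCLM (S.errMat i)).continuous.comp (matCLM S.augA).continuous).comp_continuousOn
      h.continuousOn_join) ht
  filter_upwards [h.ae_hasDerivAt_join] with s hs hsω
  simpa only [Function.comp_def, map_add, errMat_apply_augB hrel hi, add_zero]
    using (matCLM (S.errMat i)).hasFDerivAt.comp_hasDerivAt s (hs hsω)

theorem auxErr_eq (h : S.IsSolution kr ω x z) (hr : 1 ≤ S.r)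
    (hrel : ∀ j, j + 2 ≤ S.r → S.C * S.A ^ j * S.B = 0) (hXr : S.IsReferenceTrajectory Xr)
    {i : ℕ} (hi : i < S.r) (ht : t ∈ timeDomain ω) :
    S.auxErr ω x i t = matCLM (S.errMat i) (deviation x z Xr t) := by
  refine hXr.auxErr_eq hr hrel h.pos (fun i hi t ht => ?_) hi ht
  simp only [deviation, map_sub]
  exact (h.hasDerivWithinAt_errMat_join hrel hi ht).sub
    ((matCLM (S.errMat i)).hasFDerivAt.comp_hasDerivAt t (hXr.hasDerivAt t)).hasDerivWithinAt

theorem denom_ne_zero (h : S.IsSolution kr ω x z) (hr : 1 ≤ S.r)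
    (hrel : ∀ j, j + 2 ≤ S.r → S.C * S.A ^ j * S.B = 0) (hXr : S.IsReferenceTrajectory Xr)
    (ht : t ∈ timeDomain ω) : S.denom t (deviation x z Xr t) ≠ 0 := by
  rw [← gainDenom_eq_denom (h.auxErr_eq hr hrel hXr (by omega) ht)]
  exact h.gain_defined t ht

theorem denom_pos (h : S.IsSolution kr ω x z) (hr : 1 ≤ S.r) (hφ : IsFunnel (S.φ (S.r - 1)))
    (hK2 : S.K2) (hrel : ∀ j, j + 2 ≤ S.r → S.C * S.A ^ j * S.B = 0)
    (hXr : S.IsReferenceTrajectory Xr) (ht : t ∈ timeDomain ω) :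
    0 < S.denom t (deviation x z Xr t) := by
  have hinit : 0 < S.denom 0 (deviation x z Xr 0) := by
    rw [deviation, h.init_x, h.init_z]
    exact denom_init_pos hr hφ hK2 hrel hXr
  by_contra! hle
  obtain ⟨s, hs, hs0⟩ := (convex_timeDomain ω).isPreconnected.intermediate_value ht
    (zero_mem_timeDomain h.pos)
    (continuousOn_denom (timeDomain_subset ω) hφ (h.continuousOn_deviation hXr))
    ⟨hle, hinit.le⟩
  exact h.denom_ne_zero hr hrel hXr hs hs0

theorem continuousOn_ctrl (h : S.IsSolution kr ω x z) (hr : 1 ≤ S.r)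
    (hφ : IsFunnel (S.φ (S.r - 1))) (hrel : ∀ j, j + 2 ≤ S.r → S.C * S.A ^ j * S.B = 0)
    (hXr : S.IsReferenceTrajectory Xr) : ContinuousOn (S.ctrl kr ω x) (timeDomain ω) := by
  have hcont := h.continuousOn_deviation hXr
  have hgain : ContinuousOn (fun t => kr / S.denom t (deviation x z Xr t)) (timeDomain ω) :=
    continuousOn_const.div (continuousOn_denom (timeDomain_subset ω) hφ hcont)
      fun t ht => h.denom_ne_zero hr hrel hXr ht
  refine (hgain.smul (S.lastCLM.continuous.comp_continuousOn hcont)).neg.congr fun t ht => ?_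
  exact ctrl_eq_neg_smul (h.auxErr_eq hr hrel hXr (by omega) ht)

theorem hasDerivWithinAt_deviation (h : S.IsSolution kr ω x z) (hr : 1 ≤ S.r)
    (hφ : IsFunnel (S.φ (S.r - 1))) (hrel : ∀ j, j + 2 ≤ S.r → S.C * S.A ^ j * S.B = 0)
    (hXr : S.IsReferenceTrajectory Xr) (ht : t ∈ timeDomain ω) :
    HasDerivWithinAt (deviation x z Xr) (matCLM S.augA (deviation x z Xr t)
      - (kr / S.denom t (deviation x z Xr t)) •
        matCLM S.augB (S.lastCLM (deviation x z Xr t))) (timeDomain ω) t := by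
  have hjoin := hasDerivWithinAt_of_absolutelyContinuousOnInterval
    (fun b hb => h.absolutelyContinuousOnInterval_join hb) h.ae_hasDerivAt_join
    (((matCLM S.augA).continuous.comp_continuousOn h.continuousOn_join).add
      ((matCLM S.augB).continuous.comp_continuousOn (h.continuousOn_ctrl hr hφ hrel hXr))) ht
  refine (hjoin.sub (hXr.hasDerivAt t).hasDerivWithinAt).congr_deriv ?_
  rw [ctrl_eq_neg_smul (h.auxErr_eq hr hrel hXr (by omega) ht), map_neg, map_smul]
  simp only [deviation, map_sub]
  abel

theorem exists_le_denom (h : S.IsSolution kr ω x z) (hr : 1 ≤ S.r)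
    (hφ : IsFunnel (S.φ (S.r - 1))) (hK2 : S.K2)
    (hrel : ∀ j, j + 2 ≤ S.r → S.C * S.A ^ j * S.B = 0) (hXr : S.IsReferenceTrajectory Xr)
    (ht : t ∈ timeDomain ω) :
    ∃ δ, 0 < δ ∧ ∀ s ∈ Icc 0 t, δ ≤ S.denom s (deviation x z Xr s) := by
  have hsub := Icc_subset_timeDomain ht
  obtain ⟨s₀, hs₀, hmin⟩ := isCompact_Icc.exists_isMinOn ⟨0, le_rfl, ht.1⟩
    (continuousOn_denom Icc_subset_Ici_self hφ ((h.continuousOn_deviation hXr).mono hsub))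
  exact ⟨_, h.denom_pos hr hφ hK2 hrel hXr (hsub hs₀), fun s hs => hmin hs⟩

theorem hasDerivWithinAt_deviation_truncField (h : S.IsSolution kr ω x z) (hr : 1 ≤ S.r)
    (hφ : IsFunnel (S.φ (S.r - 1))) (hrel : ∀ j, j + 2 ≤ S.r → S.C * S.A ^ j * S.B = 0)
    (hXr : S.IsReferenceTrajectory Xr) (ht : t ∈ timeDomain ω)
    (hδ : δ ≤ S.denom t (deviation x z Xr t)) :
    HasDerivWithinAt (deviation x z Xr) (truncField (matCLM S.augA) (matCLM S.augB) S.lastCLM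
      (S.φ (S.r - 1)) kr δ t (deviation x z Xr t)) (Ici t) t := by
  rw [truncField_eq_of_le_denom hδ]
  obtain ⟨b, htb, hb⟩ := exists_gt_mem_timeDomain ht
  refine (h.hasDerivWithinAt_deviation hr hφ hrel hXr ht).mono_of_mem_nhdsWithin ?_
  filter_upwards [Icc_mem_nhdsGE htb] with s hs
  exact Icc_subset_timeDomain hb ⟨ht.1.trans hs.1, hs.2⟩

end IsSolution

end LoopData

theorem BoundedSignal.clm_comp {U V : Type*} [NormedAddCommGroup U] [NormedSpace ℝ U]
    [NormedAddCommGroup V] [NormedSpace ℝ V] (T : U →L[ℝ] V) {f : ℝ → U} (hf : BoundedSignal f) :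
    BoundedSignal fun t => T (f t) := by
  obtain ⟨M, hM⟩ := hf
  exact ⟨‖T‖ * M, fun t ht => T.le_opNorm_of_le (hM t ht)⟩

theorem BoundedSignal.add {U : Type*} [SeminormedAddCommGroup U] {f g : ℝ → U}
    (hf : BoundedSignal f) (hg : BoundedSignal g) : BoundedSignal fun t => f t + g t := by
  obtain ⟨M, hM⟩ := hf
  obtain ⟨N, hN⟩ := hg
  exact ⟨M + N, fun t ht => norm_add_le_of_le (hM t ht) (hN t ht)⟩

namespace LoopData

variable {n m p : ℕ} {S : LoopData n m p} {kr δ t : ℝ}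
  {Xr : ℝ → EuclideanSpace ℝ (Fin n ⊕ Fin p × Fin m)}
  {x : ℝ → EuclideanSpace ℝ (Fin n)} {z : ℝ → EuclideanSpace ℝ (Fin p × Fin m)}

/-! ### The global solution of the closed loop -/

/-- `(x, z)` starts at the initial values of the closed loop, and its deviation from the reference
trajectory `Xr` is a global classical solution of the error dynamics along which the denominator of
the gain is at least `δ > 0`. -/
structure IsFunnelTrajectory (S : LoopData n m p) (kr δ : ℝ)
    (Xr : ℝ → EuclideanSpace ℝ (Fin n ⊕ Fin p × Fin m)) (x : ℝ → EuclideanSpace ℝ (Fin n))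
    (z : ℝ → EuclideanSpace ℝ (Fin p × Fin m)) : Prop where
  isReferenceTrajectory : S.IsReferenceTrajectory Xr
  isFunnelSolution : IsFunnelSolution (matCLM S.augA) (matCLM S.augB) S.lastCLM (S.φ (S.r - 1))
    kr δ (deviation x z Xr)
  init_x : x 0 = S.x0
  init_z : z 0 = S.z0

theorem IsReferenceTrajectory.exists_isFunnelTrajectory (hXr : S.IsReferenceTrajectory Xr)
    {Q : EuclideanSpace ℝ (Fin n ⊕ Fin p × Fin m) →L[ℝ]
      EuclideanSpace ℝ (Fin n ⊕ Fin p × Fin m)} {a c C γ : ℝ}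
    (hQ : IsEnergyForm (matCLM S.augA) (matCLM S.augB) S.lastCLM Q a c C γ) (hr : 1 ≤ S.r)
    (hrel : ∀ j, j + 2 ≤ S.r → S.C * S.A ^ j * S.B = 0) (hφ : IsFunnel (S.φ (S.r - 1)))
    (hK2 : S.K2) (hkr : 0 < kr) :
    ∃ δ x z, S.IsFunnelTrajectory kr δ Xr x z ∧ BoundedSignal (deviation x z Xr) ∧
      (C ≤ 2 * kr * γ → Tendsto (deviation x z Xr) atTop (𝓝 0)) := by
  obtain ⟨δ, E, hE, hE0, hbdd, hlim⟩ := hQ.exists_isFunnelSolution hφ hkr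
    (hK2.mul_norm_lt_one hXr hrel (by omega))
  set x : ℝ → EuclideanSpace ℝ (Fin n) := fun t => stateX (E t + Xr t)
  set z : ℝ → EuclideanSpace ℝ (Fin p × Fin m) := fun t => stateZ (E t + Xr t)
  have hdev : deviation x z Xr = E := by
    funext t
    simp only [deviation, x, z, join_stateX_stateZ, add_sub_cancel_right]
  refine ⟨δ, x, z, ⟨hXr, hdev ▸ hE, ?_, ?_⟩, hdev ▸ hbdd, hdev ▸ hlim⟩
  · simp only [x, hE0, sub_add_cancel, stateX_join]
  · simp only [z, hE0, sub_add_cancel, stateZ_join]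

namespace IsFunnelTrajectory

theorem hasDerivAt_deviation (h : S.IsFunnelTrajectory kr δ Xr x z) (ht : 0 ≤ t) :
    HasDerivAt (deviation x z Xr) (matCLM S.augA (deviation x z Xr t)
      - (kr / S.denom t (deviation x z Xr t)) •
        matCLM S.augB (S.lastCLM (deviation x z Xr t))) t :=
  h.isFunnelSolution.hasDerivAt t ht

theorem le_denom (h : S.IsFunnelTrajectory kr δ Xr x z) (ht : 0 ≤ t) :
    δ ≤ S.denom t (deviation x z Xr t) :=
  h.isFunnelSolution.le_denom t ht

theorem denom_pos (h : S.IsFunnelTrajectory kr δ Xr x z) (ht : 0 ≤ t) :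
    0 < S.denom t (deviation x z Xr t) :=
  h.isFunnelSolution.δ_pos.trans_le (h.le_denom ht)

theorem join_eq (x : ℝ → EuclideanSpace ℝ (Fin n)) (z : ℝ → EuclideanSpace ℝ (Fin p × Fin m))
    (Xr : ℝ → EuclideanSpace ℝ (Fin n ⊕ Fin p × Fin m)) :
    (fun t => join (x t) (z t)) = fun t => deviation x z Xr t + Xr t :=
  funext fun _ => (sub_add_cancel _ _).symm

theorem hasDerivWithinAt_errMat (h : S.IsFunnelTrajectory kr δ Xr x z)
    (hrel : ∀ j, j + 2 ≤ S.r → S.C * S.A ^ j * S.B = 0) {i : ℕ} (hi : i + 2 ≤ S.r)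
    (ht : 0 ≤ t) :
    HasDerivWithinAt (fun s => matCLM (S.errMat i) (deviation x z Xr s))
      (matCLM (S.errMat i) (matCLM S.augA (deviation x z Xr t))) (Ici 0) t := by
  simpa only [Function.comp_def, map_sub, map_smul, errMat_apply_augB hrel hi, smul_zero, sub_zero]
    using ((matCLM (S.errMat i)).hasFDerivAt.comp_hasDerivAt t
      (h.hasDerivAt_deviation ht)).hasDerivWithinAt (s := Ici 0)

theorem auxErr_eq (h : S.IsFunnelTrajectory kr δ Xr x z) (hr : 1 ≤ S.r)
    (hrel : ∀ j, j + 2 ≤ S.r → S.C * S.A ^ j * S.B = 0) {i : ℕ} (hi : i < S.r) (ht : 0 ≤ t) :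
    S.auxErr ⊤ x i t = matCLM (S.errMat i) (deviation x z Xr t) := by
  refine h.isReferenceTrajectory.auxErr_eq hr hrel EReal.zero_lt_top (fun i hi t ht => ?_) hi
    (timeDomain_top ▸ ht)
  rw [timeDomain_top] at ht ⊢
  exact h.hasDerivWithinAt_errMat hrel hi ht

theorem hasDerivAt_join (h : S.IsFunnelTrajectory kr δ Xr x z) (hr : 1 ≤ S.r)
    (hrel : ∀ j, j + 2 ≤ S.r → S.C * S.A ^ j * S.B = 0) (ht : 0 ≤ t) :
    HasDerivAt (fun s => join (x s) (z s))
      (matCLM S.augA (join (x t) (z t)) + matCLM S.augB (S.ctrl kr ⊤ x t)) t := by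
  rw [join_eq x z Xr]
  refine ((h.hasDerivAt_deviation ht).add
    (h.isReferenceTrajectory.hasDerivAt t)).congr_deriv ?_
  rw [ctrl_eq_neg_smul (h.auxErr_eq hr hrel (by omega) ht), map_neg, map_smul, deviation,
    map_sub]
  abel

theorem continuousOn_deriv_join (h : S.IsFunnelTrajectory kr δ Xr x z) (hr : 1 ≤ S.r)
    (hrel : ∀ j, j + 2 ≤ S.r → S.C * S.A ^ j * S.B = 0) (hφ : IsFunnel (S.φ (S.r - 1))) :
    ContinuousOn (fun t => matCLM S.augA (join (x t) (z t)) + matCLM S.augB (S.ctrl kr ⊤ x t))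
      (Ici 0) := by
  have hdev : ContinuousOn (deviation x z Xr) (Ici 0) := fun t ht =>
    (h.hasDerivAt_deviation ht).continuousAt.continuousWithinAt
  have hjoin : ContinuousOn (fun t => join (x t) (z t)) (Ici 0) := fun t ht =>
    (h.hasDerivAt_join hr hrel ht).continuousAt.continuousWithinAt
  have hgain : ContinuousOn (fun t => kr / S.denom t (deviation x z Xr t)) (Ici 0) :=
    continuousOn_const.div (continuousOn_denom subset_rfl hφ hdev) fun t ht => (h.denom_pos ht).ne'
  have hctrl : ContinuousOn (S.ctrl kr ⊤ x) (Ici 0) :=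
    (hgain.smul (S.lastCLM.continuous.comp_continuousOn hdev)).neg.congr fun t ht =>
      ctrl_eq_neg_smul (h.auxErr_eq hr hrel (by omega) ht)
  exact ((matCLM S.augA).continuous.comp_continuousOn hjoin).add
    ((matCLM S.augB).continuous.comp_continuousOn hctrl)

theorem absolutelyContinuousOnInterval_join (h : S.IsFunnelTrajectory kr δ Xr x z) (hr : 1 ≤ S.r)
    (hrel : ∀ j, j + 2 ≤ S.r → S.C * S.A ^ j * S.B = 0) (hφ : IsFunnel (S.φ (S.r - 1)))
    {b : ℝ} (hb : 0 ≤ b) : AbsolutelyContinuousOnInterval (fun t => join (x t) (z t)) 0 b :=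
  absolutelyContinuousOnInterval_of_hasDerivAt hb (fun _ ht => h.hasDerivAt_join hr hrel ht)
    (h.continuousOn_deriv_join hr hrel hφ)

theorem hasDerivAt_x (h : S.IsFunnelTrajectory kr δ Xr x z) (hr : 1 ≤ S.r)
    (hrel : ∀ j, j + 2 ≤ S.r → S.C * S.A ^ j * S.B = 0) (ht : 0 ≤ t) :
    HasDerivAt x (toEuclideanLin S.A (x t) + toEuclideanLin S.B (S.input kr ⊤ x z t)) t := by
  have hjoin := h.hasDerivAt_join hr hrel ht
  rw [augA_join_add_augB] at hjoin
  simpa only [Function.comp_def, stateX_join, input]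
    using (stateX (n := n) (m := m) (p := p)).hasFDerivAt.comp_hasDerivAt t hjoin

theorem hasDerivAt_z (h : S.IsFunnelTrajectory kr δ Xr x z) (hr : 1 ≤ S.r)
    (hrel : ∀ j, j + 2 ≤ S.r → S.C * S.A ^ j * S.B = 0) (ht : 0 ≤ t) :
    HasDerivAt z (toEuclideanLin S.At (z t) + toEuclideanLin S.Bt (S.ctrl kr ⊤ x t)) t := by
  have hjoin := h.hasDerivAt_join hr hrel ht
  rw [augA_join_add_augB] at hjoin
  simpa only [Function.comp_def, stateZ_join]
    using (stateZ (n := n) (m := m) (p := p)).hasFDerivAt.comp_hasDerivAt t hjoin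

theorem isSolution (h : S.IsFunnelTrajectory kr δ Xr x z) (hr : 1 ≤ S.r)
    (hrel : ∀ j, j + 2 ≤ S.r → S.C * S.A ^ j * S.B = 0) (hφ : IsFunnel (S.φ (S.r - 1))) :
    S.IsSolution kr ⊤ x z where
  pos := EReal.zero_lt_top
  ac_x b hb := by
    simpa only [stateX_join] using absolutelyContinuousOnInterval_clm_comp stateX
      (h.absolutelyContinuousOnInterval_join hr hrel hφ hb.1)
  ac_z b hb := by
    simpa only [stateZ_join] using absolutelyContinuousOnInterval_clm_comp stateZ
      (h.absolutelyContinuousOnInterval_join hr hrel hφ hb.1)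
  init_x := h.init_x
  init_z := h.init_z
  gain_defined t ht := by
    rw [gainDenom_eq_denom (h.auxErr_eq hr hrel (by omega) ht.1)]
    exact (h.denom_pos ht.1).ne'
  ode_x := Eventually.of_forall fun _ ht => h.hasDerivAt_x hr hrel ht.1
  ode_z := Eventually.of_forall fun _ ht => h.hasDerivAt_z hr hrel ht.1

/-! ### Uniqueness -/

section Uniqueness

variable {ω : EReal} {x' : ℝ → EuclideanSpace ℝ (Fin n)}
  {z' : ℝ → EuclideanSpace ℝ (Fin p × Fin m)}

theorem deviation_eq_of_isSolution (h : S.IsFunnelTrajectory kr δ Xr x z) (hkr : 0 ≤ kr)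
    (hr : 1 ≤ S.r) (hrel : ∀ j, j + 2 ≤ S.r → S.C * S.A ^ j * S.B = 0)
    (hφ : IsFunnel (S.φ (S.r - 1))) (hK2 : S.K2) (hs : S.IsSolution kr ω x' z')
    (ht : t ∈ timeDomain ω) : deviation x' z' Xr t = deviation x z Xr t := by
  have hXr := h.isReferenceTrajectory
  obtain ⟨δ', hδ', hle⟩ := hs.exists_le_denom hr hφ hK2 hrel hXr ht
  have hsub := Icc_subset_timeDomain ht
  refine eqOn_of_truncField (A := matCLM S.augA) (B := matCLM S.augB) (L := S.lastCLM) hkr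
    (lt_min h.isFunnelSolution.δ_pos hδ') (fun s hs => hφ.nonneg hs)
    ((hs.continuousOn_deviation hXr).mono hsub)
    (fun s hs => (h.hasDerivAt_deviation hs.1).continuousAt.continuousWithinAt)
    (fun s hst => ?_) (fun s hst => ?_) ?_ ⟨ht.1, le_rfl⟩
  · have hst := Ico_subset_Icc_self hst
    exact hs.hasDerivWithinAt_deviation_truncField hr hφ hrel hXr (hsub hst)
      ((min_le_right _ _).trans (hle s hst))
  · rw [truncField_eq_of_le_denom ((min_le_left _ _).trans (h.le_denom hst.1))]
    exact (h.hasDerivAt_deviation hst.1).hasDerivWithinAt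
  · rw [deviation, deviation, hs.init_x, hs.init_z, h.init_x, h.init_z]

theorem eqOn_of_isSolution (h : S.IsFunnelTrajectory kr δ Xr x z) (hkr : 0 ≤ kr)
    (hr : 1 ≤ S.r) (hrel : ∀ j, j + 2 ≤ S.r → S.C * S.A ^ j * S.B = 0)
    (hφ : IsFunnel (S.φ (S.r - 1))) (hK2 : S.K2) (hs : S.IsSolution kr ω x' z') :
    EqOn x' x (timeDomain ω) ∧ EqOn z' z (timeDomain ω) := by
  have hjoin (t : ℝ) (ht : t ∈ timeDomain ω) : join (x' t) (z' t) = join (x t) (z t) :=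
    sub_left_injective (h.deviation_eq_of_isSolution hkr hr hrel hφ hK2 hs ht)
  exact ⟨fun t ht => by simpa only [stateX_join] using congrArg stateX (hjoin t ht),
    fun t ht => by simpa only [stateZ_join] using congrArg stateZ (hjoin t ht)⟩

theorem eq_of_isMaximalSolution (h : S.IsFunnelTrajectory kr δ Xr x z) (hkr : 0 ≤ kr)
    (hr : 1 ≤ S.r) (hrel : ∀ j, j + 2 ≤ S.r → S.C * S.A ^ j * S.B = 0)
    (hφ : IsFunnel (S.φ (S.r - 1))) (hK2 : S.K2) (hs : S.IsMaximalSolution kr ω x' z') :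
    ω = ⊤ ∧ EqOn x' x (timeDomain ⊤) ∧ EqOn z' z (timeDomain ⊤) := by
  obtain ⟨hx, hz⟩ := h.eqOn_of_isSolution hkr hr hrel hφ hK2 hs.1
  obtain rfl : ω = ⊤ := by
    by_contra hω
    exact hs.2 ⊤ x z (lt_top_iff_ne_top.2 hω) (h.isSolution hr hrel hφ) ⟨hx.symm, hz.symm⟩
  exact ⟨rfl, hx, hz⟩

end Uniqueness

/-! ### Funnel bounds, boundedness and convergence -/

theorem exists_last_funnel_bound (h : S.IsFunnelTrajectory kr δ Xr x z) :
    ∃ ε : ℝ, 0 < ε ∧ ε < 1 ∧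
      ∀ t, 0 ≤ t → S.φ (S.r - 1) t * ‖S.lastCLM (deviation x z Xr t)‖ ≤ ε := by
  refine ⟨max (1 / 2) √(1 - δ), lt_max_of_lt_left (by norm_num), max_lt (by norm_num) ?_,
    fun t ht => le_max_of_le_right (Real.le_sqrt_of_sq_le ?_)⟩
  · rw [Real.sqrt_lt' one_pos]
    linarith [h.isFunnelSolution.δ_pos]
  · rw [mul_pow]
    linarith [h.isFunnelSolution.le_denom t ht]

theorem exists_funnel_bound_of_succ (h : S.IsFunnelTrajectory kr δ Xr x z)
    (hrel : ∀ j, j + 2 ≤ S.r → S.C * S.A ^ j * S.B = 0)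
    (hφ : ∀ i, i < S.r → IsFunnel (S.φ i)) (hK1 : S.K1) (hK2 : S.K2) {i : ℕ}
    (hi : i + 1 < S.r)
    (hsucc : ∀ t, 0 ≤ t → S.φ (i + 1) t * ‖matCLM (S.errMat (i + 1)) (deviation x z Xr t)‖ ≤ 1) :
    ∃ ε : ℝ, 0 < ε ∧ ε < 1 ∧
      ∀ t, 0 ≤ t → S.φ i t * ‖matCLM (S.errMat i) (deviation x z Xr t)‖ ≤ ε := by
  refine exists_funnel_bound_of_cascade (hφ i (by omega)) (hφ (i + 1) hi) (hK1 i hi)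
    (fun t ht => ?_) ?_ hsucc
  · rw [errMat_succ_apply, add_sub_cancel_right]
    exact h.hasDerivWithinAt_errMat hrel hi ht
  · rw [deviation, h.init_x, h.init_z]
    exact hK2.mul_norm_lt_one h.isReferenceTrajectory hrel (by omega)

theorem exists_funnel_bound (h : S.IsFunnelTrajectory kr δ Xr x z) (hr : 1 ≤ S.r)
    (hrel : ∀ j, j + 2 ≤ S.r → S.C * S.A ^ j * S.B = 0)
    (hφ : ∀ i, i < S.r → IsFunnel (S.φ i)) (hK1 : S.K1) (hK2 : S.K2) {i : ℕ} (hi : i < S.r) :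
    ∃ ε : ℝ, 0 < ε ∧ ε < 1 ∧ ∀ t, 0 ≤ t → S.φ i t * ‖S.auxErr ⊤ x i t‖ ≤ ε := by
  suffices hbound : ∃ ε : ℝ, 0 < ε ∧ ε < 1 ∧
      ∀ t, 0 ≤ t → S.φ i t * ‖matCLM (S.errMat i) (deviation x z Xr t)‖ ≤ ε by
    obtain ⟨ε, hε0, hε1, hε⟩ := hbound
    exact ⟨ε, hε0, hε1, fun t ht => by rw [h.auxErr_eq hr hrel hi ht]; exact hε t ht⟩
  refine Nat.decreasingInduction' (n := S.r - 1) (P := fun i => ∃ ε : ℝ, 0 < ε ∧ ε < 1 ∧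
    ∀ t, 0 ≤ t → S.φ i t * ‖matCLM (S.errMat i) (deviation x z Xr t)‖ ≤ ε)
    (fun i hi _ hsucc => ?_) (by omega : i ≤ S.r - 1) h.exists_last_funnel_bound
  obtain ⟨ε, -, hε1, hε⟩ := hsucc
  exact h.exists_funnel_bound_of_succ hrel hφ hK1 hK2 (by omega)
    fun t ht => (hε t ht).trans hε1.le

theorem boundedSignal_gain (h : S.IsFunnelTrajectory kr δ Xr x z) (hkr : 0 ≤ kr) (hr : 1 ≤ S.r)
    (hrel : ∀ j, j + 2 ≤ S.r → S.C * S.A ^ j * S.B = 0) : BoundedSignal (S.gain kr ⊤ x) := by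
  refine ⟨kr / δ, fun t ht => ?_⟩
  rw [gain, gainDenom_eq_denom (h.auxErr_eq hr hrel (by omega) ht),
    Real.norm_of_nonneg (div_nonneg hkr (h.denom_pos ht).le)]
  exact div_le_div_of_nonneg_left hkr h.isFunnelSolution.δ_pos (h.le_denom ht)

theorem boundedSignal_ctrl (h : S.IsFunnelTrajectory kr δ Xr x z) (hkr : 0 ≤ kr) (hr : 1 ≤ S.r)
    (hrel : ∀ j, j + 2 ≤ S.r → S.C * S.A ^ j * S.B = 0)
    (hdev : BoundedSignal (deviation x z Xr)) : BoundedSignal (S.ctrl kr ⊤ x) := by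
  obtain ⟨G, hG⟩ := h.boundedSignal_gain hkr hr hrel
  obtain ⟨M, hM⟩ := hdev.clm_comp S.lastCLM
  refine ⟨G * M, fun t ht => ?_⟩
  rw [ctrl, norm_neg, norm_smul, lastErr, h.auxErr_eq hr hrel (by omega) ht]
  exact mul_le_mul (hG t ht) (hM t ht) (norm_nonneg _) ((norm_nonneg _).trans (hG t ht))

theorem boundedSignal_states_and_input (h : S.IsFunnelTrajectory kr δ Xr x z) (hkr : 0 ≤ kr)
    (hr : 1 ≤ S.r) (hrel : ∀ j, j + 2 ≤ S.r → S.C * S.A ^ j * S.B = 0)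
    (hdev : BoundedSignal (deviation x z Xr)) (hXr : BoundedSignal Xr) :
    BoundedSignal x ∧ BoundedSignal z ∧ BoundedSignal (S.input kr ⊤ x z) := by
  have hjoin : BoundedSignal fun t => join (x t) (z t) := join_eq x z Xr ▸ hdev.add hXr
  have hx : BoundedSignal x := by simpa only [stateX_join] using hjoin.clm_comp stateX
  have hz : BoundedSignal z := by simpa only [stateZ_join] using hjoin.clm_comp stateZ
  exact ⟨hx, hz, (hz.clm_comp (matCLM S.Ct)).add (h.boundedSignal_ctrl hkr hr hrel hdev)⟩

theorem hasDerivAt_augC_mul_augA_pow (h : S.IsFunnelTrajectory kr δ Xr x z)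
    (hrel : ∀ j, j + 2 ≤ S.r → S.C * S.A ^ j * S.B = 0) {j : ℕ} (hj : j + 2 ≤ S.r)
    (ht : 0 ≤ t) :
    HasDerivAt (fun s => matCLM (S.augC * S.augA ^ j) (deviation x z Xr s))
      (matCLM (S.augC * S.augA ^ (j + 1)) (deviation x z Xr t)) t := by
  refine ((matCLM (S.augC * S.augA ^ j)).hasFDerivAt.comp_hasDerivAt t
    (h.hasDerivAt_deviation ht)).congr_deriv ?_
  rw [map_sub, map_smul, ← matCLM_mul, ← matCLM_mul,
    augC_mul_augA_pow_mul_augB_eq_zero hrel j hj, matCLM_zero, smul_zero, sub_zero,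
    Matrix.mul_assoc, ← pow_succ]

theorem tendsto_iteratedDerivWithin_trackErr (h : S.IsFunnelTrajectory kr δ Xr x z) (hr : 1 ≤ S.r)
    (hrel : ∀ j, j + 2 ≤ S.r → S.C * S.A ^ j * S.B = 0)
    (hlim : Tendsto (deviation x z Xr) atTop (𝓝 0)) {i : ℕ} (hi : i < S.r) :
    Tendsto (fun t => iteratedDerivWithin i (S.trackErr x) (Ici 0) t) atTop (𝓝 0) := by
  have hjet (t : ℝ) (ht : 0 ≤ t) : iteratedDerivWithin i (S.trackErr x) (Ici 0) t
      = matCLM (S.augC * S.augA ^ i) (deviation x z Xr t) :=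
    iteratedDerivWithin_eq_of_jet (N := S.r - 1)
      (J := fun j t => matCLM (S.augC * S.augA ^ j) (deviation x z Xr t))
      (fun t ht => by
        rw [h.isReferenceTrajectory.trackErr_eq hr hrel z ht, pow_zero, Matrix.mul_one])
      (fun j hj t ht => (h.hasDerivAt_augC_mul_augA_pow hrel (by omega) ht).hasDerivWithinAt)
      i (by omega) t ht
  have hout := ((matCLM (S.augC * S.augA ^ i)).continuous.tendsto 0).comp hlim
  rw [map_zero] at hout
  refine hout.congr' ?_
  filter_upwards [eventually_ge_atTop 0] with t ht
  exact (hjet t ht).symm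

end IsFunnelTrajectory

end LoopData

end FunnelIM

theorem mainTheorem1 {n m p : ℕ} (S : FunnelIM.LoopData n m p) (α : Polynomial ℝ)
    (hr : 1 ≤ S.r)
    (hsys : FunnelIM.InSystemClass S.A S.B S.C S.r)
    (hmonic : α.Monic)
    (hα : FunnelIM.RootsAvoidZeros S.A S.B S.C α)
    (him : FunnelIM.IsInternalModel α S.At S.Bt S.Ct)
    (href : S.yref ∈ FunnelIM.RefClass m α)
    (hφ : ∀ i, i < S.r → FunnelIM.IsFunnel (S.φ i))
    (hk : ∀ i, i + 1 < S.r → 0 < S.k i)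
    (hK1 : S.K1) (hK2 : S.K2) :
    ∃ krStar : ℝ, 0 < krStar ∧ ∀ kr : ℝ, 0 < kr →
      ∃ (ω : EReal) (x : ℝ → EuclideanSpace ℝ (Fin n))
        (z : ℝ → EuclideanSpace ℝ (Fin p × Fin m)),
        -- existence and uniqueness of a maximal solution
        S.IsMaximalSolution kr ω x z ∧
        (∀ (ω' : EReal) (x' : ℝ → EuclideanSpace ℝ (Fin n))
          (z' : ℝ → EuclideanSpace ℝ (Fin p × Fin m)), S.IsMaximalSolution kr ω' x' z' →
            ω' = ω ∧ Set.EqOn x' x (FunnelIM.timeDomain ω) ∧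
              Set.EqOn z' z (FunnelIM.timeDomain ω)) ∧
        -- (i) global existence
        ω = ⊤ ∧
        -- (ii) all errors evolve uniformly in their funnels
        (∀ i, i < S.r → ∃ ε : ℝ, 0 < ε ∧ ε < 1 ∧
          ∀ t, 0 ≤ t → S.φ i t * ‖S.auxErr ω x i t‖ ≤ ε) ∧
        -- (iii) boundedness of the signals
        FunnelIM.BoundedSignal (S.gain kr ω x) ∧
        (FunnelIM.BoundedSignal S.yref →
          FunnelIM.BoundedSignal x ∧ FunnelIM.BoundedSignal z ∧
            FunnelIM.BoundedSignal (S.input kr ω x z)) ∧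
        -- (iv) asymptotic tracking for sufficiently large `k_r`
        (krStar ≤ kr → ∀ i, i < S.r →
          Filter.Tendsto (fun t => iteratedDerivWithin i (S.trackErr x) (Set.Ici 0) t)
            Filter.atTop (𝓝 0)) := by
  obtain ⟨Ah, bh, ch, hbm⟩ := him.exists_blockModel hmonic
  have hrel := hsys.relDegree.1
  have hφr := hφ (S.r - 1) (by omega)
  obtain ⟨Q, a, c, C, γ, hQ⟩ := FunnelIM.LoopData.exists_isEnergyForm hr hsys hbm hk
  obtain ⟨Xr, hXr, hXrb⟩ := FunnelIM.LoopData.exists_isReferenceTrajectory hmonic hα hbm href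
  have hγ : 0 < 2 * γ := mul_pos two_pos hQ.γ_pos
  refine ⟨C / (2 * γ), div_pos hQ.C_pos hγ, fun kr hkr => ?_⟩
  obtain ⟨δ, x, z, h, hdev, hlim⟩ := hXr.exists_isFunnelTrajectory hQ hr hrel hφr hK2 hkr
  refine ⟨⊤, x, z, ⟨h.isSolution hr hrel hφr, fun _ _ _ hω => absurd hω not_top_lt⟩,
    fun _ _ _ hs => h.eq_of_isMaximalSolution hkr.le hr hrel hφr hK2 hs, rfl,
    fun i hi => h.exists_funnel_bound hr hrel hφ hK1 hK2 hi,
    h.boundedSignal_gain hkr.le hr hrel,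
    fun hb => h.boundedSignal_states_and_input hkr.le hr hrel hdev (hXrb hb),
    fun hle i hi => h.tendsto_iteratedDerivWithin_trackErr hr hrel (hlim ?_) hi⟩
  rw [div_le_iff₀ hγ] at hle
  linarith
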